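/- Let $(M,\langle\cdot,\cdot\rangle)$ be a complete connected Riemannian manifold of dimension $n\ge 2$, let $\eta\in C^\infty(M)$, and let $T$ be a smooth symmetric positive definite divergence-free $(1,1)$-tensor field on $M$ which is bounded: there are constants $\varepsilon,\delta>0$ with $\varepsilon\le\langle Tv,v\rangle\le\delta$ for all unit tangent vectors $v$. With the convention $R(X,Y)Z=\nabla_Y\nabla_XZ-\nabla_X\nabla_YZ+\nabla_{[X,Y]}Z$ put $$R_T(X,Y)=\operatorname{tr}\bigl(T\circ(Z\mapsto R(X,Z)Y)\bigr),\qquad \operatorname{div}_\eta T=\operatorname{div}T-d\eta\circ T,\qquad R_{\eta,T}=R_T-\nabla(\operatorname{div}_\eta T)^\sharp .$$ Fix $p\in M$, let $r(x)=d(p,x)$ and $\partial_r=\nabla r$, and let $\gamma:[0,\ell]\to M$ be a minimal geodesic segment with unit speed and $\gamma(0)=p$ such that $\gamma(t)\notin\mathrm{Cut}(p)$ for $0<t\le\ell$ (that is, $r$ is smooth near $\gamma(t)$). For $0<r\le\ell$ let $$H_{\eta,T}(r)=\sum_{i=1}^{n-1}\langle T(\nabla_{e_i}\partial_r),e_i\rangle-\langle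 T(\nabla\eta),\partial_r\rangle\quad\text{at }\gamma(r),$$ where $e_1,\dots,e_{n-1}$ is an orthonormal basis of $\partial_r^{\perp}$; this is the generalized weighted mean curvature of the geodesic sphere of radius $r$ about $p$. For real $c$ let $sn_c$ be the solution of $sn_c''+c\,sn_c=0$, $sn_c(0)=0$, $sn_c'(0)=1$, and for real $m$ put $H_c^m=(m-1)\,sn_c'/sn_c$ and $H_c=H_c^n$; for an integer $m\ge 2$, $H_c^m(r)$ is the mean curvature of the geodesic sphere of radius $r$ in the simply connected space form of dimension $m$ and curvature $c$. Assume that along $\gamma$ (for $0<t\le\ell$) the vector $\partial_r$ is an eigenvector of $T$, $\nabla_{\partial_r}T=0$, and $R_{\eta,T}(\partial_r,\partial_r)\ge(n-1)c\delta$. (a) Let $a\ge0$ and suppose that $\partial_r\eta\ge-a$ along $\gamma$. Then for all $r\in(0,\ell]$, with $r\le\pi/(2\sqrt c)$ when $c>0$, $$H_{\eta,T}(r)\le\delta\,(H_c(r)+a).$$ Equality holds at $r$ if and only if, along $\gamma$ on $(0,r]$, all radial sectional curvatures are equal to $c$, $\partial_r\eta=-a$, and $T$ attains its upper bound in the following sense: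 $T=\delta\,\mathrm{Id}$ on $\partial_r^\perp$ if $c\le0$, and $T\partial_r=\delta\,\partial_r$ if $a\ne0$. (b) Suppose that $|\eta|\le k$ along $\gamma$. Then for $r\in(0,\ell]$: if $c\le0$, or if $c>0$ and $r\le\pi/(4\sqrt c)$, then $$H_{\eta,T}(r)\le\delta\,H_c^{n+4k}(r);$$ if $c>0$ and $\pi/(4\sqrt c)\le r<\pi/(2\sqrt c)$, then $$H_{\eta,T}(r)\le\Bigl(1+\frac{4k}{n-1}\cdot\frac1{\sin(2\sqrt c\,r)}\Bigr)\delta\,H_c(r),$$ and at $r=\pi/(2\sqrt c)$ the limit of this bound holds, $H_{\eta,T}(r)\le2k\sqrt c\,\delta$. In particular, if $c=0$, then $H_{\eta,T}(r)\le\delta\,\dfrac{n+4k-1}{r}\le\delta\,\dfrac{n+4k+1}{r}$. -/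

import Mathlib

open Bundle Set Filter FiberBundle
open scoped Manifold ContDiff Topology InnerProductSpace

noncomputable section

namespace RadialComparison

variable {E : Type*} [NormedAddCommGroup E] [NormedSpace ℝ E] [FiniteDimensional ℝ E]
  {M : Type*} [MetricSpace M] [ChartedSpace E M] [IsManifold 𝓘(ℝ, E) ∞ M]
  [RiemannianBundle (fun x : M ↦ TangentSpace 𝓘(ℝ, E) x)]
  [IsContMDiffRiemannianBundle 𝓘(ℝ, E) ∞ E (fun x : M ↦ TangentSpace 𝓘(ℝ, E) x)]

instance (x : M) : FiniteDimensional ℝ (TangentSpace 𝓘(ℝ, E) x) :=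
  inferInstanceAs (FiniteDimensional ℝ E)

set_option linter.unusedSectionVars false

theorem mdiffAt_inner {Y Z : Π x : M, TangentSpace 𝓘(ℝ, E) x} {x : M}
    (hY : MDiffAt (T% Y) x) (hZ : MDiffAt (T% Z) x) :
    MDiffAt (fun y ↦ ⟪Y y, Z y⟫_ℝ) x :=
  MDifferentiableAt.inner_bundle (E := fun x : M ↦ TangentSpace 𝓘(ℝ, E) x) (b := fun y : M ↦ y)
    (v := Y) (w := Z) hY hZ

/-- The right-hand side of the Koszul formula: for the Levi-Civita connection it is
`2 ⟨∇_X Y, Z⟩` at `x`. -/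
def koszul (X Y Z : Π x : M, TangentSpace 𝓘(ℝ, E) x) (x : M) : ℝ :=
  mvfderiv 𝓘(ℝ, E) (fun y ↦ ⟪Y y, Z y⟫_ℝ) x (X x)
    + mvfderiv 𝓘(ℝ, E) (fun y ↦ ⟪X y, Z y⟫_ℝ) x (Y x)
    - mvfderiv 𝓘(ℝ, E) (fun y ↦ ⟪X y, Y y⟫_ℝ) x (Z x)
    + ⟪VectorField.mlieBracket 𝓘(ℝ, E) X Y x, Z x⟫_ℝ
    - ⟪VectorField.mlieBracket 𝓘(ℝ, E) X Z x, Y x⟫_ℝ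
    - ⟪VectorField.mlieBracket 𝓘(ℝ, E) Y Z x, X x⟫_ℝ

theorem tensorialAt_koszul_left {Y Z : Π x : M, TangentSpace 𝓘(ℝ, E) x} {x : M}
    (hY : MDiffAt (T% Y) x) (hZ : MDiffAt (T% Z) x) :
    TensorialAt 𝓘(ℝ, E) E (fun X ↦ koszul X Y Z x) x where
  smul {f X} hf hX := by
    have h1 : mvfderiv 𝓘(ℝ, E) (fun y ↦ ⟪(f • X) y, Z y⟫_ℝ) x
        = f x • mvfderiv 𝓘(ℝ, E) (fun y ↦ ⟪X y, Z y⟫_ℝ) x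
          + ⟪X x, Z x⟫_ℝ • mvfderiv 𝓘(ℝ, E) f x := by
      rw [← mvfderiv_mul hf (mdiffAt_inner hX hZ)]
      congr 1; ext y; simp [real_inner_smul_left]
    have h2 : mvfderiv 𝓘(ℝ, E) (fun y ↦ ⟪(f • X) y, Y y⟫_ℝ) x
        = f x • mvfderiv 𝓘(ℝ, E) (fun y ↦ ⟪X y, Y y⟫_ℝ) x
          + ⟪X x, Y x⟫_ℝ • mvfderiv 𝓘(ℝ, E) f x := by
      rw [← mvfderiv_mul hf (mdiffAt_inner hX hY)]
      congr 1; ext y; simp [real_inner_smul_left]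
    simp only [koszul, h1, h2, VectorField.mlieBracket_smul_left hf hX]
    simp [inner_add_left, inner_smul_left, inner_smul_right]
    ring
  add {X X'} hX hX' := by
    have h1 : mvfderiv 𝓘(ℝ, E) (fun y ↦ ⟪(X + X') y, Z y⟫_ℝ) x
        = mvfderiv 𝓘(ℝ, E) (fun y ↦ ⟪X y, Z y⟫_ℝ) x
          + mvfderiv 𝓘(ℝ, E) (fun y ↦ ⟪X' y, Z y⟫_ℝ) x := by
      rw [← mvfderiv_add (mdiffAt_inner hX hZ) (mdiffAt_inner hX' hZ)]
      congr 1; ext y; simp [inner_add_left]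
    have h2 : mvfderiv 𝓘(ℝ, E) (fun y ↦ ⟪(X + X') y, Y y⟫_ℝ) x
        = mvfderiv 𝓘(ℝ, E) (fun y ↦ ⟪X y, Y y⟫_ℝ) x
          + mvfderiv 𝓘(ℝ, E) (fun y ↦ ⟪X' y, Y y⟫_ℝ) x := by
      rw [← mvfderiv_add (mdiffAt_inner hX hY) (mdiffAt_inner hX' hY)]
      congr 1; ext y; simp [inner_add_left]
    simp only [koszul, h1, h2, VectorField.mlieBracket_add_left hX hX']
    simp [inner_add_left, inner_add_right]
    ring

theorem tensorialAt_koszul_right {X Y : Π x : M, TangentSpace 𝓘(ℝ, E) x} {x : M}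
    (hX : MDiffAt (T% X) x) (hY : MDiffAt (T% Y) x) :
    TensorialAt 𝓘(ℝ, E) E (fun Z ↦ koszul X Y Z x) x where
  smul {f Z} hf hZ := by
    have h1 : mvfderiv 𝓘(ℝ, E) (fun y ↦ ⟪Y y, (f • Z) y⟫_ℝ) x
        = f x • mvfderiv 𝓘(ℝ, E) (fun y ↦ ⟪Y y, Z y⟫_ℝ) x
          + ⟪Y x, Z x⟫_ℝ • mvfderiv 𝓘(ℝ, E) f x := by
      rw [← mvfderiv_mul hf (mdiffAt_inner hY hZ)]
      congr 1; ext y; simp [real_inner_smul_right]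
    have h2 : mvfderiv 𝓘(ℝ, E) (fun y ↦ ⟪X y, (f • Z) y⟫_ℝ) x
        = f x • mvfderiv 𝓘(ℝ, E) (fun y ↦ ⟪X y, Z y⟫_ℝ) x
          + ⟪X x, Z x⟫_ℝ • mvfderiv 𝓘(ℝ, E) f x := by
      rw [← mvfderiv_mul hf (mdiffAt_inner hX hZ)]
      congr 1; ext y; simp [real_inner_smul_right]
    simp only [koszul, h1, h2, VectorField.mlieBracket_smul_right hf hZ]
    simp [inner_add_left, inner_smul_left, inner_smul_right, real_inner_comm]
    ring
  add {Z Z'} hZ hZ' := by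
    have h1 : mvfderiv 𝓘(ℝ, E) (fun y ↦ ⟪Y y, (Z + Z') y⟫_ℝ) x
        = mvfderiv 𝓘(ℝ, E) (fun y ↦ ⟪Y y, Z y⟫_ℝ) x
          + mvfderiv 𝓘(ℝ, E) (fun y ↦ ⟪Y y, Z' y⟫_ℝ) x := by
      rw [← mvfderiv_add (mdiffAt_inner hY hZ) (mdiffAt_inner hY hZ')]
      congr 1; ext y; simp [inner_add_right]
    have h2 : mvfderiv 𝓘(ℝ, E) (fun y ↦ ⟪X y, (Z + Z') y⟫_ℝ) x
        = mvfderiv 𝓘(ℝ, E) (fun y ↦ ⟪X y, Z y⟫_ℝ) x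
          + mvfderiv 𝓘(ℝ, E) (fun y ↦ ⟪X y, Z' y⟫_ℝ) x := by
      rw [← mvfderiv_add (mdiffAt_inner hX hZ) (mdiffAt_inner hX hZ')]
      congr 1; ext y; simp [inner_add_right]
    simp only [koszul, h1, h2, VectorField.mlieBracket_add_right hZ hZ']
    simp [inner_add_left, inner_add_right]
    ring

/-- For a vector field `Y` that is differentiable at `x`, the bilinear form
`(u, v) ↦ 2 ⟨∇_u Y, v⟩` on the tangent space at `x` given by the Koszul formula. -/
def koszulForm (Y : Π x : M, TangentSpace 𝓘(ℝ, E) x) (x : M) (hY : MDiffAt (T% Y) x) :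
    TangentSpace 𝓘(ℝ, E) x →L[ℝ] TangentSpace 𝓘(ℝ, E) x →L[ℝ] ℝ :=
  TensorialAt.mkHom₂ (fun X Z ↦ koszul X Y Z x) x
    (fun _ hZ ↦ tensorialAt_koszul_left hY hZ) (fun _ hX ↦ tensorialAt_koszul_right hX hY)

open scoped Classical in
/-- The Levi-Civita derivative `u ↦ ∇_u Y` at `x`, obtained from the Koszul formula
(and zero where `Y` is not differentiable). -/
def leviCivitaAux (Y : Π x : M, TangentSpace 𝓘(ℝ, E) x) (x : M) :
    TangentSpace 𝓘(ℝ, E) x →L[ℝ] TangentSpace 𝓘(ℝ, E) x :=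
  if hY : MDiffAt (T% Y) x then
    (1 / 2 : ℝ) • ∑ i, ((koszulForm Y x hY).flip
      (stdOrthonormalBasis ℝ (TangentSpace 𝓘(ℝ, E) x) i)).smulRight
      (stdOrthonormalBasis ℝ (TangentSpace 𝓘(ℝ, E) x) i)
  else 0

theorem inner_leviCivitaAux {Y : Π x : M, TangentSpace 𝓘(ℝ, E) x} {x : M}
    (hY : MDiffAt (T% Y) x) (u v : TangentSpace 𝓘(ℝ, E) x) :
    ⟪leviCivitaAux Y x u, v⟫_ℝ = koszulForm Y x hY u v / 2 := by
  have h : v = ∑ i, ⟪stdOrthonormalBasis ℝ (TangentSpace 𝓘(ℝ, E) x) i, v⟫_ℝ •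
      stdOrthonormalBasis ℝ (TangentSpace 𝓘(ℝ, E) x) i :=
    ((stdOrthonormalBasis ℝ (TangentSpace 𝓘(ℝ, E) x)).sum_repr' v).symm
  conv_rhs => rw [h]
  simp only [leviCivitaAux, dif_pos hY]
  simp [sum_inner, inner_smul_left, Finset.sum_div, Finset.mul_sum]
  refine Finset.sum_congr rfl fun i _ ↦ ?_
  ring

theorem inner_leviCivitaAux_eq_koszul {X Y Z : Π x : M, TangentSpace 𝓘(ℝ, E) x} {x : M}
    (hX : MDiffAt (T% X) x) (hY : MDiffAt (T% Y) x) (hZ : MDiffAt (T% Z) x) :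
    ⟪leviCivitaAux Y x (X x), Z x⟫_ℝ = koszul X Y Z x / 2 := by
  rw [inner_leviCivitaAux hY, koszulForm, TensorialAt.mkHom₂_apply _ _ hX hZ]

theorem koszul_add_middle {X Y Y' Z : Π x : M, TangentSpace 𝓘(ℝ, E) x} {x : M}
    (hX : MDiffAt (T% X) x) (hY : MDiffAt (T% Y) x) (hY' : MDiffAt (T% Y') x)
    (hZ : MDiffAt (T% Z) x) :
    koszul X (Y + Y') Z x = koszul X Y Z x + koszul X Y' Z x := by
  have h1 : mvfderiv 𝓘(ℝ, E) (fun y ↦ ⟪(Y + Y') y, Z y⟫_ℝ) x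
      = mvfderiv 𝓘(ℝ, E) (fun y ↦ ⟪Y y, Z y⟫_ℝ) x
        + mvfderiv 𝓘(ℝ, E) (fun y ↦ ⟪Y' y, Z y⟫_ℝ) x := by
    rw [← mvfderiv_add (mdiffAt_inner hY hZ) (mdiffAt_inner hY' hZ)]
    congr 1; ext y; simp [inner_add_left]
  have h2 : mvfderiv 𝓘(ℝ, E) (fun y ↦ ⟪X y, (Y + Y') y⟫_ℝ) x
      = mvfderiv 𝓘(ℝ, E) (fun y ↦ ⟪X y, Y y⟫_ℝ) x
        + mvfderiv 𝓘(ℝ, E) (fun y ↦ ⟪X y, Y' y⟫_ℝ) x := by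
    rw [← mvfderiv_add (mdiffAt_inner hX hY) (mdiffAt_inner hX hY')]
    congr 1; ext y; simp [inner_add_right]
  simp only [koszul, h1, h2, VectorField.mlieBracket_add_left hY hY',
    VectorField.mlieBracket_add_right hY hY']
  simp [inner_add_left, inner_add_right]
  ring

theorem koszul_smul_middle {X Y Z : Π x : M, TangentSpace 𝓘(ℝ, E) x} {f : M → ℝ} {x : M}
    (hX : MDiffAt (T% X) x) (hY : MDiffAt (T% Y) x) (hZ : MDiffAt (T% Z) x) (hf : MDiffAt f x) :
    koszul X (f • Y) Z x
      = f x * koszul X Y Z x + 2 * (mvfderiv 𝓘(ℝ, E) f x (X x) * ⟪Y x, Z x⟫_ℝ) := by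
  have h1 : mvfderiv 𝓘(ℝ, E) (fun y ↦ ⟪(f • Y) y, Z y⟫_ℝ) x
      = f x • mvfderiv 𝓘(ℝ, E) (fun y ↦ ⟪Y y, Z y⟫_ℝ) x
        + ⟪Y x, Z x⟫_ℝ • mvfderiv 𝓘(ℝ, E) f x := by
    rw [← mvfderiv_mul hf (mdiffAt_inner hY hZ)]
    congr 1; ext y; simp [real_inner_smul_left]
  have h2 : mvfderiv 𝓘(ℝ, E) (fun y ↦ ⟪X y, (f • Y) y⟫_ℝ) x
      = f x • mvfderiv 𝓘(ℝ, E) (fun y ↦ ⟪X y, Y y⟫_ℝ) x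
        + ⟪X x, Y x⟫_ℝ • mvfderiv 𝓘(ℝ, E) f x := by
    rw [← mvfderiv_mul hf (mdiffAt_inner hX hY)]
    congr 1; ext y; simp [real_inner_smul_right]
  simp only [koszul, h1, h2, VectorField.mlieBracket_smul_left hf hY,
    VectorField.mlieBracket_smul_right hf hY]
  simp [inner_add_left, inner_smul_left, inner_smul_right, real_inner_comm]
  ring

theorem mdiffAt_add_field {Y Y' : Π x : M, TangentSpace 𝓘(ℝ, E) x} {x : M}
    (hY : MDiffAt (T% Y) x) (hY' : MDiffAt (T% Y') x) : MDiffAt (T% (Y + Y')) x :=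
  mdifferentiableAt_add_section hY hY'

theorem mdiffAt_smul_field {Y : Π x : M, TangentSpace 𝓘(ℝ, E) x} {f : M → ℝ} {x : M}
    (hY : MDiffAt (T% Y) x) (hf : MDiffAt f x) : MDiffAt (T% (f • Y)) x :=
  MDifferentiableAt.smul_section hf hY

/-- The Levi-Civita connection; `leviCivita Y x u` is `∇_u Y`. -/
def leviCivita : CovariantDerivative 𝓘(ℝ, E) E (fun x : M ↦ TangentSpace 𝓘(ℝ, E) x) where
  toFun := leviCivitaAux
  isCovariantDerivativeOnUniv :=
    { add := by
        intro Y Y' x hY hY' _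
        ext u
        refine ext_inner_right ℝ fun v ↦ ?_
        have hu := mdifferentiableAt_extend 𝓘(ℝ, E) E u
        have hv := mdifferentiableAt_extend 𝓘(ℝ, E) E v
        have h1 := inner_leviCivitaAux_eq_koszul hu hY hv
        have h2 := inner_leviCivitaAux_eq_koszul hu hY' hv
        have h3 := inner_leviCivitaAux_eq_koszul hu (mdiffAt_add_field hY hY') hv
        rw [koszul_add_middle hu hY hY' hv] at h3
        simp only [extend_apply_self] at h1 h2 h3
        rw [h3, add_apply, inner_add_left, h1, h2]
        ring
      leibniz := by
        intro Y f x hY hf _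
        ext u
        refine ext_inner_right ℝ fun v ↦ ?_
        have hu := mdifferentiableAt_extend 𝓘(ℝ, E) E u
        have hv := mdifferentiableAt_extend 𝓘(ℝ, E) E v
        have h1 := inner_leviCivitaAux_eq_koszul hu hY hv
        have h3 := inner_leviCivitaAux_eq_koszul hu (mdiffAt_smul_field hY hf) hv
        rw [koszul_smul_middle hu hY hv hf] at h3
        simp only [extend_apply_self] at h1 h3
        rw [h3, add_apply, inner_add_left, smul_apply,
          real_inner_smul_left, h1, ContinuousLinearMap.smulRight_apply, real_inner_smul_left]
        ring }

/-- The Levi-Civita connection is compatible with the metric. -/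
theorem leviCivita_metric {X Y Z : Π x : M, TangentSpace 𝓘(ℝ, E) x} {x : M}
    (hX : MDiffAt (T% X) x) (hY : MDiffAt (T% Y) x) (hZ : MDiffAt (T% Z) x) :
    mvfderiv 𝓘(ℝ, E) (fun y ↦ ⟪Y y, Z y⟫_ℝ) x (X x)
      = ⟪leviCivita Y x (X x), Z x⟫_ℝ + ⟪Y x, leviCivita Z x (X x)⟫_ℝ := by
  have h1 : ⟪leviCivita Y x (X x), Z x⟫_ℝ = _ := inner_leviCivitaAux_eq_koszul hX hY hZ
  have h2 : ⟪leviCivita Z x (X x), Y x⟫_ℝ = _ := inner_leviCivitaAux_eq_koszul hX hZ hY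
  rw [real_inner_comm (leviCivita Z x (X x)), h1, h2]
  have e : (fun y ↦ ⟪Z y, Y y⟫_ℝ) = fun y ↦ ⟪Y y, Z y⟫_ℝ := funext fun y ↦ real_inner_comm _ _
  simp only [koszul, e, VectorField.mlieBracket_swap_apply (V := Z) (W := Y), inner_neg_left]
  ring

/-- The Levi-Civita connection is torsion-free. -/
theorem leviCivita_torsion {X Y : Π x : M, TangentSpace 𝓘(ℝ, E) x} {x : M}
    (hX : MDiffAt (T% X) x) (hY : MDiffAt (T% Y) x) :
    leviCivita Y x (X x) - leviCivita X x (Y x) = VectorField.mlieBracket 𝓘(ℝ, E) X Y x := by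
  refine ext_inner_right ℝ fun v ↦ ?_
  have hv := mdifferentiableAt_extend 𝓘(ℝ, E) E v
  have h1 : ⟪leviCivita Y x (X x), extend E v x⟫_ℝ = _ := inner_leviCivitaAux_eq_koszul hX hY hv
  have h2 : ⟪leviCivita X x (Y x), extend E v x⟫_ℝ = _ := inner_leviCivitaAux_eq_koszul hY hX hv
  simp only [koszul, extend_apply_self] at h1 h2
  rw [inner_sub_left, h1, h2, VectorField.mlieBracket_swap_apply (V := Y) (W := X), inner_neg_left]
  simp only [real_inner_comm (Y _) (X _)]
  ring

/-- The Riemann curvature `R(u, v)w = ∇_V ∇_U W - ∇_U ∇_V W + ∇_[U, V] W` at `x`, where `U, V, W`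
are smooth local extensions of `u, v, w`. With this sign convention the sectional curvature of the
plane spanned by orthonormal `u, v` is `⟨R(u, v)u, v⟩`. -/
def curvature (x : M) (u v w : TangentSpace 𝓘(ℝ, E) x) : TangentSpace 𝓘(ℝ, E) x :=
  leviCivita (fun y ↦ leviCivita (extend E w) y (extend E u y)) x v
    - leviCivita (fun y ↦ leviCivita (extend E w) y (extend E v y)) x u
    + leviCivita (extend E w) x
        (VectorField.mlieBracket 𝓘(ℝ, E) (extend E u) (extend E v) x)

/-- The gradient of a function. -/
def grad (f : M → ℝ) (x : M) : TangentSpace 𝓘(ℝ, E) x :=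
  ∑ i, mvfderiv 𝓘(ℝ, E) f x (stdOrthonormalBasis ℝ (TangentSpace 𝓘(ℝ, E) x) i) •
    stdOrthonormalBasis ℝ (TangentSpace 𝓘(ℝ, E) x) i

/-- The covariant derivative of a `(1,1)`-tensor field: `(∇_u T)(v) = ∇_u (T V) - T (∇_u V)`,
with `V` a smooth local extension of `v`. -/
def covTensor (T : Π x : M, TangentSpace 𝓘(ℝ, E) x →L[ℝ] TangentSpace 𝓘(ℝ, E) x) (x : M)
    (u v : TangentSpace 𝓘(ℝ, E) x) : TangentSpace 𝓘(ℝ, E) x :=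
  leviCivita (fun y ↦ T y (extend E v y)) x u - T x (leviCivita (extend E v) x u)

/-- The divergence of a `(1,1)`-tensor field, `(div T)(v) = tr (u ↦ (∇_u T)(v))`. -/
def divTensor (T : Π x : M, TangentSpace 𝓘(ℝ, E) x →L[ℝ] TangentSpace 𝓘(ℝ, E) x) (x : M)
    (v : TangentSpace 𝓘(ℝ, E) x) : ℝ :=
  ∑ i, ⟪covTensor T x (stdOrthonormalBasis ℝ (TangentSpace 𝓘(ℝ, E) x) i) v,
    stdOrthonormalBasis ℝ (TangentSpace 𝓘(ℝ, E) x) i⟫_ℝ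

/-- The vector field `(div_η T)^♯` dual to the one-form `div_η T = div T - dη ∘ T`. -/
def weightedDivSharp (η : M → ℝ)
    (T : Π x : M, TangentSpace 𝓘(ℝ, E) x →L[ℝ] TangentSpace 𝓘(ℝ, E) x) (x : M) :
    TangentSpace 𝓘(ℝ, E) x :=
  ∑ i, (divTensor T x (stdOrthonormalBasis ℝ (TangentSpace 𝓘(ℝ, E) x) i)
      - mvfderiv 𝓘(ℝ, E) η x (T x (stdOrthonormalBasis ℝ (TangentSpace 𝓘(ℝ, E) x) i))) •
    stdOrthonormalBasis ℝ (TangentSpace 𝓘(ℝ, E) x) i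

/-- `R_T(u, v) = tr (T ∘ (z ↦ R(u, z)v))`. -/
def ricciT (T : Π x : M, TangentSpace 𝓘(ℝ, E) x →L[ℝ] TangentSpace 𝓘(ℝ, E) x) (x : M)
    (u v : TangentSpace 𝓘(ℝ, E) x) : ℝ :=
  ∑ i, ⟪T x (curvature x u (stdOrthonormalBasis ℝ (TangentSpace 𝓘(ℝ, E) x) i) v),
    stdOrthonormalBasis ℝ (TangentSpace 𝓘(ℝ, E) x) i⟫_ℝ

/-- `R_{η,T} = R_T - ∇ (div_η T)^♯`. -/
def ricciEtaT (η : M → ℝ)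
    (T : Π x : M, TangentSpace 𝓘(ℝ, E) x →L[ℝ] TangentSpace 𝓘(ℝ, E) x) (x : M)
    (u v : TangentSpace 𝓘(ℝ, E) x) : ℝ :=
  ricciT T x u v - ⟪leviCivita (weightedDivSharp η T) x u, v⟫_ℝ

/-- The radial field `∂_r`: the gradient of the distance from `p`. -/
def radial (p : M) (x : M) : TangentSpace 𝓘(ℝ, E) x := grad (fun y ↦ dist p y) x

/-- The generalized weighted mean curvature `H_{η,T} = ∑ ⟨T (A e_i), e_i⟩ - ⟨T ∇η, ν⟩` at `x` of the
geodesic sphere centred at `p` through `x`, with unit normal `ν = ∂_r` and shape operator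
`A u = ∇_u ν`; the `e_i` form an orthonormal basis of the hyperplane orthogonal to `ν`. -/
def meanCurvature (η : M → ℝ)
    (T : Π x : M, TangentSpace 𝓘(ℝ, E) x →L[ℝ] TangentSpace 𝓘(ℝ, E) x) (p x : M) : ℝ :=
  (∑ i, ⟪T x (leviCivita (radial p) x
        (stdOrthonormalBasis ℝ ↥(ℝ ∙ (radial p x : TangentSpace 𝓘(ℝ, E) x))ᗮ i)),
      (stdOrthonormalBasis ℝ ↥(ℝ ∙ (radial p x : TangentSpace 𝓘(ℝ, E) x))ᗮ i :
        TangentSpace 𝓘(ℝ, E) x)⟫_ℝ)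
    - ⟪T x (grad η x), radial p x⟫_ℝ

variable (E) in
/-- The set of points near which the distance from `p` is smooth. On a complete Riemannian manifold
this is the complement of `Cut(p) ∪ {p}`, where `Cut(p)` is the cut locus of `p`. -/
def distSmoothSet (p : M) : Set M :=
  {x | ∀ᶠ y in 𝓝 x, ContMDiffAt 𝓘(ℝ, E) 𝓘(ℝ, ℝ) ∞ (fun z ↦ dist p z) y}

variable (E) in
/-- `γ` restricted to `[0, ℓ]` is a minimal geodesic segment from `p`, parametrized by arc length. -/
structure IsMinimalGeodesic (γ : ℝ → M) (p : M) (ℓ : ℝ) : Prop where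
  start : γ 0 = p
  smooth : ContMDiffOn 𝓘(ℝ, ℝ) 𝓘(ℝ, E) ∞ γ (Icc 0 ℓ)
  dist_eq : ∀ s ∈ Icc 0 ℓ, ∀ t ∈ Icc 0 ℓ, dist (γ s) (γ t) = |s - t|

/-- The solution of `f'' + c f = 0`, `f 0 = 0`, `f' 0 = 1`. -/
def sn (c r : ℝ) : ℝ :=
  if 0 < c then Real.sin (√c * r) / √c
  else if c = 0 then r
  else Real.sinh (√(-c) * r) / √(-c)

/-- The mean curvature `(m - 1) sn_c' / sn_c` of the geodesic sphere of radius `r` in the simply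
connected space form of dimension `m` and constant curvature `c`; as usual in comparison theorems
the same formula is used for a real parameter `m`. -/
def modelMeanCurvature (c m r : ℝ) : ℝ := (m - 1) * (deriv (sn c) r / sn c r)

end RadialComparison

end

/-!
Let `X = ∂_r`, `A = ∇X` and `h = tr (T ∘ A)` along `γ`. The distance function satisfies `|∇r| = 1`
and `γ' = X`, so `∇_X A = -A² - R(X, ·)X`. As `T` is radially parallel, `h' = -tr (T A²) - R_T(X, X)`;
since `div T = 0`, the term `⟨T ∇η, X⟩` in `H = H_{η,T}` accounts exactly for the difference of `R_T`
and `R_{η,T}`, and `H' = -tr (T A²) - R_{η,T}(X, X)` (`mvfderiv_traceMeanCurvature`). The radial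
eigenvalue `m ≤ δ` of `T` is constant, so `h = H + m (η ∘ γ)'`.

Let `P` be the projection to `X^⊥`. As `tr (T (A - s P)²) ≥ 0` and `tr (T P) ≤ (n - 1) δ`,
`H' ≤ -(2 s (H + m (η ∘ γ)') - s² (n - 1) δ) - (n - 1) c δ` for every real `s` (`RiccatiInequality`).
This already bounds `H` by a multiple of `1 / t`. With `s = ψ = sn_c' / sn_c` it says that
`sn_c² H - (n - 1) δ sn_c sn_c' - δ a sn_c²`, respectively
`sn_c² H - (n - 1) δ sn_c sn_c' + 2 m sn_c sn_c' (η - k)` after an integration by parts, decreases, and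
both functions tend to `0` at `0`. The first gives (a), the second gives (b) as long as
`(sn_c sn_c')' = sn_c' (2 ·) ≥ 0`; beyond `π / (4 √c)` the constant `k` is replaced by `-k`.

If equality holds in (a) at `r`, the decreasing function vanishes on `(0, r]`, all inequalities are
equalities, and `A = ψ P` (`RadialSetting.umbilical_of_eq`), so that the Riccati equation gives the
radial curvatures (`RadialSetting.curvature_of_umbilical`).

Conversely, let the radial curvatures be equal to `c`. The function `w = sn_c⁴ tr (B²)`, with
`B = A - ψ P`, satisfies `w' = -2 sn_c⁴ tr (B³)`, and it has to be shown that `w = 0`. The Riccati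
equation with constant curvature has other solutions, so an initial condition is needed, and it
suffices that `A ≥ κ / t` on `X^⊥` for some `κ > 0` and small `t`: then `B ≥ -(1 - k) / t` with `k > 0`,
so `w' ≤ 2 ((1 - k) / t) w`, while `w = O(t²)`, which forces `w = 0` (`eq_zero_of_deriv_le`).

The lower bound on `A` (`exists_shape_lower_bound`) is proved without Jacobi fields or the exponential
map. In a chart at `p`, a calibration bounds the length of the curves from `p` to points near `γ t`
from below by a function with a positive definite Hessian (`exists_length_sq_lower_bound`). It touches
`r²` at `γ t`, and comparing second derivatives there gives the bound.
-/

noncomputable section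

namespace RadialComparison

variable {E : Type*} [NormedAddCommGroup E] [NormedSpace ℝ E] [FiniteDimensional ℝ E]
  {M : Type*} [MetricSpace M] [ChartedSpace E M] [IsManifold 𝓘(ℝ, E) ∞ M]
  [RiemannianBundle (fun x : M ↦ TangentSpace 𝓘(ℝ, E) x)]
  [IsContMDiffRiemannianBundle 𝓘(ℝ, E) ∞ E (fun x : M ↦ TangentSpace 𝓘(ℝ, E) x)]

set_option linter.unusedSectionVars false


/-! ### Smoothness of gradients and of covariant derivatives -/

theorem extend_eq_symm (x y : M) (v : TangentSpace 𝓘(ℝ, E) x) :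
    extend E v y = (trivializationAt E (TangentSpace 𝓘(ℝ, E)) x).symm y v := by
  have : (trivializationAt E (TangentSpace 𝓘(ℝ, E)) x ⟨x, v⟩).2 = v :=
    (tangentBundleCore 𝓘(ℝ, E) M).coordChange_self (achart E x) x (mem_chart_source E x) v
  simp only [extend]
  rw [this]

theorem extend_eq_mfderiv_symm {x y : M} (hy : y ∈ (chartAt E x).source)
    (v : TangentSpace 𝓘(ℝ, E) x) :
    extend E v y = mfderiv 𝓘(ℝ, E) 𝓘(ℝ, E) (extChartAt 𝓘(ℝ, E) x).symm
      (extChartAt 𝓘(ℝ, E) x y) v := by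
  have h := TangentBundle.symmL_trivializationAt (I := 𝓘(ℝ, E)) hy
  rw [modelWithCornersSelf_coe, range_id, mfderivWithin_univ] at h
  rw [extend_eq_symm, ← h]
  exact (Trivialization.symmL_apply (R := ℝ) (trivializationAt E (TangentSpace 𝓘(ℝ, E)) x)
    (by simpa using hy) v).symm

/-- The derivative of a function in the direction of a field that is constant in the chart at `x`
is a partial derivative of its coordinate expression. -/
theorem mvfderiv_extend {x y : M} (hy : y ∈ (chartAt E x).source) {f : M → ℝ} (hf : MDiffAt f y)
    (v : TangentSpace 𝓘(ℝ, E) x) :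
    mvfderiv 𝓘(ℝ, E) f y (extend E v y)
      = fderiv ℝ (f ∘ (extChartAt 𝓘(ℝ, E) x).symm) (extChartAt 𝓘(ℝ, E) x y) v := by
  have hl : (extChartAt 𝓘(ℝ, E) x).symm (extChartAt 𝓘(ℝ, E) x y) = y :=
    (extChartAt 𝓘(ℝ, E) x).left_inv (by simpa using hy)
  have hs : MDifferentiableAt 𝓘(ℝ, E) 𝓘(ℝ, E) (extChartAt 𝓘(ℝ, E) x).symm
      (extChartAt 𝓘(ℝ, E) x y) := by
    have := mdifferentiableWithinAt_extChartAt_symm (I := 𝓘(ℝ, E)) (x := x)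
      (z := extChartAt 𝓘(ℝ, E) x y) ((extChartAt 𝓘(ℝ, E) x).map_source (by simpa using hy))
    simpa [mdifferentiableWithinAt_univ] using this
  rw [extend_eq_mfderiv_symm hy]
  rw [← mfderiv_eq_fderiv, mfderiv_comp _ (by rwa [hl]) hs]
  rw [hl]
  rfl

theorem contDiffAt_comp_symm {x : M} {f : M → ℝ} {n : ℕ∞ω}
    (hf : CMDiffAt n f x) :
    ContDiffAt ℝ n (f ∘ (extChartAt 𝓘(ℝ, E) x).symm) (extChartAt 𝓘(ℝ, E) x x) := by
  have := (contMDiffAt_iff.1 hf).2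
  simpa only [writtenInExtChartAt, modelWithCornersSelf_coe, range_id, contDiffWithinAt_univ] using! this

theorem contMDiffAt_mvfderiv_extend {x : M} {f : M → ℝ} {k : ℕ}
    (hf : CMDiffAt (k + 1 : ℕ) f x) (v : TangentSpace 𝓘(ℝ, E) x) :
    CMDiffAt k (fun y ↦ mvfderiv 𝓘(ℝ, E) f y (extend E v y)) x := by
  have h1 := contDiffAt_comp_symm hf
  have h2 : ContDiffAt ℝ k (fun ξ ↦ fderiv ℝ (f ∘ (extChartAt 𝓘(ℝ, E) x).symm) ξ v)
      (extChartAt 𝓘(ℝ, E) x x) :=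
    (h1.fderiv_right (m := k) (by norm_cast)).clm_apply contDiffAt_const
  have h3 : CMDiffAt k ((fun ξ ↦ fderiv ℝ (f ∘ (extChartAt 𝓘(ℝ, E) x).symm) ξ v) ∘
      (extChartAt 𝓘(ℝ, E) x)) x :=
    h2.contMDiffAt.comp x contMDiffAt_extChartAt
  refine h3.congr_of_eventuallyEq ?_
  have hf' : ∀ᶠ y in 𝓝 x, CMDiffAt (k + 1 : ℕ) f y :=
    (contMDiffAt_iff_contMDiffAt_nhds (by exact_mod_cast ENat.natCast_ne_top _)).1 hf
  filter_upwards [hf', chart_source_mem_nhds E x] with y hy1 hy2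
  exact mvfderiv_extend hy2 (hy1.mdifferentiableAt (by norm_cast)) v

variable (E) in
/-- A fixed basis of the model space, regarded as a basis of the tangent space at `x`. -/
def tangentBasis (x : M) :
    Module.Basis (Fin (Module.finrank ℝ E)) ℝ (TangentSpace 𝓘(ℝ, E) x) :=
  Module.finBasis ℝ E

/-- The coordinate frame at `x`: the fields with constant coefficients in the chart at `x`. -/
def frame (x : M) (i : Fin (Module.finrank ℝ E)) : Π y : M, TangentSpace 𝓘(ℝ, E) y :=
  extend E (tangentBasis E x i)

variable (E) in
/-- The Gram matrix, with respect to the metric, of the coordinate frame at `x`. -/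
def gram (x y : M) : Matrix (Fin (Module.finrank ℝ E)) (Fin (Module.finrank ℝ E)) ℝ := fun i j ↦
  ⟪frame (E := E) x i y, frame (E := E) x j y⟫_ℝ

/-- The coordinates of a vector field with respect to the coordinate frame at `x`. -/
def frameCoeff (x : M) (Y : Π x : M, TangentSpace 𝓘(ℝ, E) x)
    (i : Fin (Module.finrank ℝ E)) : M → ℝ :=
  LinearMap.piApply ((trivializationAt E (TangentSpace 𝓘(ℝ, E)) x).localFrameCoeff
    𝓘(ℝ, E) (Module.finBasis ℝ E) i) Y

theorem localFrame_eq_extend {x y : M} (hy : y ∈ (chartAt E x).source)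
    (i : Fin (Module.finrank ℝ E)) :
    (trivializationAt E (TangentSpace 𝓘(ℝ, E)) x).localFrame (Module.finBasis ℝ E) i y
      = frame x i y := by
  rw [frame, extend_eq_symm, Trivialization.localFrame_apply_of_mem_baseSet _ _ (by simpa using hy)]
  simp only [Trivialization.basisAt, Module.Basis.map_apply]
  rfl

theorem eq_sum_frameCoeff {x y : M} (hy : y ∈ (chartAt E x).source)
    (Y : Π x : M, TangentSpace 𝓘(ℝ, E) x) :
    Y y = ∑ i, frameCoeff x Y i y •
      frame x i y := by
  rw [Trivialization.eq_sum_localFrameCoeff_smul (I := 𝓘(ℝ, E)) (s := Y)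
    (e := trivializationAt E (TangentSpace 𝓘(ℝ, E)) x) (b := Module.finBasis ℝ E)
    (by simpa using hy)]
  refine Finset.sum_congr rfl fun i _ ↦ ?_
  rw [localFrame_eq_extend hy]
  rfl

theorem eventually_eq_sum_frameCoeff (x : M) (Y : Π x : M, TangentSpace 𝓘(ℝ, E) x) :
    ∀ᶠ y in 𝓝 x, Y y = ∑ i, frameCoeff x Y i y •
      frame x i y := by
  filter_upwards [chart_source_mem_nhds E x] with y hy using eq_sum_frameCoeff hy Y

theorem mdiffAt_frameCoeff {x : M} {Y : Π x : M, TangentSpace 𝓘(ℝ, E) x}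
    (hY : MDiffAt (T% Y) x) (i : Fin (Module.finrank ℝ E)) : MDiffAt (frameCoeff x Y i) x :=
  mdifferentiableAt_localFrameCoeff _ (by simp) hY i

theorem contMDiffAt_frameCoeff {x : M} {Y : Π x : M, TangentSpace 𝓘(ℝ, E) x} {k : ℕ}
    (hY : CMDiffAt k (T% Y) x) (i : Fin (Module.finrank ℝ E)) :
    CMDiffAt k (frameCoeff x Y i) x :=
  contMDiffAt_localFrameCoeff _ (by simp) hY i

theorem contMDiffAt_extend_field {k : ℕ} {x : M} (v : TangentSpace 𝓘(ℝ, E) x) :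
    CMDiffAt k (T% (extend E v)) x :=
  contMDiffAt_extend 𝓘(ℝ, E) E v

theorem contMDiffAt_inner {k : ℕ} {Y Z : Π x : M, TangentSpace 𝓘(ℝ, E) x} {x : M}
    (hY : CMDiffAt k (T% Y) x) (hZ : CMDiffAt k (T% Z) x) :
    CMDiffAt k (fun y ↦ ⟪Y y, Z y⟫_ℝ) x :=
  ContMDiffAt.inner_bundle (E := fun x : M ↦ TangentSpace 𝓘(ℝ, E) x) (b := fun y : M ↦ y)
    (v := Y) (w := Z) hY hZ

theorem contMDiffAt_det {k : ℕ} {ι : Type*} [Fintype ι] [DecidableEq ι] {x : M}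
    {G : M → Matrix ι ι ℝ} (hG : ∀ i j, CMDiffAt k (fun y ↦ G y i j) x) :
    CMDiffAt k (fun y ↦ (G y).det) x := by
  simp only [Matrix.det_apply, Units.smul_def, zsmul_eq_mul]
  exact contMDiffAt_finsetSum fun σ _ ↦ contMDiffAt_const.mul
    (contMDiffAt_finsetProd fun i _ ↦ hG _ _)

theorem gram_mulVec {x y : M} (hy : y ∈ (chartAt E x).source)
    (Y : Π x : M, TangentSpace 𝓘(ℝ, E) x) (i : Fin (Module.finrank ℝ E)) :
    (gram E x y).mulVec (fun j ↦ frameCoeff x Y j y) i =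
      ⟪Y y, frame x i y⟫_ℝ := by
  conv_rhs => rw [eq_sum_frameCoeff hy Y]
  simp only [Matrix.mulVec, dotProduct, gram, sum_inner, real_inner_smul_left]
  refine Finset.sum_congr rfl fun j _ ↦ ?_
  rw [real_inner_comm, mul_comm]

theorem extend_linearIndependent {x y : M} (hy : y ∈ (chartAt E x).source) :
    LinearIndependent ℝ (fun i ↦ frame (E := E) x i y) := by
  have := ((trivializationAt E (TangentSpace 𝓘(ℝ, E)) x).isLocalFrameOn_localFrame_baseSet
    𝓘(ℝ, E) 1 (Module.finBasis ℝ E)).linearIndependent (x := y) (by simpa using hy)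
  have e : (fun i ↦ frame (E := E) x i y) = fun i ↦
      (trivializationAt E (TangentSpace 𝓘(ℝ, E)) x).localFrame (Module.finBasis ℝ E) i y :=
    funext fun i ↦ (localFrame_eq_extend hy i).symm
  rw [e]
  exact this

theorem gram_det_ne_zero {x y : M} (hy : y ∈ (chartAt E x).source) : (gram E x y).det ≠ 0 := by
  intro h
  obtain ⟨c, hc, h0⟩ := Matrix.exists_mulVec_eq_zero_iff.2 h
  have hz : ∑ j, c j • frame (E := E) x j y = 0 := by
    rw [← inner_self_eq_zero (𝕜 := ℝ)]
    conv_lhs => rw [sum_inner]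
    refine Finset.sum_eq_zero fun i _ ↦ ?_
    rw [real_inner_smul_left, inner_sum]
    have := congrFun h0 i
    simp only [Matrix.mulVec, dotProduct, gram, Pi.zero_apply] at this
    have h3 : ∑ j, ⟪frame (E := E) x i y,
        c j • frame x j y⟫_ℝ = 0 := by
      rw [← this]
      refine Finset.sum_congr rfl fun j _ ↦ ?_
      rw [real_inner_smul_right, mul_comm]
    rw [h3, mul_zero]
  exact hc (funext fun j ↦ Fintype.linearIndependent_iff.1 (extend_linearIndependent hy) c hz j)

/-- A vector field is as smooth as its inner products with the coordinate fields. The coordinates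
of the field are recovered from these inner products by Cramer's rule for the Gram matrix. -/
theorem contMDiffAt_of_inner_extend {k : ℕ} {x : M} {Y : Π x : M, TangentSpace 𝓘(ℝ, E) x}
    (h : ∀ v : TangentSpace 𝓘(ℝ, E) x, CMDiffAt k (fun y ↦ ⟪Y y, extend E v y⟫_ℝ) x) :
    CMDiffAt k (T% Y) x := by
  have hG : ∀ i j, CMDiffAt k (fun y ↦ gram E x y i j) x := fun i j ↦
    contMDiffAt_inner (contMDiffAt_extend_field _) (contMDiffAt_extend_field _)
  have hc : ∀ i, CMDiffAt k (frameCoeff x Y i) x := by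
    intro i
    have h1 : CMDiffAt k (fun y ↦ ((gram E x y).det)⁻¹ * (Matrix.cramer (gram E x y)
        (fun j ↦ ⟪Y y, frame x j y⟫_ℝ)) i) x := by
      refine ContMDiffAt.mul ?_ ?_
      · exact (contMDiffAt_det hG).inv₀ (gram_det_ne_zero (mem_chart_source E x))
      · simp only [Matrix.cramer_apply]
        refine contMDiffAt_det fun a b ↦ ?_
        simp only [Matrix.updateCol_apply]
        split_ifs
        · exact h _
        · exact hG _ _
    refine h1.congr_of_eventuallyEq ?_
    filter_upwards [chart_source_mem_nhds E x] with y hy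
    have h2 : (fun j ↦ ⟪Y y, frame x j y⟫_ℝ)
        = (gram E x y).mulVec (fun j ↦ frameCoeff x Y j y) :=
      funext fun j ↦ (gram_mulVec hy Y j).symm
    rw [h2, Matrix.cramer_eq_adjugate_mulVec, Matrix.mulVec_mulVec, Matrix.adjugate_mul,
      Matrix.smul_mulVec, Matrix.one_mulVec, Pi.smul_apply, smul_eq_mul,
      inv_mul_cancel_left₀ (gram_det_ne_zero hy)]
  have h4 : CMDiffAt k (T% (fun y ↦ ∑ i, frameCoeff x Y i y • frame (E := E) x i y)) x :=
    .sum_section fun i _ ↦ (hc i).smul_section (contMDiffAt_extend_field _)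
  exact h4.congr_of_eventuallyEq ((eventually_eq_sum_frameCoeff x Y).mono fun y hy ↦ by simp [← hy])

theorem inner_grad (f : M → ℝ) (x : M) (v : TangentSpace 𝓘(ℝ, E) x) :
    ⟪grad f x, v⟫_ℝ = mvfderiv 𝓘(ℝ, E) f x v := by
  have h : v = ∑ i, ⟪stdOrthonormalBasis ℝ (TangentSpace 𝓘(ℝ, E) x) i, v⟫_ℝ •
      stdOrthonormalBasis ℝ (TangentSpace 𝓘(ℝ, E) x) i :=
    ((stdOrthonormalBasis ℝ (TangentSpace 𝓘(ℝ, E) x)).sum_repr' v).symm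
  conv_rhs => rw [h]
  simp only [grad, sum_inner, real_inner_smul_left, map_sum, map_smul, smul_eq_mul]
  exact Finset.sum_congr rfl fun i _ ↦ mul_comm _ _

theorem contMDiffAt_grad {k : ℕ} {f : M → ℝ} {x : M} (hf : CMDiffAt (k + 1 : ℕ) f x) :
    CMDiffAt k (T% (grad (E := E) f)) x := by
  refine contMDiffAt_of_inner_extend fun v ↦ ?_
  simp only [inner_grad]
  exact contMDiffAt_mvfderiv_extend hf v

theorem contMDiffAt_mvfderiv {k : ℕ} {f : M → ℝ} {x : M} {Y : Π x : M, TangentSpace 𝓘(ℝ, E) x}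
    (hf : CMDiffAt (k + 1 : ℕ) f x) (hY : CMDiffAt k (T% Y) x) :
    CMDiffAt k (fun y ↦ mvfderiv 𝓘(ℝ, E) f y (Y y)) x := by
  simp only [← inner_grad]
  exact contMDiffAt_inner (contMDiffAt_grad hf) hY

theorem eventually_mdiffAt {k : ℕ} {Y : Π x : M, TangentSpace 𝓘(ℝ, E) x} {x : M}
    (hY : CMDiffAt (k + 1 : ℕ) (T% Y) x) : ∀ᶠ y in 𝓝 x, MDiffAt (T% Y) y := by
  have : ∀ᶠ y in 𝓝 x, CMDiffAt (k + 1 : ℕ) (T% Y) y :=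
    (contMDiffAt_iff_contMDiffAt_nhds (by exact_mod_cast ENat.natCast_ne_top _)).1 hY
  exact this.mono fun y hy ↦ hy.mdifferentiableAt (by norm_cast)

theorem contMDiffAt_leviCivita {k : ℕ} {X Y : Π x : M, TangentSpace 𝓘(ℝ, E) x} {x : M}
    (hX : CMDiffAt (k + 1 : ℕ) (T% X) x) (hY : CMDiffAt (k + 1 : ℕ) (T% Y) x) :
    CMDiffAt k (T% (fun y ↦ leviCivita Y y (X y))) x := by
  refine contMDiffAt_of_inner_extend fun v ↦ ?_
  have hV : CMDiffAt (k + 1 : ℕ) (T% (extend E v)) x := contMDiffAt_extend_field v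
  have hk : ((k : ℕ) : ℕ∞ω) ≤ ((k + 1 : ℕ) : ℕ∞ω) := by norm_cast; omega
  have : IsManifold 𝓘(ℝ, E) (minSmoothness ℝ 2) M := by
    simp only [minSmoothness_of_isRCLikeNormedField]; infer_instance
  have : IsManifold 𝓘(ℝ, E) (((k + 1 : ℕ) : ℕ∞ω) + 1) M :=
    .of_le (n := ∞) (by exact_mod_cast le_top)
  have hbr : ∀ {P Q : Π x : M, TangentSpace 𝓘(ℝ, E) x}, CMDiffAt (k + 1 : ℕ) (T% P) x →
      CMDiffAt (k + 1 : ℕ) (T% Q) x →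
      CMDiffAt k (T% (VectorField.mlieBracket 𝓘(ℝ, E) P Q)) x := fun hP hQ ↦
    ContMDiffAt.mlieBracket_vectorField (m := k) (n := (k + 1 : ℕ)) hP hQ
      (by simp)
  have h1 : CMDiffAt k (fun y ↦ koszul X Y (extend E v) y / 2) x := by
    simp only [koszul, div_eq_mul_inv]
    refine ContMDiffAt.mul ?_ contMDiffAt_const
    refine ((((ContMDiffAt.add ?_ ?_).sub ?_).add ?_).sub ?_).sub ?_
    · exact contMDiffAt_mvfderiv (contMDiffAt_inner hY hV) (hX.of_le hk)
    · exact contMDiffAt_mvfderiv (contMDiffAt_inner hX hV) (hY.of_le hk)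
    · exact contMDiffAt_mvfderiv (contMDiffAt_inner hX hY) (hV.of_le hk)
    · exact contMDiffAt_inner (hbr hX hY) (hV.of_le hk)
    · exact contMDiffAt_inner (hbr hX hV) (hY.of_le hk)
    · exact contMDiffAt_inner (hbr hY hV) (hX.of_le hk)
  refine h1.congr_of_eventuallyEq ?_
  filter_upwards [eventually_mdiffAt hX, eventually_mdiffAt hY, eventually_mdiffAt hV]
    with y h1 h2 h3
  exact inner_leviCivitaAux_eq_koszul h1 h2 h3

/-! ### Second derivatives and the Lie bracket -/

theorem mfderiv_extChartAt_self (x : M) (v : TangentSpace 𝓘(ℝ, E) x) :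
    mfderiv 𝓘(ℝ, E) 𝓘(ℝ, E) (extChartAt 𝓘(ℝ, E) x) x v = v := by
  have h1 := DFunLike.congr_fun
    (TangentBundle.continuousLinearMapAt_trivializationAt (I := 𝓘(ℝ, E)) (mem_chart_source E x)) v
  have h2 := Trivialization.continuousLinearMapAt_apply_of_mem ℝ
    (trivializationAt E (TangentSpace 𝓘(ℝ, E)) x) (by simp : x ∈ _) v
  exact h1.symm.trans (h2.trans
    ((tangentBundleCore 𝓘(ℝ, E) M).coordChange_self (achart E x) x (mem_chart_source E x) v))

theorem mvfderiv_eq_fderiv_chart {x : M} {f : M → ℝ} (hf : MDiffAt f x)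
    (v : TangentSpace 𝓘(ℝ, E) x) :
    mvfderiv 𝓘(ℝ, E) f x v
      = fderiv ℝ (f ∘ (extChartAt 𝓘(ℝ, E) x).symm) (extChartAt 𝓘(ℝ, E) x x) v := by
  have := mvfderiv_extend (mem_chart_source E x) hf v
  rwa [extend_apply_self] at this

/-- A vector of the model space, regarded as a tangent vector at `x` through the chart at `x`. -/
def asTangent (x : M) (e : E) : TangentSpace 𝓘(ℝ, E) x := e

/-- The coordinate expression of a vector field in the chart at `x`. -/
def fieldInChart (x : M) (V : Π x : M, TangentSpace 𝓘(ℝ, E) x) : E → E :=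
  VectorField.mpullbackWithin 𝓘(ℝ, E) 𝓘(ℝ, E) (extChartAt 𝓘(ℝ, E) x).symm V (range 𝓘(ℝ, E))

theorem differentiableAt_fieldInChart {x : M} {V : Π x : M, TangentSpace 𝓘(ℝ, E) x}
    (hV : MDiffAt (T% V) x) :
    DifferentiableAt ℝ (fieldInChart x V) (extChartAt 𝓘(ℝ, E) x x) := by
  have := MDifferentiableWithinAt.differentiableWithinAt_mpullbackWithin_vectorField
    (s := univ) (mdifferentiableWithinAt_univ.2 hV)
  rw [preimage_univ, univ_inter, modelWithCornersSelf_coe, range_id] at this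
  have := differentiableWithinAt_univ.1 this
  unfold fieldInChart
  rw [modelWithCornersSelf_coe, range_id]
  exact this

theorem extend_fieldInChart {x y : M} (hy : y ∈ (chartAt E x).source)
    (V : Π x : M, TangentSpace 𝓘(ℝ, E) x) :
    extend E (asTangent x (fieldInChart x V (extChartAt 𝓘(ℝ, E) x y))) y = V y := by
  have hl : (extChartAt 𝓘(ℝ, E) x).symm (extChartAt 𝓘(ℝ, E) x y) = y :=
    (extChartAt 𝓘(ℝ, E) x).left_inv (by simpa using hy)
  have hi := isInvertible_mfderivWithin_extChartAt_symm (I := 𝓘(ℝ, E)) (x := x)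
    (y := extChartAt 𝓘(ℝ, E) x y) ((extChartAt 𝓘(ℝ, E) x).map_source (by simpa using hy))
  rw [extend_eq_mfderiv_symm hy]
  have hr : range 𝓘(ℝ, E) = univ := by simp
  have := hi.self_apply_inverse (V ((extChartAt 𝓘(ℝ, E) x).symm (extChartAt 𝓘(ℝ, E) x y)))
  have e : mfderivWithin 𝓘(ℝ, E) 𝓘(ℝ, E) (extChartAt 𝓘(ℝ, E) x).symm (range 𝓘(ℝ, E))
      (extChartAt 𝓘(ℝ, E) x y) = mfderiv 𝓘(ℝ, E) 𝓘(ℝ, E) (extChartAt 𝓘(ℝ, E) x).symm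
      (extChartAt 𝓘(ℝ, E) x y) := by
    rw [hr, mfderivWithin_univ]
  have h3 := (DFunLike.congr_fun e _).symm.trans this
  have h4 : (V ((extChartAt 𝓘(ℝ, E) x).symm (extChartAt 𝓘(ℝ, E) x y)) : E) = V y := by rw [hl]
  exact h3.trans h4

theorem fieldInChart_self (x : M) (V : Π x : M, TangentSpace 𝓘(ℝ, E) x) :
    asTangent x (fieldInChart x V (extChartAt 𝓘(ℝ, E) x x)) = V x := by
  have := extend_fieldInChart (mem_chart_source E x) V
  rwa [extend_apply_self] at this

/-- The coordinate expression of the second derivative `u (V f)`. -/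
theorem mvfderiv_mvfderiv {x : M} {f : M → ℝ} (hf : CMDiffAt 2 f x)
    {V : Π x : M, TangentSpace 𝓘(ℝ, E) x} (hV : MDiffAt (T% V) x) (u : E) :
    mvfderiv 𝓘(ℝ, E) (fun y ↦ mvfderiv 𝓘(ℝ, E) f y (V y)) x (asTangent x u)
      = fderiv ℝ (fderiv ℝ (f ∘ (extChartAt 𝓘(ℝ, E) x).symm)) (extChartAt 𝓘(ℝ, E) x x) u
          (fieldInChart x V (extChartAt 𝓘(ℝ, E) x x))
        + fderiv ℝ (f ∘ (extChartAt 𝓘(ℝ, E) x).symm) (extChartAt 𝓘(ℝ, E) x x)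
          (fderiv ℝ (fieldInChart x V) (extChartAt 𝓘(ℝ, E) x x) u) := by
  set φ := extChartAt 𝓘(ℝ, E) x with hφ
  have hf1 : ∀ᶠ y in 𝓝 x, CMDiffAt 2 f y := (contMDiffAt_iff_contMDiffAt_nhds (by simp)).1 hf
  have hd : MDiffAt (fun y ↦ mvfderiv 𝓘(ℝ, E) f y (V y)) x := by
    simp only [← inner_grad]
    have h1 : CMDiffAt (1 : ℕ) (T% (grad (E := E) f)) x := contMDiffAt_grad hf
    exact mdiffAt_inner (h1.mdifferentiableAt (by norm_num)) hV
  refine (mvfderiv_eq_fderiv_chart hd _).trans ?_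
  have hev : (fun y ↦ mvfderiv 𝓘(ℝ, E) f y (V y)) ∘ φ.symm =ᶠ[𝓝 (φ x)]
      fun ξ ↦ fderiv ℝ (f ∘ φ.symm) ξ (fieldInChart x V ξ) := by
    have hc : ContinuousAt φ.symm (φ x) := continuousAt_extChartAt_symm x
    have hx : φ.symm (φ x) = x := φ.left_inv (mem_extChartAt_source x)
    have hc' : Tendsto φ.symm (𝓝 (φ x)) (𝓝 x) := by
      have := hc.tendsto; rwa [hx] at this
    filter_upwards [hc'.eventually hf1, hc'.eventually (chart_source_mem_nhds E x),
      extChartAt_target_mem_nhds (I := 𝓘(ℝ, E)) x] with ξ h1 h2 h3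
    have h4 := mvfderiv_extend h2 (h1.mdifferentiableAt (by norm_num))
      (asTangent x (fieldInChart x V (φ (φ.symm ξ))))
    rw [extend_fieldInChart h2] at h4
    rw [φ.right_inv h3] at h4
    exact h4
  have hF : ContDiffAt ℝ 2 (f ∘ φ.symm) (φ x) := contDiffAt_comp_symm hf
  have hF1 : DifferentiableAt ℝ (fderiv ℝ (f ∘ φ.symm)) (φ x) :=
    (hF.fderiv_right (m := 1) (by norm_num)).differentiableAt (by norm_num)
  rw [hev.fderiv_eq, fderiv_clm_apply hF1 (differentiableAt_fieldInChart hV)]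
  exact add_comm _ _

theorem mlieBracket_eq_chart {x : M} {U V : Π x : M, TangentSpace 𝓘(ℝ, E) x} :
    VectorField.mlieBracket 𝓘(ℝ, E) U V x =
      asTangent x (VectorField.lieBracket ℝ (fieldInChart x U) (fieldInChart x V)
        (extChartAt 𝓘(ℝ, E) x x)) := by
  have h1 : mfderiv 𝓘(ℝ, E) 𝓘(ℝ, E) (extChartAt 𝓘(ℝ, E) x) x
      = ContinuousLinearMap.id ℝ E := by
    ext v; exact mfderiv_extChartAt_self x v
  have h2 : (mfderiv 𝓘(ℝ, E) 𝓘(ℝ, E) (extChartAt 𝓘(ℝ, E) x) x).inverse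
      = ContinuousLinearMap.id ℝ E := by
    rw [h1]; exact ContinuousLinearMap.inverse_id
  have h3 : VectorField.mlieBracket 𝓘(ℝ, E) U V x = _ :=
    (congrFun VectorField.mlieBracketWithin_univ x).symm.trans
      (VectorField.mlieBracketWithin_apply ..)
  refine h3.trans ((DFunLike.congr_fun h2 _).trans ?_)
  have hs : (extChartAt 𝓘(ℝ, E) x).symm ⁻¹' univ ∩ range 𝓘(ℝ, E) = univ := by simp
  rw [hs]
  exact congrFun (VectorField.lieBracketWithin_univ (𝕜 := ℝ) (E := E)
    (V := fieldInChart x U) (W := fieldInChart x V)) _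

/-- The Lie bracket acts on functions as the commutator of derivations. -/
theorem mvfderiv_mlieBracket {x : M} {f : M → ℝ} (hf : CMDiffAt 2 f x)
    {U V : Π x : M, TangentSpace 𝓘(ℝ, E) x} (hU : MDiffAt (T% U) x) (hV : MDiffAt (T% V) x) :
    mvfderiv 𝓘(ℝ, E) f x (VectorField.mlieBracket 𝓘(ℝ, E) U V x)
      = mvfderiv 𝓘(ℝ, E) (fun y ↦ mvfderiv 𝓘(ℝ, E) f y (V y)) x (U x)
        - mvfderiv 𝓘(ℝ, E) (fun y ↦ mvfderiv 𝓘(ℝ, E) f y (U y)) x (V x) := by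
  have hs : IsSymmSndFDerivAt ℝ (f ∘ (extChartAt 𝓘(ℝ, E) x).symm) (extChartAt 𝓘(ℝ, E) x x) :=
    (contDiffAt_comp_symm hf).isSymmSndFDerivAt (by simp)
  rw [← fieldInChart_self x U, ← fieldInChart_self x V]
  rw [mvfderiv_mvfderiv hf hV, mvfderiv_mvfderiv hf hU, hs.eq]
  rw [mvfderiv_eq_fderiv_chart (hf.mdifferentiableAt (by norm_num)), mlieBracket_eq_chart]
  have h : ∀ (L : E →L[ℝ] ℝ) (a b : E), L (asTangent x (a - b) : TangentSpace 𝓘(ℝ, E) x)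
      = L a - L b := fun L a b ↦ map_sub L a b
  rw [VectorField.lieBracket, h]
  ring

/-- The Hessian `u (V f) - (∇_u V) f` is symmetric. -/
theorem hessian_symm {x : M} {f : M → ℝ} (hf : CMDiffAt 2 f x)
    {U V : Π x : M, TangentSpace 𝓘(ℝ, E) x} (hU : MDiffAt (T% U) x) (hV : MDiffAt (T% V) x) :
    mvfderiv 𝓘(ℝ, E) (fun y ↦ mvfderiv 𝓘(ℝ, E) f y (V y)) x (U x)
        - mvfderiv 𝓘(ℝ, E) f x (leviCivita V x (U x))
      = mvfderiv 𝓘(ℝ, E) (fun y ↦ mvfderiv 𝓘(ℝ, E) f y (U y)) x (V x)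
        - mvfderiv 𝓘(ℝ, E) f x (leviCivita U x (V x)) := by
  have h1 := mvfderiv_mlieBracket hf hU hV
  rw [← leviCivita_torsion hU hV, map_sub] at h1
  linarith

/-! ### Covariant calculus of endomorphism fields -/

section EndomorphismFields

variable {x : M}

theorem leviCivita_add_apply {Y Z : Π x : M, TangentSpace 𝓘(ℝ, E) x} (hY : MDiffAt (T% Y) x)
    (hZ : MDiffAt (T% Z) x) (u : TangentSpace 𝓘(ℝ, E) x) :
    leviCivita (fun y ↦ Y y + Z y) x u = leviCivita Y x u + leviCivita Z x u := by
  have := leviCivita.isCovariantDerivativeOnUniv.add hY hZ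
  exact DFunLike.congr_fun this u

theorem leviCivita_smul_apply {f : M → ℝ} {Y : Π x : M, TangentSpace 𝓘(ℝ, E) x}
    (hf : MDiffAt f x) (hY : MDiffAt (T% Y) x) (u : TangentSpace 𝓘(ℝ, E) x) :
    leviCivita (fun y ↦ f y • Y y) x u
      = f x • leviCivita Y x u + mvfderiv 𝓘(ℝ, E) f x u • Y x := by
  have := leviCivita.isCovariantDerivativeOnUniv.leibniz hY hf
  exact DFunLike.congr_fun this u

theorem leviCivita_const_smul_apply (a : ℝ) {Y : Π x : M, TangentSpace 𝓘(ℝ, E) x}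
    (hY : MDiffAt (T% Y) x) (u : TangentSpace 𝓘(ℝ, E) x) :
    leviCivita (fun y ↦ a • Y y) x u = a • leviCivita Y x u := by
  have := leviCivita.isCovariantDerivativeOnUniv.smul_const a hY
  exact DFunLike.congr_fun this u

theorem leviCivita_congr {Y Z : Π x : M, TangentSpace 𝓘(ℝ, E) x} (hY : MDiffAt (T% Y) x)
    (h : ∀ᶠ y in 𝓝 x, Y y = Z y) : leviCivita Y x = leviCivita Z x := by
  have hZ : MDiffAt (T% Z) x := hY.congr_of_eventuallyEq (h.mono fun y hy ↦ by simp [hy])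
  exact leviCivita.isCovariantDerivativeOnUniv.congr_of_eventuallyEq hY hZ univ_mem h

theorem mdiffAt_extend (v : TangentSpace 𝓘(ℝ, E) x) : MDiffAt (T% (extend E v)) x :=
  mdifferentiableAt_extend 𝓘(ℝ, E) E v

theorem mdiffAt_frame (i : Fin (Module.finrank ℝ E)) : MDiffAt (T% (frame (E := E) x i)) x :=
  mdiffAt_extend _

theorem mdiffAt_sum_field {ι : Type*} {s : Finset ι} {Y : ι → Π x : M, TangentSpace 𝓘(ℝ, E) x}
    (h : ∀ i ∈ s, MDiffAt (T% (Y i)) x) : MDiffAt (T% (fun y ↦ ∑ i ∈ s, Y i y)) x :=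
  MDifferentiableAt.sum_section h

theorem mdiffAt_sum {ι : Type*} {s : Finset ι} {f : ι → M → ℝ}
    (h : ∀ i ∈ s, MDiffAt (f i) x) : MDiffAt (fun y ↦ ∑ i ∈ s, f i y) x := by
  classical
  induction s using Finset.induction_on with
  | empty => simpa using mdifferentiableAt_const
  | insert a s ha ih =>
    simp only [Finset.sum_insert ha]
    exact (h a (by simp)).add (ih fun i hi ↦ h i (by simp [hi]))

theorem mvfderiv_congr {f g : M → ℝ} (h : f =ᶠ[𝓝 x] g) :
    mvfderiv 𝓘(ℝ, E) f x = mvfderiv 𝓘(ℝ, E) g x := by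
  have := h.mfderiv_eq (I := 𝓘(ℝ, E)) (I' := 𝓘(ℝ, ℝ))
  exact this

theorem mvfderiv_sum_apply {ι : Type*} (s : Finset ι) {f : ι → M → ℝ}
    (h : ∀ i ∈ s, MDiffAt (f i) x) (u : TangentSpace 𝓘(ℝ, E) x) :
    mvfderiv 𝓘(ℝ, E) (fun y ↦ ∑ i ∈ s, f i y) x u = ∑ i ∈ s, mvfderiv 𝓘(ℝ, E) (f i) x u := by
  classical
  induction s using Finset.induction_on with
  | empty =>
    simp only [Finset.sum_empty]
    simp [mvfderiv]
  | insert a s ha ih =>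
    simp only [Finset.sum_insert ha]
    have := mvfderiv_add (h a (by simp)) (mdiffAt_sum (s := s) fun i hi ↦ h i (by simp [hi]))
    rw [← ih fun i hi ↦ h i (by simp [hi])]
    exact DFunLike.congr_fun this u

theorem leviCivita_sum_apply {ι : Type*} (s : Finset ι) {Y : ι → Π x : M, TangentSpace 𝓘(ℝ, E) x}
    (h : ∀ i ∈ s, MDiffAt (T% (Y i)) x) (u : TangentSpace 𝓘(ℝ, E) x) :
    leviCivita (fun y ↦ ∑ i ∈ s, Y i y) x u = ∑ i ∈ s, leviCivita (Y i) x u := by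
  classical
  induction s using Finset.induction_on with
  | empty =>
    simp only [Finset.sum_empty]
    exact DFunLike.congr_fun (leviCivita.isCovariantDerivativeOnUniv.zero (x := x)) u
  | insert a s ha ih =>
    simp only [Finset.sum_insert ha]
    rw [leviCivita_add_apply (h a (by simp)) (mdiffAt_sum_field fun i hi ↦ h i (by simp [hi])),
      ih fun i hi ↦ h i (by simp [hi])]

/-- A field of endomorphisms is differentiable at `x` if it maps the coordinate fields at `x` to
fields that are differentiable at `x`. -/
def DiffEndo (S : Π x : M, TangentSpace 𝓘(ℝ, E) x →L[ℝ] TangentSpace 𝓘(ℝ, E) x) (x : M) : Prop :=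
  ∀ v : TangentSpace 𝓘(ℝ, E) x, MDiffAt (T% (fun y ↦ S y (extend E v y))) x

variable {S S' : Π x : M, TangentSpace 𝓘(ℝ, E) x →L[ℝ] TangentSpace 𝓘(ℝ, E) x}

theorem DiffEndo.mdiffAt (hS : DiffEndo S x) {V : Π x : M, TangentSpace 𝓘(ℝ, E) x}
    (hV : MDiffAt (T% V) x) : MDiffAt (T% (fun y ↦ S y (V y))) x := by
  have h : MDiffAt (T% (fun y ↦ ∑ i, frameCoeff x V i y • S y (frame (E := E) x i y))) x :=
    mdiffAt_sum_field fun i _ ↦ mdiffAt_smul_field (hS _) (mdiffAt_frameCoeff hV i)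
  refine h.congr_of_eventuallyEq ((eventually_eq_sum_frameCoeff x V).mono fun y hy ↦ ?_)
  simp only
  conv_lhs => rw [hy, map_sum]
  simp only [map_smul]

theorem DiffEndo.leviCivita_apply (hS : DiffEndo S x) {V : Π x : M, TangentSpace 𝓘(ℝ, E) x}
    (hV : MDiffAt (T% V) x) (u : TangentSpace 𝓘(ℝ, E) x) :
    leviCivita (fun y ↦ S y (V y)) x u = covTensor S x u (V x) + S x (leviCivita V x u) := by
  have ht : TensorialAt 𝓘(ℝ, E) E (fun V : Π x : M, TangentSpace 𝓘(ℝ, E) x ↦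
      leviCivita (fun y ↦ S y (V y)) x u - S x (leviCivita V x u)) x :=
    { smul := by
        intro f V hf hV
        have h1 := leviCivita_smul_apply hf (hS.mdiffAt hV) u
        have h2 := leviCivita_smul_apply hf hV u
        simp only [Pi.smul_apply', map_smul]
        change leviCivita (fun y ↦ f y • S y (V y)) x u - S x (leviCivita (fun y ↦ f y • V y) x u)
          = _
        rw [h1, h2, map_add, map_smul, map_smul, smul_sub]
        abel
      add := by
        intro V W hV hW
        have h1 := leviCivita_add_apply (hS.mdiffAt hV) (hS.mdiffAt hW) u
        have h2 := leviCivita_add_apply hV hW u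
        simp only [Pi.add_apply, map_add]
        change leviCivita (fun y ↦ S y (V y) + S y (W y)) x u
          - S x (leviCivita (fun y ↦ V y + W y) x u) = _
        rw [h1, h2, map_add]
        abel }
  have := ht.pointwise hV (mdiffAt_extend (V x)) (extend_apply_self E (V x)).symm
  rw [covTensor]
  exact sub_eq_iff_eq_add.1 this

/-- The covariant derivative of a differentiable endomorphism field, as a linear map. -/
def covTensorMap (hS : DiffEndo S x) (u : TangentSpace 𝓘(ℝ, E) x) :
    TangentSpace 𝓘(ℝ, E) x →ₗ[ℝ] TangentSpace 𝓘(ℝ, E) x where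
  toFun v := covTensor S x u v
  map_add' v w := by
    have h := hS.leviCivita_apply (mdiffAt_add_field (mdiffAt_extend v) (mdiffAt_extend w)) u
    have h1 := leviCivita_add_apply (hS (v := v)) (hS (v := w)) u
    have h2 := leviCivita_add_apply (mdiffAt_extend v) (mdiffAt_extend w) u
    simp only [Pi.add_apply, extend_apply_self, map_add] at h
    rw [h1] at h
    change _ = _ + S x (leviCivita (fun y ↦ extend E v y + extend E w y) x u) at h
    rw [h2, map_add] at h
    simp only [covTensor] at h ⊢
    rw [← sub_eq_iff_eq_add] at h
    rw [← h]; abel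
  map_smul' a v := by
    have h := hS.leviCivita_apply (V := fun y ↦ a • extend E v y)
      (mdiffAt_smul_field (mdiffAt_extend v) mdifferentiableAt_const) u
    have h1 := leviCivita_const_smul_apply a (hS (v := v)) u
    have h2 := leviCivita_const_smul_apply a (mdiffAt_extend v) u
    simp only [extend_apply_self, map_smul] at h
    rw [h1, h2, map_smul] at h
    simp only [covTensor] at h ⊢
    rw [← sub_eq_iff_eq_add] at h
    rw [← h, RingHom.id_apply, smul_sub]

theorem covTensorMap_apply (hS : DiffEndo S x) (u v : TangentSpace 𝓘(ℝ, E) x) :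
    covTensorMap hS u v = covTensor S x u v := rfl

theorem DiffEndo.comp (hS : DiffEndo S x) (hS' : DiffEndo S' x) :
    DiffEndo (fun y ↦ S y ∘L S' y) x := fun v ↦ hS.mdiffAt (hS' v)

theorem covTensor_comp (hS : DiffEndo S x) (hS' : DiffEndo S' x)
    (u v : TangentSpace 𝓘(ℝ, E) x) :
    covTensor (fun y ↦ S y ∘L S' y) x u v
      = covTensor S x u (S' x v) + S x (covTensor S' x u v) := by
  have h1 := hS.leviCivita_apply (hS' v) u
  have h2 : S' x (extend E v x) = S' x v := by rw [extend_apply_self]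
  simp only [covTensor, ContinuousLinearMap.comp_apply, h2] at h1 ⊢
  rw [h1, map_sub]
  abel

theorem trace_eq_sum_frameCoeff {y : M} (hy : y ∈ (chartAt E x).source) :
    LinearMap.trace ℝ _ (S y : TangentSpace 𝓘(ℝ, E) y →ₗ[ℝ] TangentSpace 𝓘(ℝ, E) y)
      = ∑ i, frameCoeff x (fun y ↦ S y (frame (E := E) x i y)) i y := by
  have hc : Fintype.card (Fin (Module.finrank ℝ E))
      = Module.finrank ℝ (TangentSpace 𝓘(ℝ, E) y) := Fintype.card_fin _
  let b : Module.Basis (Fin (Module.finrank ℝ E)) ℝ (TangentSpace 𝓘(ℝ, E) y) :=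
    Module.Basis.mk (extend_linearIndependent hy)
      ((extend_linearIndependent hy).span_eq_top_of_card_eq_finrank' hc).ge
  have hb : ∀ i, b i = frame x i y := fun i ↦ by simp [b]
  rw [LinearMap.trace_eq_matrix_trace ℝ b, Matrix.trace]
  refine Finset.sum_congr rfl fun i _ ↦ ?_
  rw [Matrix.diag_apply, LinearMap.toMatrix_apply]
  have h := eq_sum_frameCoeff hy (fun y ↦ S y (frame (E := E) x i y))
  rw [ContinuousLinearMap.coe_coe, hb, h]
  simp only [← hb, map_sum, map_smul, Finsupp.coe_finsetSum, Finset.sum_apply, Finsupp.smul_apply,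
    Module.Basis.repr_self]
  simp [Finsupp.single_apply]

theorem DiffEndo.mdiffAt_trace (hS : DiffEndo S x) :
    MDiffAt (fun y ↦ LinearMap.trace ℝ _
      (S y : TangentSpace 𝓘(ℝ, E) y →ₗ[ℝ] TangentSpace 𝓘(ℝ, E) y)) x := by
  have h : MDiffAt (fun y ↦ ∑ i, frameCoeff x (fun y ↦ S y (frame (E := E) x i y)) i y) x :=
    mdiffAt_sum fun i _ ↦ mdiffAt_frameCoeff (hS _) i
  refine h.congr_of_eventuallyEq ?_
  filter_upwards [chart_source_mem_nhds E x] with y hy using trace_eq_sum_frameCoeff hy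

/-- The trace commutes with covariant differentiation. -/
theorem DiffEndo.mvfderiv_trace (hS : DiffEndo S x) (u : TangentSpace 𝓘(ℝ, E) x) :
    mvfderiv 𝓘(ℝ, E) (fun y ↦ LinearMap.trace ℝ _
      (S y : TangentSpace 𝓘(ℝ, E) y →ₗ[ℝ] TangentSpace 𝓘(ℝ, E) y)) x u
      = LinearMap.trace ℝ _ (covTensorMap hS u) := by
  have hx := mem_chart_source E x
  have hfr : ∀ i, frame (E := E) x i x = tangentBasis E x i := fun i ↦ extend_apply_self E _
  set b := tangentBasis E x
  let s : Fin (Module.finrank ℝ E) → Fin (Module.finrank ℝ E) → M → ℝ := fun j i ↦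
    frameCoeff x (fun y ↦ S y (frame (E := E) x j y)) i
  have hs : ∀ j i, MDiffAt (s j i) x := fun j i ↦ mdiffAt_frameCoeff (hS _) i
  let Γ : TangentSpace 𝓘(ℝ, E) x →ₗ[ℝ] TangentSpace 𝓘(ℝ, E) x :=
    b.constr ℝ fun i ↦ leviCivita (frame (E := E) x i) x u
  let D : TangentSpace 𝓘(ℝ, E) x →ₗ[ℝ] TangentSpace 𝓘(ℝ, E) x :=
    b.constr ℝ fun j ↦ ∑ i, mvfderiv 𝓘(ℝ, E) (s j i) x u • b i
  have hΓ : ∀ i, Γ (b i) = leviCivita (frame (E := E) x i) x u := fun i ↦ by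
    simp [Γ]
  have hD : ∀ j, D (b j) = ∑ i, mvfderiv 𝓘(ℝ, E) (s j i) x u • b i := fun i ↦ by
    simp [D]
  let σ : TangentSpace 𝓘(ℝ, E) x →ₗ[ℝ] TangentSpace 𝓘(ℝ, E) x := (S x).toLinearMap
  have hL : covTensorMap hS u = Γ * σ - σ * Γ + D := by
    refine b.ext fun j ↦ ?_
    have h1 := hS.leviCivita_apply (mdiffAt_extend (b j)) u
    have h2 : leviCivita (fun y ↦ S y (frame (E := E) x j y)) x u
        = ∑ i, (s j i x • leviCivita (frame (E := E) x i) x u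
          + mvfderiv 𝓘(ℝ, E) (s j i) x u • b i) := by
      rw [leviCivita_congr (Y := fun y ↦ S y (frame (E := E) x j y)) (hS (b j))
        (eventually_eq_sum_frameCoeff x (fun y ↦ S y (frame (E := E) x j y))),
        leviCivita_sum_apply (Y := fun i y ↦ s j i y • frame (E := E) x i y) _
          fun i _ ↦ mdiffAt_smul_field (mdiffAt_extend _) (hs j i)]
      refine Finset.sum_congr rfl fun i _ ↦ ?_
      rw [leviCivita_smul_apply (hs j i) (mdiffAt_frame i), hfr]
    have h3 : S x (b j) = ∑ i, s j i x • b i := by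
      have := eq_sum_frameCoeff hx (fun y ↦ S y (frame (E := E) x j y))
      simpa only [hfr] using this
    have h4 : Γ (σ (b j)) = ∑ i, s j i x • leviCivita (frame (E := E) x i) x u := by
      change Γ (S x (b j)) = _
      rw [h3, map_sum]
      simp only [map_smul, hΓ]
    rw [extend_apply_self] at h1
    have h5 : σ (Γ (b j)) = S x (leviCivita (extend E (b j)) x u) := by rw [hΓ]; rfl
    rw [covTensorMap_apply, LinearMap.add_apply, LinearMap.sub_apply, Module.End.mul_apply,
      Module.End.mul_apply, h4, h5, hD, eq_sub_of_add_eq h1.symm]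
    change leviCivita (fun y ↦ S y (frame (E := E) x j y)) x u - _ = _
    rw [h2, Finset.sum_add_distrib]
    abel
  rw [hL, map_add, map_sub, LinearMap.trace_mul_comm, sub_self, zero_add,
    LinearMap.trace_eq_matrix_trace ℝ b, Matrix.trace]
  have h6 : ∀ᶠ y in 𝓝 x, LinearMap.trace ℝ _
      (S y : TangentSpace 𝓘(ℝ, E) y →ₗ[ℝ] TangentSpace 𝓘(ℝ, E) y) = ∑ i, s i i y := by
    filter_upwards [chart_source_mem_nhds E x] with y hy using trace_eq_sum_frameCoeff hy
  rw [show mvfderiv 𝓘(ℝ, E) (fun y ↦ LinearMap.trace ℝ _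
      (S y : TangentSpace 𝓘(ℝ, E) y →ₗ[ℝ] TangentSpace 𝓘(ℝ, E) y)) x
      = mvfderiv 𝓘(ℝ, E) (fun y ↦ ∑ i, s i i y) x from mvfderiv_congr h6,
    mvfderiv_sum_apply _ fun i _ ↦ hs i i]
  refine Finset.sum_congr rfl fun i _ ↦ ?_
  rw [Matrix.diag_apply, LinearMap.toMatrix_apply, hD]
  simp [Finsupp.single_apply]

end EndomorphismFields

/-! ### Curvature and the Riccati equation -/

section Curvature

variable {x : M}

theorem contMDiffAt_zero_of_mdiff {k : ℕ} {Y : Π x : M, TangentSpace 𝓘(ℝ, E) x}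
    (hY : CMDiffAt (k + 1 : ℕ) (T% Y) x) : MDiffAt (T% Y) x :=
  hY.mdifferentiableAt (by norm_cast)

theorem diffEndo_leviCivita {W : Π x : M, TangentSpace 𝓘(ℝ, E) x}
    (hW : CMDiffAt (2 : ℕ) (T% W) x) : DiffEndo (fun y ↦ leviCivita W y) x := fun v ↦
  contMDiffAt_zero_of_mdiff (k := 0) (contMDiffAt_leviCivita (contMDiffAt_extend_field v) hW)

/-- The second covariant derivative `∇²_{v,u} W`. -/
def secondCov (W : Π x : M, TangentSpace 𝓘(ℝ, E) x) (x : M) (v u : TangentSpace 𝓘(ℝ, E) x) :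
    TangentSpace 𝓘(ℝ, E) x :=
  covTensor (fun y ↦ leviCivita W y) x v u

theorem curvature_eq_secondCov_extend (u v w : TangentSpace 𝓘(ℝ, E) x) :
    curvature x u v w = secondCov (extend E w) x v u - secondCov (extend E w) x u v := by
  have ht := leviCivita_torsion (mdiffAt_extend u) (mdiffAt_extend v)
  rw [extend_apply_self, extend_apply_self] at ht
  rw [curvature, secondCov, secondCov, covTensor, covTensor, ← ht, map_sub]
  abel

theorem secondCov_congr {W W' : Π x : M, TangentSpace 𝓘(ℝ, E) x} (hW : CMDiffAt (2 : ℕ) (T% W) x)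
    (h : ∀ᶠ y in 𝓝 x, W y = W' y) (v u : TangentSpace 𝓘(ℝ, E) x) :
    secondCov W x v u = secondCov W' x v u := by
  have h1 : ∀ᶠ y in 𝓝 x, leviCivita W y = leviCivita W' y := by
    filter_upwards [eventually_eventually_nhds.2 h, eventually_mdiffAt hW] with y hy hy2
    exact leviCivita_congr hy2 hy
  rw [secondCov, secondCov, covTensor, covTensor, h1.self_of_nhds,
    leviCivita_congr (Z := fun y ↦ leviCivita W' y (extend E u y)) (diffEndo_leviCivita hW u)
      (h1.mono fun y hy ↦ by simp only [hy])]

theorem secondCov_add {W W' : Π x : M, TangentSpace 𝓘(ℝ, E) x} (hW : CMDiffAt (2 : ℕ) (T% W) x)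
    (hW' : CMDiffAt (2 : ℕ) (T% W') x) (v u : TangentSpace 𝓘(ℝ, E) x) :
    secondCov (fun y ↦ W y + W' y) x v u = secondCov W x v u + secondCov W' x v u := by
  have h1 : ∀ᶠ y in 𝓝 x, ∀ z, leviCivita W y z + leviCivita W' y z
      = leviCivita (fun y ↦ W y + W' y) y z := by
    filter_upwards [eventually_mdiffAt hW, eventually_mdiffAt hW'] with y h1 h2 z
    rw [leviCivita_add_apply h1 h2]
  have h2 := leviCivita_congr
    (mdiffAt_add_field (diffEndo_leviCivita hW u) (diffEndo_leviCivita hW' u))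
    (h1.mono fun y hy ↦ hy _)
  have h3 := leviCivita_add_apply (diffEndo_leviCivita hW u) (diffEndo_leviCivita hW' u) v
  simp only [secondCov, covTensor]
  rw [← h2, ← h1.self_of_nhds]
  change leviCivita (fun y ↦ _ + _) x v - _ = _
  rw [h3]
  abel

/-- `∇²_{v,u} (f W) = f ∇²_{v,u} W` up to terms symmetric in `u` and `v`. -/
theorem secondCov_smul {W : Π x : M, TangentSpace 𝓘(ℝ, E) x} {f : M → ℝ}
    (hf : CMDiffAt (2 : ℕ) f x) (hW : CMDiffAt (2 : ℕ) (T% W) x)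
    (v u : TangentSpace 𝓘(ℝ, E) x) :
    secondCov (fun y ↦ f y • W y) x v u - secondCov (fun y ↦ f y • W y) x u v
      = f x • (secondCov W x v u - secondCov W x u v) := by
  have hf0 : MDiffAt f x := hf.mdifferentiableAt (by norm_num)
  have hW0 : MDiffAt (T% W) x := contMDiffAt_zero_of_mdiff (k := 1) hW
  have key : ∀ v u : TangentSpace 𝓘(ℝ, E) x, secondCov (fun y ↦ f y • W y) x v u
      = f x • secondCov W x v u + mvfderiv 𝓘(ℝ, E) f x v • leviCivita W x u
        + mvfderiv 𝓘(ℝ, E) f x u • leviCivita W x v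
        + (mvfderiv 𝓘(ℝ, E) (fun y ↦ mvfderiv 𝓘(ℝ, E) f y (extend E u y)) x v
          - mvfderiv 𝓘(ℝ, E) f x (leviCivita (extend E u) x v)) • W x := by
    intro v u
    have h1 : ∀ᶠ y in 𝓝 x, ∀ z, f y • leviCivita W y z + mvfderiv 𝓘(ℝ, E) f y z • W y
        = leviCivita (fun y ↦ f y • W y) y z := by
      filter_upwards [eventually_mdiffAt hW, (contMDiffAt_iff_contMDiffAt_nhds (by simp)).1 hf]
        with y h1 h2 z
      rw [leviCivita_smul_apply (h2.mdifferentiableAt (by norm_num)) h1]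
    have hdu : MDiffAt (fun y ↦ mvfderiv 𝓘(ℝ, E) f y (extend E u y)) x :=
      (contMDiffAt_mvfderiv (k := 1) hf (contMDiffAt_extend_field u)).mdifferentiableAt
        (by norm_num)
    have hA := mdiffAt_smul_field (diffEndo_leviCivita hW u) hf0
    have hB := mdiffAt_smul_field hW0 hdu
    have h2 := leviCivita_congr (mdiffAt_add_field hA hB) (h1.mono fun y hy ↦ hy (extend E u y))
    have h3 := leviCivita_add_apply hA hB v
    have h4 := leviCivita_smul_apply hf0 (diffEndo_leviCivita hW u) v
    have h5 := leviCivita_smul_apply hdu hW0 v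
    simp only [extend_apply_self] at h4 h5
    change leviCivita (fun y ↦ f y • leviCivita W y (extend E u y)
      + mvfderiv 𝓘(ℝ, E) f y (extend E u y) • W y) x = _ at h2
    change leviCivita (fun y ↦ f y • leviCivita W y (extend E u y)
      + mvfderiv 𝓘(ℝ, E) f y (extend E u y) • W y) x v
        = leviCivita (fun y ↦ f y • leviCivita W y (extend E u y)) x v
        + leviCivita (fun y ↦ mvfderiv 𝓘(ℝ, E) f y (extend E u y) • W y) x v at h3
    simp only [secondCov, covTensor]
    rw [← h2, ← h1.self_of_nhds, h3, h4, h5, sub_smul, smul_sub]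
    abel
  have hs := hessian_symm (by exact_mod_cast hf) (mdiffAt_extend v) (mdiffAt_extend u)
  rw [extend_apply_self, extend_apply_self] at hs
  rw [key v u, key u v, hs, smul_sub]
  abel

/-- The curvature may be computed from any extension of the third vector. -/
theorem curvature_eq_secondCov {W : Π x : M, TangentSpace 𝓘(ℝ, E) x}
    (hW : CMDiffAt (2 : ℕ) (T% W) x) (u v : TangentSpace 𝓘(ℝ, E) x) :
    curvature x u v (W x) = secondCov W x v u - secondCov W x u v := by
  classical
  have hsum : ∀ (s : Finset (Fin (Module.finrank ℝ E))) (f : Fin (Module.finrank ℝ E) → M → ℝ),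
      (∀ i, CMDiffAt (2 : ℕ) (f i) x) →
      CMDiffAt (2 : ℕ) (T% (fun y ↦ ∑ i ∈ s, f i y • frame (E := E) x i y)) x ∧
      secondCov (fun y ↦ ∑ i ∈ s, f i y • frame (E := E) x i y) x v u
        - secondCov (fun y ↦ ∑ i ∈ s, f i y • frame (E := E) x i y) x u v
      = ∑ i ∈ s, f i x • (secondCov (frame (E := E) x i) x v u
        - secondCov (frame (E := E) x i) x u v) := by
    intro s f hf
    refine ⟨.sum_section fun i _ ↦ (hf i).smul_section (contMDiffAt_extend_field _), ?_⟩
    induction s using Finset.induction_on with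
    | empty =>
      have h0 : leviCivita (fun y : M ↦ (0 : TangentSpace 𝓘(ℝ, E) y)) = 0 :=
        funext fun y ↦ leviCivita.isCovariantDerivativeOnUniv.zero (x := y)
      have h1 := secondCov_smul (f := fun _ ↦ (0 : ℝ)) contMDiffAt_const
        (contMDiffAt_extend_field (E := E) u) v u
      simpa using h1
    | insert a s ha ih =>
      have ha' : CMDiffAt (2 : ℕ) (T% (fun y ↦ f a y • frame (E := E) x a y)) x :=
        (hf a).smul_section (contMDiffAt_extend_field _)
      have hs' : CMDiffAt (2 : ℕ) (T% (fun y ↦ ∑ i ∈ s, f i y • frame (E := E) x i y)) x :=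
        .sum_section fun i _ ↦ (hf i).smul_section (contMDiffAt_extend_field _)
      simp only [Finset.sum_insert ha]
      rw [secondCov_add ha' hs', secondCov_add ha' hs', ← ih,
        ← secondCov_smul (W := frame (E := E) x a) (hf a) (contMDiffAt_extend_field _)]
      change (_ + _) - (_ + _) = (secondCov (fun y ↦ f a y • frame (E := E) x a y) x v u - _) + _
      abel
  have hx := mem_chart_source E x
  have hx1 := eq_sum_frameCoeff hx W
  have h1 := (hsum Finset.univ (frameCoeff x W) fun i ↦ contMDiffAt_frameCoeff hW i).2
  have h2 := hsum Finset.univ (fun i _ ↦ frameCoeff x W i x) fun i ↦ contMDiffAt_const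
  rw [curvature_eq_secondCov_extend]
  have hev : ∀ᶠ y in 𝓝 x, ∑ i, frameCoeff x W i x • frame (E := E) x i y = extend E (W x) y := by
    filter_upwards [chart_source_mem_nhds E x] with y hy
    let L : TangentSpace 𝓘(ℝ, E) x →ₗ[ℝ] TangentSpace 𝓘(ℝ, E) y :=
      (trivializationAt E (TangentSpace 𝓘(ℝ, E)) x).symmₗ ℝ y
    have hl : ∀ v : TangentSpace 𝓘(ℝ, E) x, extend E v y = L v := fun v ↦ by
      change _ = (trivializationAt E (TangentSpace 𝓘(ℝ, E)) x).symmₗ ℝ y v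
      rw [extend_eq_symm, Trivialization.coe_symmₗ]
      simpa using hy
    have hx2 : W x = ∑ i, frameCoeff x W i x • tangentBasis E x i :=
      hx1.trans (Finset.sum_congr rfl fun i _ ↦ by
        rw [show frame (E := E) x i x = tangentBasis E x i from extend_apply_self E _])
    conv_rhs => rw [hx2, hl, map_sum]
    refine Finset.sum_congr rfl fun i _ ↦ ?_
    rw [map_smul, ← hl]
    rfl
  rw [← secondCov_congr h2.1 hev, ← secondCov_congr h2.1 hev, h2.2,
    secondCov_congr hW (eventually_eq_sum_frameCoeff x W),
    secondCov_congr hW (eventually_eq_sum_frameCoeff x W), h1]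

/-! The data of a distance function: `X = ∇ρ` has unit length near `x`, and `A = ∇X`. -/

variable {ρ : M → ℝ}

theorem contMDiffAt_grad_of_infty (hρ : CMDiffAt ∞ ρ x) (k : ℕ) :
    CMDiffAt k (T% (grad (E := E) ρ)) x :=
  contMDiffAt_grad (hρ.of_le (by exact_mod_cast le_top))

theorem eventually_contMDiffAt_infty (hρ : CMDiffAt ∞ ρ x) (k : ℕ) : ∀ᶠ y in 𝓝 x, CMDiffAt k ρ y :=
  (contMDiffAt_iff_contMDiffAt_nhds (by exact_mod_cast ENat.natCast_ne_top _)).1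
    (hρ.of_le (by exact_mod_cast le_top))

/-- The Hessian `∇(∇ρ)` is a symmetric endomorphism. -/
theorem inner_leviCivita_grad_symm (hρ : CMDiffAt (2 : ℕ) ρ x) (u v : TangentSpace 𝓘(ℝ, E) x) :
    ⟪leviCivita (grad ρ) x u, v⟫_ℝ = ⟪u, leviCivita (grad ρ) x v⟫_ℝ := by
  have hX : MDiffAt (T% (grad (E := E) ρ)) x :=
    contMDiffAt_zero_of_mdiff (k := 0) (contMDiffAt_grad (k := 1) hρ)
  have hs := hessian_symm (by exact_mod_cast hρ) (mdiffAt_extend u) (mdiffAt_extend v)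
  have hg : ∀ (y : M) (w : TangentSpace 𝓘(ℝ, E) y), mvfderiv 𝓘(ℝ, E) ρ y w = ⟪grad ρ y, w⟫_ℝ :=
    fun y w ↦ (inner_grad ρ y w).symm
  simp only [hg] at hs
  have h1 := leviCivita_metric (mdiffAt_extend u) hX (mdiffAt_extend v)
  have h2 := leviCivita_metric (mdiffAt_extend v) hX (mdiffAt_extend u)
  simp only [extend_apply_self] at hs h1 h2
  rw [h1, h2] at hs
  rw [real_inner_comm (leviCivita (grad ρ) x v)]
  linarith

/-- The integral curves of `X = ∇ρ` are geodesics: `⟨∇_X X, v⟩ = ⟨X, ∇_v X⟩` is half the derivative of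
`|X|² = 1` in the direction `v`. -/
theorem leviCivita_grad_self (hρ : CMDiffAt (2 : ℕ) ρ x)
    (h1 : ∀ᶠ y in 𝓝 x, ‖grad (E := E) ρ y‖ = 1) : leviCivita (grad (E := E) ρ) x (grad ρ x) = 0 := by
  have hX : MDiffAt (T% (grad (E := E) ρ)) x :=
    contMDiffAt_zero_of_mdiff (k := 0) (contMDiffAt_grad (k := 1) hρ)
  refine ext_inner_right ℝ fun v ↦ ?_
  rw [inner_leviCivita_grad_symm hρ, inner_zero_left, real_inner_comm]
  have h2 := leviCivita_metric (mdiffAt_extend v) hX hX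
  have h3 : mvfderiv 𝓘(ℝ, E) (fun y ↦ ⟪grad (E := E) ρ y, grad ρ y⟫_ℝ) x = 0 := by
    rw [mvfderiv_congr (g := fun _ ↦ (1 : ℝ)), mvfderiv_const]
    filter_upwards [h1] with y hy
    rw [real_inner_self_eq_norm_sq, hy, one_pow]
  rw [h3, extend_apply_self, real_inner_comm (leviCivita (grad ρ) x v)] at h2
  simp only [zero_apply] at h2
  linarith

/-- The Riccati equation for the shape operator `A` of the level sets of a distance function. -/
theorem covTensor_grad_riccati (hρ : CMDiffAt ∞ ρ x)
    (h1 : ∀ᶠ y in 𝓝 x, ‖grad (E := E) ρ y‖ = 1) (v : TangentSpace 𝓘(ℝ, E) x) :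
    covTensor (fun y ↦ leviCivita (grad ρ) y) x (grad ρ x) v
      = -leviCivita (grad ρ) x (leviCivita (grad ρ) x v) - curvature x (grad ρ x) v (grad ρ x) := by
  have hX2 : CMDiffAt (2 : ℕ) (T% (grad (E := E) ρ)) x := contMDiffAt_grad_of_infty hρ 2
  have hX : MDiffAt (T% (grad (E := E) ρ)) x := contMDiffAt_zero_of_mdiff (k := 1) hX2
  have h2 := (diffEndo_leviCivita hX2).leviCivita_apply hX v
  have h0 : ∀ᶠ y in 𝓝 x, leviCivita (grad (E := E) ρ) y (grad ρ y) = 0 := by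
    filter_upwards [eventually_eventually_nhds.2 h1, eventually_contMDiffAt_infty hρ 2]
      with y hy hy2 using leviCivita_grad_self hy2 hy
  have h3 := leviCivita_congr (Z := fun y ↦ 0) ((diffEndo_leviCivita hX2).mdiffAt hX) h0
  have h4 : leviCivita (fun y : M ↦ (0 : TangentSpace 𝓘(ℝ, E) y)) x = 0 :=
    leviCivita.isCovariantDerivativeOnUniv.zero (x := x)
  rw [h3, h4] at h2
  rw [curvature_eq_secondCov hX2, secondCov, secondCov]
  simp only [zero_apply] at h2
  rw [eq_neg_of_add_eq_zero_left h2.symm]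
  abel

end Curvature

/-! ### Evolution of the mean curvature along the normal direction -/

section Evolution

variable {x : M} {ρ η : M → ℝ}
  {T : Π x : M, TangentSpace 𝓘(ℝ, E) x →L[ℝ] TangentSpace 𝓘(ℝ, E) x}

variable (E) in
/-- The shape operator `∇(∇ρ)` of the level sets of `ρ`, as a linear map. -/
abbrev shape (ρ : M → ℝ) (x : M) : TangentSpace 𝓘(ℝ, E) x →ₗ[ℝ] TangentSpace 𝓘(ℝ, E) x :=
  (leviCivita (grad (E := E) ρ) x).toLinearMap

/-- The radial curvature operator `v ↦ R(X, v)X`, `X = ∇ρ`, written through the Riccati equation so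
that its linearity is manifest. -/
def radialCurvature (ρ : M → ℝ) (x : M) (hA : DiffEndo (fun y ↦ leviCivita (grad (E := E) ρ) y) x) :
    TangentSpace 𝓘(ℝ, E) x →ₗ[ℝ] TangentSpace 𝓘(ℝ, E) x :=
  -(covTensorMap hA (grad ρ x)) - shape E ρ x ∘ₗ shape E ρ x

theorem diffEndo_shape (hρ : CMDiffAt ∞ ρ x) :
    DiffEndo (fun y ↦ leviCivita (grad (E := E) ρ) y) x :=
  diffEndo_leviCivita (contMDiffAt_grad_of_infty hρ 2)

theorem radialCurvature_apply (hρ : CMDiffAt ∞ ρ x)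
    (h1 : ∀ᶠ y in 𝓝 x, ‖grad (E := E) ρ y‖ = 1) (v : TangentSpace 𝓘(ℝ, E) x) :
    radialCurvature ρ x (diffEndo_shape hρ) v = curvature x (grad ρ x) v (grad ρ x) := by
  have := covTensor_grad_riccati hρ h1 v
  simp only [radialCurvature, LinearMap.sub_apply, LinearMap.neg_apply, covTensorMap_apply,
    LinearMap.comp_apply, ContinuousLinearMap.coe_coe]
  rw [this]
  abel

theorem covTensorMap_shape (hρ : CMDiffAt ∞ ρ x) :
    covTensorMap (diffEndo_shape hρ) (grad (E := E) ρ x) =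
      -(shape E ρ x * shape E ρ x) - radialCurvature ρ x (diffEndo_shape hρ) := by
  simp only [radialCurvature, Module.End.mul_eq_comp]
  abel

/-- The trace of the Riccati equation, with a radially parallel tensor as a weight. -/
theorem mvfderiv_trace_comp_shape (hρ : CMDiffAt ∞ ρ x)
    (hT : DiffEndo T x) (hTpar : ∀ v, covTensor T x (grad ρ x) v = 0) :
    mvfderiv 𝓘(ℝ, E) (fun y ↦ LinearMap.trace ℝ _ ((T y).toLinearMap ∘ₗ shape E ρ y)) x (grad ρ x)
      = -LinearMap.trace ℝ _ ((T x).toLinearMap ∘ₗ shape E ρ x ∘ₗ shape E ρ x)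
        - LinearMap.trace ℝ _ ((T x).toLinearMap ∘ₗ radialCurvature ρ x (diffEndo_shape hρ)) := by
  have hA := diffEndo_shape (E := E) hρ
  have h := (hT.comp hA).mvfderiv_trace (grad ρ x)
  refine h.trans ?_
  have : covTensorMap (hT.comp hA) (grad ρ x)
      = (T x).toLinearMap ∘ₗ covTensorMap (diffEndo_shape hρ) (grad ρ x) := by
    ext v
    rw [covTensorMap_apply, covTensor_comp hT hA, hTpar, zero_add]
    rfl
  rw [this, covTensorMap_shape hρ, LinearMap.comp_sub, LinearMap.comp_neg, map_sub, map_neg]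
  rfl

theorem mvfderiv_trace_shape (hρ : CMDiffAt ∞ ρ x) :
    mvfderiv 𝓘(ℝ, E) (fun y ↦ LinearMap.trace ℝ _ (shape E ρ y)) x (grad ρ x)
      = -LinearMap.trace ℝ _ (shape E ρ x ∘ₗ shape E ρ x)
        - LinearMap.trace ℝ _ (radialCurvature ρ x (diffEndo_shape hρ)) := by
  have h := (diffEndo_shape (E := E) hρ).mvfderiv_trace (grad ρ x)
  refine h.trans ?_
  rw [covTensorMap_shape hρ, map_sub, map_neg]
  rfl

theorem mvfderiv_trace_shape_sq (hρ : CMDiffAt ∞ ρ x) :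
    mvfderiv 𝓘(ℝ, E) (fun y ↦ LinearMap.trace ℝ _ (shape E ρ y ∘ₗ shape E ρ y)) x (grad ρ x)
      = -2 * LinearMap.trace ℝ _ (shape E ρ x ∘ₗ shape E ρ x ∘ₗ shape E ρ x)
        - 2 * LinearMap.trace ℝ _
          (shape E ρ x ∘ₗ radialCurvature ρ x (diffEndo_shape hρ)) := by
  have hA := diffEndo_shape (E := E) hρ
  have h := (hA.comp hA).mvfderiv_trace (grad ρ x)
  refine h.trans ?_
  have : covTensorMap (hA.comp hA) (grad ρ x)
      = covTensorMap (diffEndo_shape hρ) (grad ρ x) * shape E ρ x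
        + shape E ρ x * covTensorMap (diffEndo_shape hρ) (grad ρ x) := by
    ext v
    rw [covTensorMap_apply, covTensor_comp hA hA]
    rfl
  rw [this, map_add, LinearMap.trace_mul_comm, covTensorMap_shape hρ, mul_sub, mul_neg, map_sub,
    map_neg, ← Module.End.mul_eq_comp, ← Module.End.mul_eq_comp, ← Module.End.mul_eq_comp]
  ring

/-- For a symmetric divergence-free tensor the term `∇(div_η T)^♯` in the curvature `R_{η,T}` is a
derivative of `T ∇η`. -/
theorem weightedDivSharp_eq (hTsymm : ∀ u v : TangentSpace 𝓘(ℝ, E) x, ⟪T x u, v⟫_ℝ = ⟪u, T x v⟫_ℝ)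
    (hTdiv : ∀ v, divTensor T x v = 0) :
    weightedDivSharp η T x = -T x (grad η x) := by
  have h := (stdOrthonormalBasis ℝ (TangentSpace 𝓘(ℝ, E) x)).sum_repr' (T x (grad η x))
  rw [← h, weightedDivSharp, ← Finset.sum_neg_distrib]
  refine Finset.sum_congr rfl fun i _ ↦ ?_
  rw [hTdiv, zero_sub, neg_smul, ← inner_grad, ← hTsymm, real_inner_comm]

theorem ricciT_eq_trace (hρ : CMDiffAt ∞ ρ x) (h1 : ∀ᶠ y in 𝓝 x, ‖grad (E := E) ρ y‖ = 1) :
    ricciT T x (grad ρ x) (grad ρ x)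
      = LinearMap.trace ℝ _ ((T x).toLinearMap ∘ₗ radialCurvature ρ x (diffEndo_shape hρ)) := by
  rw [LinearMap.trace_eq_sum_inner _ (stdOrthonormalBasis ℝ (TangentSpace 𝓘(ℝ, E) x)), ricciT]
  refine Finset.sum_congr rfl fun i _ ↦ ?_
  rw [LinearMap.comp_apply, radialCurvature_apply hρ h1, real_inner_comm]
  rfl

/-- The generalized weighted mean curvature, written with a trace over the whole tangent space. -/
def traceMeanCurvature (η : M → ℝ)
    (T : Π x : M, TangentSpace 𝓘(ℝ, E) x →L[ℝ] TangentSpace 𝓘(ℝ, E) x) (ρ : M → ℝ) (x : M) : ℝ :=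
  LinearMap.trace ℝ _ ((T x).toLinearMap ∘ₗ shape E ρ x) - ⟪T x (grad η x), grad ρ x⟫_ℝ

theorem mdiffAt_traceMeanCurvature (hρ : CMDiffAt ∞ ρ x) (hT : DiffEndo T x)
    (hη : CMDiffAt ∞ η x) : MDiffAt (traceMeanCurvature η T ρ) x := by
  have h1 : MDiffAt (T% (grad (E := E) ρ)) x :=
    contMDiffAt_zero_of_mdiff (k := 0) (contMDiffAt_grad_of_infty hρ 1)
  have h2 : MDiffAt (T% (grad (E := E) η)) x :=
    contMDiffAt_zero_of_mdiff (k := 0) (contMDiffAt_grad_of_infty hη 1)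
  exact (hT.comp (diffEndo_shape hρ)).mdiffAt_trace.sub (mdiffAt_inner (hT.mdiffAt h2) h1)

/-- The Riccati equation for the weighted mean curvature: the derivative of `⟨T ∇η, X⟩` is absorbed
by the curvature `R_{η,T}`, as `∇_X X = 0`. -/
theorem mvfderiv_traceMeanCurvature (hρ : CMDiffAt ∞ ρ x)
    (h1 : ∀ᶠ y in 𝓝 x, ‖grad (E := E) ρ y‖ = 1) (hη : CMDiffAt ∞ η x)
    (hT : DiffEndo T x) (hTpar : ∀ v, covTensor T x (grad ρ x) v = 0)
    (hTsymm : ∀ (y : M) (u v : TangentSpace 𝓘(ℝ, E) y), ⟪T y u, v⟫_ℝ = ⟪u, T y v⟫_ℝ)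
    (hTdiv : ∀ (y : M) v, divTensor T y v = 0) :
    mvfderiv 𝓘(ℝ, E) (traceMeanCurvature η T ρ) x (grad ρ x)
      = -LinearMap.trace ℝ _ ((T x).toLinearMap ∘ₗ shape E ρ x ∘ₗ shape E ρ x)
        - ricciEtaT η T x (grad ρ x) (grad ρ x) := by
  have hX : MDiffAt (T% (grad (E := E) ρ)) x :=
    contMDiffAt_zero_of_mdiff (k := 0) (contMDiffAt_grad_of_infty hρ 1)
  have hY : MDiffAt (T% (grad (E := E) η)) x :=
    contMDiffAt_zero_of_mdiff (k := 0) (contMDiffAt_grad_of_infty hη 1)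
  have hTY := hT.mdiffAt hY
  have e1 := mvfderiv_sub (hT.comp (diffEndo_shape hρ)).mdiffAt_trace (mdiffAt_inner hTY hX)
  have e2 := leviCivita_metric hX hTY hX
  have e3 : leviCivita (weightedDivSharp η T) x (grad ρ x)
      = -leviCivita (fun y ↦ T y (grad η y)) x (grad ρ x) := by
    have : ∀ᶠ y in 𝓝 x, (-1 : ℝ) • T y (grad η y) = weightedDivSharp η T y :=
      Eventually.of_forall fun y ↦ by
        rw [weightedDivSharp_eq (hTsymm y) (hTdiv y), neg_one_smul]
    rw [← leviCivita_congr (Y := fun y ↦ (-1 : ℝ) • T y (grad η y))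
      (mdiffAt_smul_field hTY mdifferentiableAt_const) this,
      leviCivita_const_smul_apply _ hTY, neg_one_smul]
  have e4 := DFunLike.congr_fun e1 (grad ρ x)
  refine Eq.trans e4 ?_
  rw [sub_apply, e2, leviCivita_grad_self (eventually_contMDiffAt_infty hρ 2).self_of_nhds h1,
    inner_zero_right, add_zero, ricciEtaT, e3, ricciT_eq_trace hρ h1, inner_neg_left]
  have e5 := mvfderiv_trace_comp_shape hρ hT hTpar
  change mvfderiv 𝓘(ℝ, E) (fun y ↦ LinearMap.trace ℝ _ ((T y).toLinearMap ∘ₗ shape E ρ y)) x (grad ρ x) - _ = _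
  rw [e5]
  ring

theorem diffEndo_of_contMDiff
    (hT : ContMDiffAt 𝓘(ℝ, E) (𝓘(ℝ, E).prod 𝓘(ℝ, E →L[ℝ] E)) ∞
      (fun x : M ↦ TotalSpace.mk' (E →L[ℝ] E)
        (E := fun x : M ↦ TangentSpace 𝓘(ℝ, E) x →L[ℝ] TangentSpace 𝓘(ℝ, E) x) x (T x)) x) :
    DiffEndo T x := by
  intro v
  have hv : ContMDiffAt 𝓘(ℝ, E) (𝓘(ℝ, E).prod 𝓘(ℝ, E)) (1 : ℕ) (T% (extend E v)) x :=
    contMDiffAt_extend_field v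
  have hT1 : ContMDiffAt 𝓘(ℝ, E) (𝓘(ℝ, E).prod 𝓘(ℝ, E →L[ℝ] E)) (1 : ℕ)
      (fun x : M ↦ TotalSpace.mk' (E →L[ℝ] E)
        (E := fun x : M ↦ TangentSpace 𝓘(ℝ, E) x →L[ℝ] TangentSpace 𝓘(ℝ, E) x) x (T x)) x :=
    hT.of_le (by exact_mod_cast le_top)
  have := ContMDiffAt.clm_bundle_apply (b := fun y : M ↦ y) (v := extend E v)
    (ϕ := fun y ↦ T y) hT1 hv
  exact this.mdifferentiableAt (by norm_num)

end Evolution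

/-! ### The Riemannian distance -/

section RiemannianDistance

open MeasureTheory (volume)
open Manifold

variable {x y p : M}

theorem sub_le_integral_of_hasDerivAt_le {g g' φ : ℝ → ℝ} {a b : ℝ} (hab : a ≤ b)
    (hg : ∀ s ∈ Icc a b, HasDerivAt g (g' s) s) (hφ : Continuous φ)
    (h : ∀ s ∈ Icc a b, g' s ≤ φ s) : g b - g a ≤ ∫ s in a..b, φ s := by
  have hd : ∀ s ∈ Icc a b, HasDerivAt (fun s ↦ (∫ u in a..s, φ u) - g s) (φ s - g' s) s :=
    fun s hs ↦ (intervalIntegral.integral_hasDerivAt_right (hφ.intervalIntegrable _ _)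
      hφ.stronglyMeasurable.stronglyMeasurableAtFilter hφ.continuousAt).sub (hg s hs)
  have hm : MonotoneOn (fun s ↦ (∫ u in a..s, φ u) - g s) (Icc a b) :=
    monotoneOn_of_hasDerivWithinAt_nonneg (convex_Icc a b)
      (fun s hs ↦ (hd s hs).continuousAt.continuousWithinAt)
      (fun s hs ↦ (hd s (interior_subset hs)).hasDerivWithinAt)
      fun s hs ↦ sub_nonneg.2 (h s (interior_subset hs))
  have := hm (left_mem_Icc.2 hab) (right_mem_Icc.2 hab) hab
  simp only [intervalIntegral.integral_same] at this
  linarith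

/-- The speed of a curve. -/
def speed (α : ℝ → M) (s : ℝ) : ℝ := ‖mfderiv 𝓘(ℝ, ℝ) 𝓘(ℝ, E) α s 1‖

theorem continuous_speed {α : ℝ → M} (hα : ContMDiff 𝓘(ℝ, ℝ) 𝓘(ℝ, E) 1 α) :
    Continuous (speed (E := E) α) := by
  have h1 : Continuous (fun s : ℝ ↦ (⟨s, (1 : ℝ)⟩ : TangentBundle 𝓘(ℝ, ℝ) ℝ)) := by
    rw [← (tangentBundleModelSpaceHomeomorph 𝓘(ℝ, ℝ)).comp_continuous_iff]
    exact Continuous.prodMk continuous_id continuous_const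
  have h2 := (hα.continuous_tangentMap le_rfl).comp h1
  have : IsContinuousRiemannianBundle E (fun x : M ↦ TangentSpace 𝓘(ℝ, E) x) := by
    obtain ⟨g, hg, hg'⟩ := IsContMDiffRiemannianBundle.exists_contMDiff (IB := 𝓘(ℝ, E)) (n := ∞)
      (F := E) (E := fun x : M ↦ TangentSpace 𝓘(ℝ, E) x)
    exact ⟨g, hg.continuous, hg'⟩
  have h3 : Continuous (fun s ↦ ⟪mfderiv 𝓘(ℝ, ℝ) 𝓘(ℝ, E) α s (1 : ℝ),
      mfderiv 𝓘(ℝ, ℝ) 𝓘(ℝ, E) α s (1 : ℝ)⟫_ℝ) :=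
    Continuous.inner_bundle (E := fun x : M ↦ TangentSpace 𝓘(ℝ, E) x) (F := E) (b := α) h2 h2
  have h4 := h3.sqrt
  convert h4 using 2 with s
  exact norm_eq_sqrt_real_inner _

theorem continuousAt_norm_field {Y : Π x : M, TangentSpace 𝓘(ℝ, E) x}
    (hY : CMDiffAt (0 : ℕ) (T% Y) x) : ContinuousAt (fun y ↦ ‖Y y‖) x := by
  have h := (contMDiffAt_inner hY hY).continuousAt.sqrt
  convert h using 2 with y
  exact norm_eq_sqrt_real_inner _

variable [IsRiemannianManifold 𝓘(ℝ, E) M]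

theorem pathELength_eq_ofReal {α : ℝ → M} (hα : ContMDiff 𝓘(ℝ, ℝ) 𝓘(ℝ, E) 1 α) {a b : ℝ}
    (hab : a ≤ b) :
    pathELength 𝓘(ℝ, E) α a b = ENNReal.ofReal (∫ s in a..b, speed (E := E) α s) := by
  have hc := continuous_speed hα
  rw [pathELength_eq_lintegral_mfderiv_Icc, intervalIntegral.integral_of_le hab,
    ← MeasureTheory.integral_Icc_eq_integral_Ioc,
    MeasureTheory.ofReal_integral_eq_lintegral_ofReal (hc.integrableOn_Icc)
      (Eventually.of_forall fun s ↦ norm_nonneg _)]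
  refine MeasureTheory.lintegral_congr fun s ↦ ?_
  rw [speed, ofReal_norm]

theorem dist_le_integral_speed {α : ℝ → M} (hα : ContMDiff 𝓘(ℝ, ℝ) 𝓘(ℝ, E) 1 α) {a b : ℝ}
    (hab : a ≤ b) : dist (α a) (α b) ≤ ∫ s in a..b, speed (E := E) α s := by
  have h := riemannianEDist_le_pathELength (I := 𝓘(ℝ, E)) (a := a) (b := b) hα.contMDiffOn rfl rfl
    hab
  rw [← IsRiemannianManifold.out (I := 𝓘(ℝ, E)), pathELength_eq_ofReal hα hab] at h
  rw [edist_dist] at h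
  exact (ENNReal.ofReal_le_ofReal_iff (intervalIntegral.integral_nonneg hab
    fun s _ ↦ norm_nonneg _)).1 h

theorem dist_le_of_speed_le {α : ℝ → M} {a b C : ℝ} (hab : a ≤ b) (hC : 0 ≤ C)
    (hα : ContMDiffOn 𝓘(ℝ, ℝ) 𝓘(ℝ, E) 1 α (Icc a b))
    (h : ∀ s ∈ Icc a b, speed (E := E) α s ≤ C) : dist (α a) (α b) ≤ C * (b - a) := by
  have h1 := riemannianEDist_le_pathELength (I := 𝓘(ℝ, E)) (a := a) (b := b) hα rfl rfl hab
  rw [← IsRiemannianManifold.out (I := 𝓘(ℝ, E)), pathELength_eq_lintegral_mfderiv_Icc] at h1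
  have h2 : ∫⁻ s in Icc a b, ‖mfderiv 𝓘(ℝ, ℝ) 𝓘(ℝ, E) α s 1‖ₑ
      ≤ ∫⁻ s in Icc a b, ENNReal.ofReal C := by
    refine MeasureTheory.setLIntegral_mono measurable_const fun s hs ↦ ?_
    rw [← ofReal_norm]
    exact ENNReal.ofReal_le_ofReal (h s hs)
  have h3 := h1.trans h2
  rw [MeasureTheory.setLIntegral_const, Real.volume_Icc, ← ENNReal.ofReal_mul hC, edist_dist] at h3
  exact (ENNReal.ofReal_le_ofReal_iff (mul_nonneg hC (sub_nonneg.2 hab))).1 h3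

/-- Two points are joined by `C¹` curves whose length is arbitrarily close to their distance. -/
theorem exists_nearly_minimal_curve (x y : M) {ε : ℝ} (hε : 0 < ε) :
    ∃ α : ℝ → M, ContMDiff 𝓘(ℝ, ℝ) 𝓘(ℝ, E) 1 α ∧ α 0 = x ∧ α 1 = y ∧
      ∫ s in (0 : ℝ)..1, speed (E := E) α s < dist x y + ε := by
  have h : riemannianEDist 𝓘(ℝ, E) x y < ENNReal.ofReal (dist x y + ε) := by
    rw [← IsRiemannianManifold.out (I := 𝓘(ℝ, E)), edist_dist]
    exact (ENNReal.ofReal_lt_ofReal_iff (by positivity)).2 (by linarith)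
  obtain ⟨α, h0, h1, hα, hl, -⟩ := exists_lt_locally_constant_of_riemannianEDist_lt h zero_lt_one
  refine ⟨α, hα, h0, h1, ?_⟩
  rw [pathELength_eq_ofReal hα zero_le_one] at hl
  exact (ENNReal.ofReal_lt_ofReal_iff (by positivity)).1 hl

theorem hasDerivAt_comp_curve {α : ℝ → M} {f : M → ℝ} {s : ℝ}
    (hf : MDiffAt f (α s)) (hα : MDifferentiableAt 𝓘(ℝ, ℝ) 𝓘(ℝ, E) α s) :
    HasDerivAt (f ∘ α)
      (mvfderiv 𝓘(ℝ, E) f (α s) (mfderiv 𝓘(ℝ, ℝ) 𝓘(ℝ, E) α s 1)) s := by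
  have h1 := (hf.hasMFDerivAt.comp s hα.hasMFDerivAt).hasFDerivAt
  exact HasFDerivAt.hasDerivAt (F := ℝ) (f := f ∘ α) (x := s) h1

/-- A function whose gradient is bounded by `q` on a ball is `q`-Lipschitz at its centre. -/
theorem abs_sub_le_of_norm_grad_le {f : M → ℝ} {R q : ℝ} (hq : 0 ≤ q)
    (hf : ∀ z ∈ Metric.ball x R, MDiffAt f z ∧ ‖grad (E := E) f z‖ ≤ q) (hy : dist x y < R) :
    |f y - f x| ≤ q * dist x y := by
  refine le_of_forall_pos_le_add fun ε hε ↦ ?_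
  obtain ⟨ε', hε', h1, h2⟩ : ∃ ε' > 0, dist x y + ε' ≤ R ∧ q * ε' ≤ ε := by
    refine ⟨min (R - dist x y) (ε / (q + 1)), lt_min (by linarith) (by positivity), ?_, ?_⟩
    · linarith [min_le_left (R - dist x y) (ε / (q + 1))]
    · calc q * min (R - dist x y) (ε / (q + 1)) ≤ q * (ε / (q + 1)) := by
            gcongr; exact min_le_right _ _
        _ ≤ (q + 1) * (ε / (q + 1)) := by gcongr; linarith
        _ = ε := by field_simp
  obtain ⟨α, hα, h0, h1', hl⟩ := exists_nearly_minimal_curve (E := E) x y hε'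
  have hc := continuous_speed hα
  have hint : ∀ a b, IntervalIntegrable (speed (E := E) α) volume a b :=
    fun a b ↦ hc.intervalIntegrable a b
  have hmem : ∀ s ∈ Icc (0 : ℝ) 1, α s ∈ Metric.ball x R := by
    intro s hs
    have h3 := dist_le_integral_speed hα hs.1
    have h4 := intervalIntegral.integral_add_adjacent_intervals (hint 0 s) (hint s 1)
    have h5 : 0 ≤ ∫ u in s..1, speed (E := E) α u :=
      intervalIntegral.integral_nonneg hs.2 fun u _ ↦ norm_nonneg _
    rw [Metric.mem_ball, dist_comm, ← h0]
    rw [← h0] at hl h1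
    linarith
  have hd : ∀ s ∈ Icc (0 : ℝ) 1, HasDerivAt (f ∘ α)
      (mvfderiv 𝓘(ℝ, E) f (α s) (mfderiv 𝓘(ℝ, ℝ) 𝓘(ℝ, E) α s 1)) s := fun s hs ↦
    hasDerivAt_comp_curve (hf _ (hmem s hs)).1 (hα.mdifferentiableAt one_ne_zero)
  have hb : ∀ s ∈ Icc (0 : ℝ) 1,
      |mvfderiv 𝓘(ℝ, E) f (α s) (mfderiv 𝓘(ℝ, ℝ) 𝓘(ℝ, E) α s 1)| ≤ q * speed (E := E) α s := by
    intro s hs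
    rw [← inner_grad]
    exact (abs_real_inner_le_norm _ _).trans
      (mul_le_mul_of_nonneg_right (hf _ (hmem s hs)).2 (norm_nonneg _))
  have hqc : Continuous (fun s ↦ q * speed (E := E) α s) := continuous_const.mul hc
  have key1 := sub_le_integral_of_hasDerivAt_le zero_le_one hd hqc
    fun s hs ↦ (le_abs_self _).trans (hb s hs)
  have key2 := sub_le_integral_of_hasDerivAt_le zero_le_one (fun s hs ↦ (hd s hs).neg) hqc
    fun s hs ↦ (neg_le_abs _).trans (hb s hs)
  rw [intervalIntegral.integral_const_mul] at key1 key2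
  simp only [Pi.neg_apply, Function.comp_apply, h0, h1'] at key1 key2
  have h6 : q * ∫ s in (0 : ℝ)..1, speed (E := E) α s ≤ q * (dist x y + ε') := by gcongr
  rw [abs_le]
  constructor <;> nlinarith

/-- The curve through `x` that is the straight line with velocity `e` in the chart at `x`. -/
def chartLine (x : M) (e : E) (t : ℝ) : M :=
  (extChartAt 𝓘(ℝ, E) x).symm (extChartAt 𝓘(ℝ, E) x x + t • e)

theorem chartLine_zero (x : M) (e : E) : chartLine x e 0 = x := by
  simp [chartLine]

theorem eventually_chartLine (x : M) (e : E) : ∀ᶠ t in 𝓝 (0 : ℝ),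
    ContMDiffAt 𝓘(ℝ, ℝ) 𝓘(ℝ, E) ∞ (chartLine x e) t ∧
    mfderiv 𝓘(ℝ, ℝ) 𝓘(ℝ, E) (chartLine x e) t 1 = extend E (asTangent x e) (chartLine x e t) := by
  set φ := extChartAt 𝓘(ℝ, E) x with hφ
  have hLc : ContDiff ℝ ∞ (fun t : ℝ ↦ φ x + t • e) := by fun_prop
  have hLd : ∀ t, HasDerivAt (fun t : ℝ ↦ φ x + t • e) e t := fun t ↦ by
    simpa using ((hasDerivAt_id t).smul_const e).const_add (φ x)
  have htgt : ∀ᶠ t in 𝓝 (0 : ℝ), φ x + t • e ∈ φ.target := by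
    refine hLc.continuous.continuousAt.eventually_mem ?_
    rw [zero_smul, add_zero]
    exact extChartAt_target_mem_nhds x
  filter_upwards [htgt] with t ht
  have hs : ContMDiffAt 𝓘(ℝ, E) 𝓘(ℝ, E) ∞ φ.symm (φ x + t • e) :=
    (contMDiffOn_extChartAt_symm x).contMDiffAt ((isOpen_extChartAt_target x).mem_nhds ht)
  refine ⟨hs.comp t hLc.contMDiff.contMDiffAt, ?_⟩
  have hsrc : chartLine x e t ∈ (chartAt E x).source := by
    have := φ.map_target ht
    rwa [extChartAt_source] at this
  have hr : φ (chartLine x e t) = φ x + t • e := φ.right_inv ht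
  rw [extend_eq_mfderiv_symm hsrc]
  have h1 := mfderiv_comp t (hs.mdifferentiableAt (by simp))
    (hLd t).differentiableAt.mdifferentiableAt
  have h2 := DFunLike.congr_fun h1 (1 : ℝ)
  refine h2.trans ?_
  have h3 : mfderiv 𝓘(ℝ, ℝ) 𝓘(ℝ, E) (fun t : ℝ ↦ φ x + t • e) t (1 : ℝ) = e := by
    rw [mfderiv_eq_fderiv]
    exact (hLd t).deriv
  have h4 : ∀ ξ, ξ = φ x + t • e → mfderiv 𝓘(ℝ, E) 𝓘(ℝ, E) φ.symm (φ x + t • e)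
      (mfderiv 𝓘(ℝ, ℝ) 𝓘(ℝ, E) (fun t : ℝ ↦ φ x + t • e) t (1 : ℝ))
      = mfderiv 𝓘(ℝ, E) 𝓘(ℝ, E) φ.symm ξ e := by
    rintro ξ rfl
    exact congrArg _ h3
  exact h4 _ hr

theorem continuousAt_norm_extend (v : TangentSpace 𝓘(ℝ, E) x) :
    ContinuousAt (fun y ↦ ‖extend E v y‖) x :=
  continuousAt_norm_field (contMDiffAt_extend_field v)

theorem hasDerivAt_comp_chartLine {f : M → ℝ} (hf : MDiffAt f x) (v : TangentSpace 𝓘(ℝ, E) x) :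
    HasDerivAt (fun t ↦ f (chartLine (E := E) x v t)) (mvfderiv 𝓘(ℝ, E) f x v) 0 := by
  obtain ⟨h1, h2⟩ := (eventually_chartLine (E := E) x v).self_of_nhds
  have h0 : chartLine (E := E) x v 0 = x := chartLine_zero (E := E) x v
  have h := hasDerivAt_comp_curve (E := E) (f := f) (α := chartLine (E := E) x v) (s := 0)
    (by rw [h0]; exact hf) (h1.mdifferentiableAt (by simp))
  rw [h2] at h
  have h3 : ∀ y, y = x → mvfderiv 𝓘(ℝ, E) f x v
      = mvfderiv 𝓘(ℝ, E) f y (extend E v y) := by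
    rintro y rfl
    rw [extend_apply_self]
  exact h.congr_deriv (h3 _ h0).symm

/-- The derivative of a `1`-Lipschitz function does not exceed `1`. -/
theorem norm_grad_le_one {f : M → ℝ} (hf : MDiffAt f x) (h : ∀ y, |f y - f x| ≤ dist x y) :
    ‖grad (E := E) f x‖ ≤ 1 := by
  set w := grad (E := E) f x with hw
  have hd := hasDerivAt_comp_chartLine hf w
  have h0 := chartLine_zero (E := E) x w
  rw [← inner_grad, real_inner_self_eq_norm_sq] at hd
  have key : ∀ ε > 0, ‖w‖ ^ 2 ≤ ‖w‖ + ε := by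
    intro ε hε
    have hc : ContinuousAt (chartLine (E := E) x w) 0 :=
      (eventually_chartLine (E := E) x w).self_of_nhds.1.continuousAt
    have hc2 : ∀ᶠ t in 𝓝 (0 : ℝ), ‖extend E w (chartLine (E := E) x w t)‖ < ‖w‖ + ε := by
      have h1 := continuousAt_norm_extend w
      have h2 : ∀ᶠ y in 𝓝 x, ‖extend E w y‖ < ‖w‖ + ε :=
        h1.eventually_lt_const (by simp only [extend_apply_self]; linarith)
      rw [ContinuousAt, h0] at hc
      exact hc.eventually h2
    obtain ⟨t0, ht0, hb⟩ := Metric.eventually_nhds_iff.1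
      ((eventually_chartLine (E := E) x w).and hc2)
    have hmain : ∀ᶠ t in 𝓝[>] (0 : ℝ),
        slope (fun t ↦ f (chartLine (E := E) x w t)) 0 t ≤ ‖w‖ + ε := by
      filter_upwards [Ioo_mem_nhdsGT ht0] with t ht
      have hin : ∀ s ∈ Icc 0 t, dist s 0 < t0 := fun s hs ↦ by
        rw [Real.dist_eq, sub_zero, abs_of_nonneg hs.1]; exact hs.2.trans_lt ht.2
      have h1 := dist_le_of_speed_le (E := E) (α := chartLine (E := E) x w) (C := ‖w‖ + ε) ht.1.le
        (by positivity)
        (fun s hs ↦ ((hb (hin s hs)).1.1.of_le (by exact_mod_cast le_top)).contMDiffWithinAt)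
        (fun s hs ↦ by
          rw [speed, (hb (hin s hs)).1.2]
          exact (hb (hin s hs)).2.le)
      rw [h0, sub_zero] at h1
      rw [slope_def_field, sub_zero, div_le_iff₀ ht.1, h0]
      exact (le_abs_self _).trans ((h _).trans h1)
    exact le_of_tendsto ((hasDerivAt_iff_tendsto_slope.1 hd).mono_left
      (nhdsWithin_mono (0 : ℝ) (s := Ioi 0) fun t ht ↦ ne_of_gt ht)) hmain
  have h2 : ‖w‖ ^ 2 ≤ ‖w‖ := le_of_forall_pos_le_add key
  nlinarith [norm_nonneg w]

/-- The eikonal equation for the distance from a point. -/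
theorem norm_grad_dist_eq_one (hx : x ≠ p)
    (hr : ∀ᶠ z in 𝓝 x, ContMDiffAt 𝓘(ℝ, E) 𝓘(ℝ, ℝ) ∞ (fun z ↦ dist p z) z) :
    ‖grad (E := E) (fun z ↦ dist p z) x‖ = 1 := by
  have hmd : ∀ᶠ z in 𝓝 x, MDiffAt (fun z ↦ dist p z) z :=
    hr.mono fun z hz ↦ hz.mdifferentiableAt (by simp)
  refine le_antisymm (norm_grad_le_one hmd.self_of_nhds fun y ↦ ?_) ?_
  · rw [dist_comm p y, dist_comm p x, dist_comm x y]; exact abs_dist_sub_le _ _ _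
  by_contra! hlt
  obtain ⟨q, hq1, hq2⟩ := exists_between hlt
  have hq0 : 0 ≤ q := (norm_nonneg _).trans hq1.le
  have hc : ContinuousAt (fun z ↦ ‖grad (E := E) (fun z ↦ dist p z) z‖) x :=
    continuousAt_norm_field (contMDiffAt_grad_of_infty hr.self_of_nhds 0)
  obtain ⟨R, hR, hball⟩ := Metric.eventually_nhds_iff_ball.1
    (hmd.and (hc.eventually_lt_const hq1))
  set d := min (R / 2) (dist x p) with hd
  have hdp : 0 < d := lt_min (by linarith) (dist_pos.2 hx)
  obtain ⟨α, hα, h0, h1, hl⟩ := exists_nearly_minimal_curve (E := E) x p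
    (ε := (1 - q) * d / 2) (by nlinarith)
  -- a point at distance `d` from `x` on a nearly minimal curve from `x` to `p`
  obtain ⟨s, hs, hsd⟩ : ∃ s ∈ Icc (0 : ℝ) 1, dist x (α s) = d := by
    have hcont : ContinuousOn (fun s ↦ dist x (α s)) (Icc 0 1) :=
      (continuous_const.dist hα.continuous).continuousOn
    have := intermediate_value_Icc zero_le_one hcont
    simp only [h0, h1, dist_self] at this
    exact this ⟨hdp.le, min_le_right _ _⟩
  have e1 := dist_le_integral_speed hα hs.1
  have e2 := dist_le_integral_speed hα hs.2
  have hint : ∀ a b, IntervalIntegrable (speed (E := E) α) volume a b :=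
    fun a b ↦ (continuous_speed hα).intervalIntegrable a b
  have e3 := intervalIntegral.integral_add_adjacent_intervals (hint 0 s) (hint s 1)
  rw [h0] at e1
  rw [h1] at e2
  have e4 := abs_sub_le_of_norm_grad_le (E := E) (x := x) (y := α s)
    (f := fun z ↦ dist p z) hq0 (fun z hz ↦ ⟨(hball z hz).1, (hball z hz).2.le⟩)
    (by rw [hsd]; exact (min_le_left _ _).trans_lt (by linarith))
  rw [hsd, abs_le] at e4
  rw [dist_comm p x, dist_comm p (α s)] at e4
  nlinarith

/-! ### Minimal geodesics -/

variable {γ : ℝ → M} {ℓ : ℝ}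

theorem dist_geodesic (hγ : IsMinimalGeodesic E γ p ℓ) {t : ℝ} (ht : t ∈ Icc 0 ℓ) :
    dist p (γ t) = t := by
  have := hγ.dist_eq 0 (left_mem_Icc.2 (ht.1.trans ht.2)) t ht
  rwa [hγ.start, zero_sub, abs_neg, abs_of_nonneg ht.1] at this

variable (E) in
/-- The velocity of a minimal geodesic at an interior point or an end point of its interval. -/
def velocity (γ : ℝ → M) (ℓ t : ℝ) : TangentSpace 𝓘(ℝ, E) (γ t) :=
  mfderivWithin 𝓘(ℝ, ℝ) 𝓘(ℝ, E) γ (Icc 0 ℓ) t 1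

theorem hasDerivWithinAt_comp_geodesic (hγ : IsMinimalGeodesic E γ p ℓ) {t : ℝ}
    (ht : t ∈ Icc 0 ℓ) {f : M → ℝ} (hf : MDiffAt f (γ t)) :
    HasDerivWithinAt (f ∘ γ) (mvfderiv 𝓘(ℝ, E) f (γ t) (velocity E γ ℓ t)) (Icc 0 ℓ) t := by
  have h1 := (hf.hasMFDerivAt.comp_hasMFDerivWithinAt t
    ((hγ.smooth.mdifferentiableOn (by simp)) t ht).hasMFDerivWithinAt).hasFDerivWithinAt
  exact HasFDerivWithinAt.hasDerivWithinAt (F := ℝ) (f := f ∘ γ) (x := t) h1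

/-- The velocity of a minimal geodesic has norm at most `1`: test the local Lipschitz bound on a
function with prescribed gradient at `γ t`. -/
theorem norm_velocity_le_one (hγ : IsMinimalGeodesic E γ p ℓ) {t : ℝ} (ht : t ∈ Ioc 0 ℓ) :
    ‖velocity E γ ℓ t‖ ≤ 1 := by
  set x := γ t with hx
  set w := velocity E γ ℓ t with hw
  -- a function that is linear in the chart, with gradient `w` at `x`
  let Λ : E →L[ℝ] ℝ := LinearMap.toContinuousLinearMap
    ({ toFun := fun e ↦ ⟪w, asTangent x e⟫_ℝ
       map_add' := fun a b ↦ inner_add_right (𝕜 := ℝ) w (asTangent x a) (asTangent x b)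
       map_smul' := fun a b ↦ real_inner_smul_right w (asTangent x b) a } : E →ₗ[ℝ] ℝ)
  let f : M → ℝ := fun y ↦ Λ (extChartAt 𝓘(ℝ, E) x y)
  have hf : CMDiffAt ∞ f x :=
    Λ.contDiff.contMDiff.contMDiffAt.comp x contMDiffAt_extChartAt
  have hfx : ∀ v : TangentSpace 𝓘(ℝ, E) x, mvfderiv 𝓘(ℝ, E) f x v = ⟪w, v⟫_ℝ := by
    intro v
    rw [mvfderiv_eq_fderiv_chart (hf.mdifferentiableAt (by simp))]
    have h1 : f ∘ (extChartAt 𝓘(ℝ, E) x).symm =ᶠ[𝓝 (extChartAt 𝓘(ℝ, E) x x)] Λ := by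
      filter_upwards [extChartAt_target_mem_nhds (I := 𝓘(ℝ, E)) x] with ξ hξ
      simp only [f, Function.comp_apply, (extChartAt 𝓘(ℝ, E) x).right_inv hξ]
    rw [h1.fderiv_eq, Λ.fderiv]
    rfl
  have hgrad : grad (E := E) f x = w :=
    ext_inner_right ℝ fun v ↦ by rw [inner_grad, hfx]
  have hd := hasDerivWithinAt_comp_geodesic hγ (Ioc_subset_Icc_self ht)
    (hf.mdifferentiableAt (by simp))
  rw [hfx, real_inner_self_eq_norm_sq] at hd
  have key : ∀ ε > 0, ‖w‖ ^ 2 ≤ ‖w‖ + ε := by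
    intro ε hε
    have hc : ContinuousAt (fun z ↦ ‖grad (E := E) f z‖) x :=
      continuousAt_norm_field (contMDiffAt_grad_of_infty hf 0)
    obtain ⟨R, hR, hball⟩ := Metric.eventually_nhds_iff_ball.1
      (((eventually_contMDiffAt_infty hf 1).mono fun z hz ↦ hz.mdifferentiableAt one_ne_zero).and
        (hc.eventually_lt_const (u := ‖w‖ + ε) (by simp only [hgrad]; linarith)))
    have h2 := ((hasDerivWithinAt_iff_tendsto_slope.1 hd).mono_left
      (nhdsWithin_mono t (s := Ioo (max 0 (t - R)) t) fun s hs ↦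
        ⟨⟨(le_max_left _ _).trans hs.1.le, hs.2.le.trans ht.2⟩, ne_of_lt hs.2⟩))
    have hne : (𝓝[Ioo (max 0 (t - R)) t] t).NeBot := by
      refine mem_closure_iff_nhdsWithin_neBot.1 ?_
      have hlt : max 0 (t - R) < t := max_lt ht.1 (by linarith)
      rw [closure_Ioo hlt.ne]
      exact right_mem_Icc.2 hlt.le
    refine le_of_tendsto h2 ?_
    filter_upwards [self_mem_nhdsWithin] with s hs
    have hs0 : 0 ≤ s := (le_max_left _ _).trans hs.1.le
    have hsR : t - R < s := (le_max_right _ _).trans_lt hs.1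
    have hdist : dist x (γ s) = t - s := by
      rw [hx, hγ.dist_eq t (Ioc_subset_Icc_self ht) s ⟨hs0, hs.2.le.trans ht.2⟩, abs_of_pos]
      linarith [hs.2]
    have h3 := abs_sub_le_of_norm_grad_le (E := E) (x := x) (y := γ s) (f := f) (R := R)
      (q := ‖w‖ + ε) (by positivity) (fun z hz ↦ ⟨(hball z hz).1, (hball z hz).2.le⟩)
      (by rw [hdist]; linarith)
    rw [hdist] at h3
    rw [slope_def_field, div_le_iff_of_neg (by linarith [hs.2])]
    simp only [Function.comp_apply]
    linarith [neg_abs_le (f (γ s) - f x)]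
  have h2 : ‖w‖ ^ 2 ≤ ‖w‖ := le_of_forall_pos_le_add key
  nlinarith [norm_nonneg w]

/-- Along a minimal geodesic from `p` that avoids the cut locus, the velocity is `∂_r`. -/
theorem velocity_eq_radial (hγ : IsMinimalGeodesic E γ p ℓ) {t : ℝ} (ht : t ∈ Ioc 0 ℓ)
    (hr : γ t ∈ distSmoothSet E p) : velocity E γ ℓ t = radial p (γ t) := by
  have ht' := Ioc_subset_Icc_self ht
  have hne : γ t ≠ p := fun h ↦ by
    have := dist_geodesic hγ ht'
    rw [h, dist_self] at this
    exact ht.1.ne this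
  have hX := norm_grad_dist_eq_one hne hr
  have hd := hasDerivWithinAt_comp_geodesic hγ ht'
    ((show ∀ᶠ z in 𝓝 (γ t), ContMDiffAt 𝓘(ℝ, E) 𝓘(ℝ, ℝ) ∞ (fun z ↦ dist p z) z from
      hr).self_of_nhds.mdifferentiableAt (by simp))
  have hd2 : HasDerivWithinAt ((fun z ↦ dist p z) ∘ γ) 1 (Icc 0 ℓ) t :=
    (hasDerivWithinAt_id t _).congr (fun s hs ↦ dist_geodesic hγ hs) (dist_geodesic hγ ht')
  have hu : UniqueDiffWithinAt ℝ (Icc 0 ℓ) t := uniqueDiffOn_Icc (ht.1.trans_le ht.2) t ht'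
  have h1 := hu.eq_deriv _ hd hd2
  rw [← inner_grad] at h1
  have hV := norm_velocity_le_one hγ ht
  change _ = grad (E := E) (fun z ↦ dist p z) (γ t)
  set X := grad (E := E) (fun z ↦ dist p z) (γ t)
  set V := velocity E γ ℓ t
  have h2 : ‖V - X‖ ^ 2 ≤ 0 := by
    rw [norm_sub_sq_real, real_inner_comm, h1, hX]
    nlinarith [norm_nonneg V]
  have h3 : ‖V - X‖ = 0 := by nlinarith [norm_nonneg (V - X)]
  exact sub_eq_zero.1 (norm_eq_zero.1 h3)

end RiemannianDistance

/-! ### Traces of symmetric endomorphisms -/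

section LinearAlgebra

variable {V : Type*} [NormedAddCommGroup V] [InnerProductSpace ℝ V] [FiniteDimensional ℝ V]

/-- The projection to the hyperplane orthogonal to a unit vector `X`. -/
def perpProj (X : V) : V →ₗ[ℝ] V := LinearMap.id - (innerₛₗ ℝ X).smulRight X

theorem perpProj_apply (X v : V) : perpProj X v = v - ⟪X, v⟫_ℝ • X := rfl

theorem inner_perpProj (X u v : V) : ⟪perpProj X u, v⟫_ℝ = ⟪u, perpProj X v⟫_ℝ := by
  simp only [perpProj_apply, inner_sub_left, inner_sub_right, real_inner_smul_left,
    real_inner_smul_right, real_inner_comm X u]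
  ring

theorem perpProj_self {X : V} (hX : ‖X‖ = 1) : perpProj X X = 0 := by
  rw [perpProj_apply, real_inner_self_eq_norm_sq, hX]; simp

theorem inner_perpProj_self {X : V} (hX : ‖X‖ = 1) (v : V) : ⟪perpProj X v, X⟫_ℝ = 0 := by
  rw [inner_perpProj, perpProj_self hX, inner_zero_right]

theorem perpProj_of_inner_eq_zero {X u : V} (h : ⟪u, X⟫_ℝ = 0) : perpProj X u = u := by
  rw [perpProj_apply, real_inner_comm, h]; simp

theorem perpProj_comp_self {X : V} (hX : ‖X‖ = 1) : perpProj X ∘ₗ perpProj X = perpProj X :=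
  LinearMap.ext fun v ↦ perpProj_of_inner_eq_zero (inner_perpProj_self hX v)

theorem trace_perpProj {X : V} (hX : ‖X‖ = 1) :
    LinearMap.trace ℝ V (perpProj X) = Module.finrank ℝ V - 1 := by
  rw [perpProj, map_sub, LinearMap.trace_id, LinearMap.trace_smulRight]
  simp [hX]

theorem comp_perpProj {X : V} {A : V →ₗ[ℝ] V} (hA : A X = 0) : A ∘ₗ perpProj X = A :=
  LinearMap.ext fun v ↦ by simp [perpProj_apply, hA]

theorem perpProj_comp {X : V} {A : V →ₗ[ℝ] V} (hAs : A.IsSymmetric) (hA : A X = 0) :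
    perpProj X ∘ₗ A = A :=
  LinearMap.ext fun v ↦ perpProj_of_inner_eq_zero (by rw [hAs, hA, inner_zero_right])

/-- A vector on which a positive semidefinite form vanishes lies in its kernel. -/
theorem apply_eq_zero_of_inner_eq_zero {S : V →ₗ[ℝ] V} (hS : S.IsSymmetric)
    (hpos : ∀ v, 0 ≤ ⟪S v, v⟫_ℝ) {u : V} (hu : ⟪S u, u⟫_ℝ = 0) : S u = 0 := by
  have h : ∀ t : ℝ, 0 ≤ (⟪S (S u), S u⟫_ℝ) * (t * t) + (2 * ‖S u‖ ^ 2) * t + 0 := by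
    intro t
    have := hpos (u + t • S u)
    have h2 : ⟪S (S u), u⟫_ℝ = ‖S u‖ ^ 2 := by
      rw [hS, real_inner_self_eq_norm_sq]
    simp only [map_add, map_smul, inner_add_left, inner_add_right, real_inner_smul_left,
      real_inner_smul_right, hu, h2, real_inner_self_eq_norm_sq] at this
    linarith
  have hd := discrim_le_zero h
  rw [discrim] at hd
  have : ‖S u‖ ^ 2 = 0 := by nlinarith [sq_nonneg (‖S u‖ ^ 2)]
  exact norm_eq_zero.1 (pow_eq_zero_iff two_ne_zero |>.1 this)

theorem trace_conj_eq_sum {T B : V →ₗ[ℝ] V} (hB : B.IsSymmetric) :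
    LinearMap.trace ℝ V (T ∘ₗ B ∘ₗ B)
      = ∑ i, ⟪T (B (stdOrthonormalBasis ℝ V i)), B (stdOrthonormalBasis ℝ V i)⟫_ℝ := by
  rw [← LinearMap.comp_assoc, LinearMap.trace_comp_comm',
    LinearMap.trace_eq_sum_inner _ (stdOrthonormalBasis ℝ V)]
  refine Finset.sum_congr rfl fun i _ ↦ ?_
  rw [LinearMap.comp_apply, ← hB, real_inner_comm]
  rfl

theorem ext_stdOrthonormalBasis {B C : V →ₗ[ℝ] V}
    (h : ∀ i, B (stdOrthonormalBasis ℝ V i) = C (stdOrthonormalBasis ℝ V i)) : B = C :=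
  (stdOrthonormalBasis ℝ V).toBasis.ext fun i ↦ by simpa using h i

variable {X : V} {A T : V →ₗ[ℝ] V} {δ : ℝ}

theorem isSymmetric_perpProj : (perpProj X).IsSymmetric := fun u v ↦ inner_perpProj X u v

/-- Expansion of the square of the deviation `A - s P` of the shape operator from an umbilical
one. -/
theorem trace_sq_sub (hX : ‖X‖ = 1) (hAs : A.IsSymmetric) (hA : A X = 0) (s : ℝ) :
    LinearMap.trace ℝ V (T ∘ₗ (A - s • perpProj X) ∘ₗ (A - s • perpProj X))
      = LinearMap.trace ℝ V (T ∘ₗ A ∘ₗ A) - 2 * s * LinearMap.trace ℝ V (T ∘ₗ A)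
        + s ^ 2 * LinearMap.trace ℝ V (T ∘ₗ perpProj X) := by
  simp only [LinearMap.comp_sub, LinearMap.sub_comp, LinearMap.comp_smul, LinearMap.smul_comp,
    comp_perpProj hA, perpProj_comp hAs hA, perpProj_comp_self hX, map_sub, map_smul, smul_eq_mul]
  ring

theorem isSymmetric_sub_smul (hAs : A.IsSymmetric) (s : ℝ) :
    (A - s • perpProj X).IsSymmetric := fun u v ↦ by
  simp only [LinearMap.sub_apply, LinearMap.smul_apply, inner_sub_left, inner_sub_right,
    real_inner_smul_left, real_inner_smul_right, hAs u v, inner_perpProj]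

theorem trace_comp_sq_nonneg (hT : ∀ v, 0 ≤ ⟪T v, v⟫_ℝ) {B : V →ₗ[ℝ] V} (hB : B.IsSymmetric) :
    0 ≤ LinearMap.trace ℝ V (T ∘ₗ B ∘ₗ B) := by
  rw [trace_conj_eq_sum hB]
  exact Finset.sum_nonneg fun i _ ↦ hT _

theorem trace_comp_perpProj_le (hX : ‖X‖ = 1) (hTδ : ∀ v, ⟪T v, v⟫_ℝ ≤ δ * ‖v‖ ^ 2) :
    LinearMap.trace ℝ V (T ∘ₗ perpProj X) ≤ (Module.finrank ℝ V - 1) * δ := by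
  have h : 0 ≤ LinearMap.trace ℝ V ((δ • LinearMap.id - T) ∘ₗ perpProj X ∘ₗ perpProj X) := by
    refine trace_comp_sq_nonneg (fun v ↦ ?_) isSymmetric_perpProj
    simp only [LinearMap.sub_apply, LinearMap.smul_apply, LinearMap.id_apply, inner_sub_left,
      real_inner_smul_left, real_inner_self_eq_norm_sq]
    linarith [hTδ v]
  rw [perpProj_comp_self hX, LinearMap.sub_comp, LinearMap.smul_comp, LinearMap.id_comp, map_sub,
    map_smul, trace_perpProj hX, smul_eq_mul] at h
  linarith

/-- The equality case of the previous bound: `T = δ` on the hyperplane. -/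
theorem eq_smul_of_trace_comp_perpProj (hX : ‖X‖ = 1) (hTs : T.IsSymmetric)
    (hTδ : ∀ v, ⟪T v, v⟫_ℝ ≤ δ * ‖v‖ ^ 2)
    (h : (Module.finrank ℝ V - 1) * δ ≤ LinearMap.trace ℝ V (T ∘ₗ perpProj X))
    {u : V} (hu : ⟪u, X⟫_ℝ = 0) : T u = δ • u := by
  set S : V →ₗ[ℝ] V := δ • LinearMap.id - T with hS
  have hSs : S.IsSymmetric := fun u v ↦ by
    simp only [hS, LinearMap.sub_apply, LinearMap.smul_apply, LinearMap.id_apply, inner_sub_left,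
      inner_sub_right, real_inner_smul_left, real_inner_smul_right, hTs u v]
  have hSp : ∀ v, 0 ≤ ⟪S v, v⟫_ℝ := fun v ↦ by
    simp only [hS, LinearMap.sub_apply, LinearMap.smul_apply, LinearMap.id_apply, inner_sub_left,
      real_inner_smul_left, real_inner_self_eq_norm_sq]
    linarith [hTδ v]
  have h0 : LinearMap.trace ℝ V (S ∘ₗ perpProj X ∘ₗ perpProj X) ≤ 0 := by
    rw [perpProj_comp_self hX, hS, LinearMap.sub_comp, LinearMap.smul_comp, LinearMap.id_comp,
      map_sub, map_smul, trace_perpProj hX, smul_eq_mul]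
    linarith
  rw [trace_conj_eq_sum isSymmetric_perpProj] at h0
  have h1 := (Finset.sum_eq_zero_iff_of_nonneg fun i _ ↦ hSp _).1
    (le_antisymm h0 (Finset.sum_nonneg fun i _ ↦ hSp _))
  have h2 : S ∘ₗ perpProj X = 0 := ext_stdOrthonormalBasis fun i ↦ by
    simpa using apply_eq_zero_of_inner_eq_zero hSs hSp (h1 i (Finset.mem_univ i))
  have h3 := LinearMap.congr_fun h2 u
  rw [LinearMap.comp_apply, perpProj_of_inner_eq_zero hu] at h3
  exact (sub_eq_zero.1 h3).symm

/-- The inequality `tr (T (A - s P)²) ≥ 0`, combined with the upper bound for `tr (T P)`. The free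
parameter `s` replaces the Cauchy-Schwarz inequality and keeps the estimate linear in `tr (T A)`. -/
theorem two_mul_trace_sub_le (hX : ‖X‖ = 1) (hAs : A.IsSymmetric) (hA : A X = 0)
    (hT : ∀ v, 0 ≤ ⟪T v, v⟫_ℝ) (hTδ : ∀ v, ⟪T v, v⟫_ℝ ≤ δ * ‖v‖ ^ 2) (s : ℝ) :
    2 * s * LinearMap.trace ℝ V (T ∘ₗ A) - s ^ 2 * ((Module.finrank ℝ V - 1) * δ)
      ≤ LinearMap.trace ℝ V (T ∘ₗ A ∘ₗ A) := by
  have h1 := trace_sq_sub (T := T) hX hAs hA s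
  have h2 := trace_comp_sq_nonneg hT (isSymmetric_sub_smul (X := X) hAs s)
  have h3 := mul_le_mul_of_nonneg_left (trace_comp_perpProj_le hX hTδ) (sq_nonneg s)
  linarith

/-- The equality case: the hypersurface is umbilical, and `T = δ` on its tangent space unless the
principal curvature vanishes. -/
theorem umbilical_of_trace_eq (hX : ‖X‖ = 1) (hAs : A.IsSymmetric) (hA : A X = 0)
    (hTs : T.IsSymmetric) (hT : ∀ v, v ≠ 0 → 0 < ⟪T v, v⟫_ℝ)
    (hTδ : ∀ v, ⟪T v, v⟫_ℝ ≤ δ * ‖v‖ ^ 2) {s : ℝ}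
    (h : LinearMap.trace ℝ V (T ∘ₗ A ∘ₗ A)
      ≤ 2 * s * LinearMap.trace ℝ V (T ∘ₗ A) - s ^ 2 * ((Module.finrank ℝ V - 1) * δ)) :
    A = s • perpProj X ∧ (s ≠ 0 → ∀ u, ⟪u, X⟫_ℝ = 0 → T u = δ • u) := by
  have hT0 : ∀ v, 0 ≤ ⟪T v, v⟫_ℝ := fun v ↦ by
    rcases eq_or_ne v 0 with rfl | hv
    · simp
    · exact (hT v hv).le
  have h1 := trace_sq_sub (T := T) hX hAs hA s
  have h2 := trace_comp_sq_nonneg hT0 (isSymmetric_sub_smul (X := X) hAs s)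
  have h3 := mul_le_mul_of_nonneg_left (trace_comp_perpProj_le hX hTδ) (sq_nonneg s)
  constructor
  · have h4 : LinearMap.trace ℝ V (T ∘ₗ (A - s • perpProj X) ∘ₗ (A - s • perpProj X)) = 0 :=
      le_antisymm (by linarith) h2
    rw [trace_conj_eq_sum (isSymmetric_sub_smul hAs s)] at h4
    have h5 := (Finset.sum_eq_zero_iff_of_nonneg fun i _ ↦ hT0 _).1 h4
    refine ext_stdOrthonormalBasis fun i ↦ ?_
    by_contra hne
    exact (hT _ (sub_ne_zero.2 hne)).ne' (h5 i (Finset.mem_univ i))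
  · intro hs u hu
    refine eq_smul_of_trace_comp_perpProj hX hTs hTδ ?_ hu
    have hs2 : 0 < s ^ 2 := by positivity
    refine le_of_mul_le_mul_left ?_ hs2
    linarith

/-- The trace of an endomorphism that vanishes on `X` is a sum over a basis of `X^⊥`. -/
theorem sum_perp_eq_trace {S : V →ₗ[ℝ] V} (hX : ‖X‖ = 1) (hS : S X = 0) :
    ∑ i, ⟪S (stdOrthonormalBasis ℝ ↥(ℝ ∙ X)ᗮ i : V), (stdOrthonormalBasis ℝ ↥(ℝ ∙ X)ᗮ i : V)⟫_ℝ
      = LinearMap.trace ℝ V S := by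
  set K : Submodule ℝ V := (ℝ ∙ X)ᗮ
  have hmem : ∀ v, perpProj X v ∈ K := fun v ↦
    Submodule.mem_orthogonal_singleton_iff_inner_left.2 (inner_perpProj_self hX v)
  let q : V →ₗ[ℝ] K := (perpProj X).codRestrict K hmem
  have h1 : S = (S ∘ₗ K.subtype) ∘ₗ q := by
    conv_lhs => rw [← comp_perpProj hS]
    rfl
  conv_rhs => rw [h1, LinearMap.trace_comp_comm']
  rw [LinearMap.trace_eq_sum_inner _ (stdOrthonormalBasis ℝ K)]
  refine Finset.sum_congr rfl fun i _ ↦ ?_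
  rw [Submodule.coe_inner]
  change _ = ⟪(stdOrthonormalBasis ℝ K i : V), perpProj X (S (stdOrthonormalBasis ℝ K i : V))⟫_ℝ
  rw [← inner_perpProj, perpProj_of_inner_eq_zero, real_inner_comm]
  exact Submodule.mem_orthogonal_singleton_iff_inner_left.1 (stdOrthonormalBasis ℝ K i).2

end LinearAlgebra

/-! ### The model functions -/

section Comparison

/-- The derivative of `sn c`. -/
def cs (c r : ℝ) : ℝ :=
  if 0 < c then Real.cos (√c * r)
  else if c = 0 then 1
  else Real.cosh (√(-c) * r)

theorem hasDerivAt_sn (c r : ℝ) : HasDerivAt (sn c) (cs c r) r := by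
  unfold cs
  split_ifs with h1 h2
  · have e : sn c = fun r ↦ Real.sin (√c * r) / √c := by ext; simp [sn, h1]
    rw [e]
    have := (((hasDerivAt_id r).const_mul √c).sin).div_const √c
    refine this.congr_deriv ?_
    have := Real.sqrt_pos.2 h1
    simp only [id]
    field_simp
  · have e : sn c = fun r ↦ r := by ext; simp [sn, h2]
    rw [e]; exact hasDerivAt_id r
  · have e : sn c = fun r ↦ Real.sinh (√(-c) * r) / √(-c) := by ext; simp [sn, h1, h2]
    rw [e]
    have := (((hasDerivAt_id r).const_mul √(-c)).sinh).div_const √(-c)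
    refine this.congr_deriv ?_
    have : 0 < √(-c) := Real.sqrt_pos.2 (by push Not at h1; have := lt_of_le_of_ne h1 h2; linarith)
    simp only [id]
    field_simp

theorem hasDerivAt_cs (c r : ℝ) : HasDerivAt (cs c) (-c * sn c r) r := by
  unfold sn
  split_ifs with h1 h2
  · have e : cs c = fun r ↦ Real.cos (√c * r) := by ext; simp [cs, h1]
    rw [e]
    refine ((hasDerivAt_id r).const_mul √c).cos.congr_deriv ?_
    have h3 := Real.sqrt_pos.2 h1
    have h4 := Real.sq_sqrt h1.le
    simp only [id]
    field_simp
    rw [h4, mul_comm]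
  · have e : cs c = fun r ↦ 1 := by ext; simp [cs, h2]
    rw [e, h2]; simpa using hasDerivAt_const r (1 : ℝ)
  · have e : cs c = fun r ↦ Real.cosh (√(-c) * r) := by ext; simp [cs, h1, h2]
    rw [e]
    refine ((hasDerivAt_id r).const_mul √(-c)).cosh.congr_deriv ?_
    have h0 : 0 < -c := by push Not at h1; have := lt_of_le_of_ne h1 h2; linarith
    have h3 := Real.sqrt_pos.2 h0
    have h4 := Real.sq_sqrt h0.le
    simp only [id]
    field_simp
    rw [h4]; ring

theorem deriv_sn (c r : ℝ) : deriv (sn c) r = cs c r := (hasDerivAt_sn c r).deriv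

theorem sn_zero (c : ℝ) : sn c 0 = 0 := by unfold sn; split_ifs <;> simp

theorem cs_zero (c : ℝ) : cs c 0 = 1 := by unfold cs; split_ifs <;> simp

theorem sn_pos {c r : ℝ} (hr : 0 < r) (hc : 0 < c → √c * r < Real.pi) : 0 < sn c r := by
  unfold sn
  split_ifs with h1 h2
  · have := Real.sqrt_pos.2 h1
    exact div_pos (Real.sin_pos_of_pos_of_lt_pi (by positivity) (hc h1)) this
  · exact hr
  · have : 0 < √(-c) := Real.sqrt_pos.2 (by push Not at h1; have := lt_of_le_of_ne h1 h2; linarith)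
    exact div_pos (Real.sinh_pos_iff.2 (by positivity)) this

theorem cs_pos {c r : ℝ} (hr : 0 ≤ r) (hc : 0 < c → √c * r < Real.pi / 2) : 0 < cs c r := by
  unfold cs
  split_ifs with h1 h2
  · refine Real.cos_pos_of_mem_Ioo ⟨?_, hc h1⟩
    have : 0 ≤ √c * r := by positivity
    linarith [Real.pi_pos]
  · exact one_pos
  · exact Real.cosh_pos _

theorem cs_nonneg {c r : ℝ} (hr : 0 ≤ r) (hc : 0 < c → √c * r ≤ Real.pi / 2) : 0 ≤ cs c r := by
  unfold cs
  split_ifs with h1 h2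
  · refine Real.cos_nonneg_of_mem_Icc ⟨?_, hc h1⟩
    have : 0 ≤ √c * r := by positivity
    linarith [Real.pi_pos]
  · exact zero_le_one
  · exact (Real.cosh_pos _).le

/-- `cs² - c sn²` is the function `cs` at the doubled argument. -/
theorem cs_sq_sub (c r : ℝ) : cs c r ^ 2 - c * sn c r ^ 2 = cs c (2 * r) := by
  unfold cs sn
  split_ifs with h1 h2
  · have h3 := Real.sqrt_pos.2 h1
    have h4 := Real.sq_sqrt h1.le
    rw [show √c * (2 * r) = 2 * (√c * r) by ring, Real.cos_two_mul, div_pow, h4,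
      mul_div_cancel₀ _ h1.ne', Real.sin_sq]
    ring
  · rw [h2]; ring
  · have h0 : 0 < -c := by push Not at h1; have := lt_of_le_of_ne h1 h2; linarith
    have h4 := Real.sq_sqrt h0.le
    rw [show √(-c) * (2 * r) = 2 * (√(-c) * r) by ring, Real.cosh_two_mul, div_pow, h4]
    have : c ≠ 0 := h2
    field_simp
    ring

theorem continuous_sn (c : ℝ) : Continuous (sn c) :=
  continuous_iff_continuousAt.2 fun r ↦ (hasDerivAt_sn c r).continuousAt

theorem continuous_cs (c : ℝ) : Continuous (cs c) :=
  continuous_iff_continuousAt.2 fun r ↦ (hasDerivAt_cs c r).continuousAt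

theorem tendsto_sn_div (c : ℝ) : Tendsto (fun t ↦ sn c t / t) (𝓝[>] 0) (𝓝 1) := by
  have h := (hasDerivAt_iff_tendsto_slope.1 (hasDerivAt_sn c 0)).mono_left
    (nhdsWithin_mono (0 : ℝ) (s := Ioi 0) fun t ht ↦ ne_of_gt ht)
  rw [cs_zero] at h
  refine h.congr fun t ↦ ?_
  rw [slope_def_field, sn_zero, sub_zero, sub_zero]

/-- The Riccati equation in the model space. -/
theorem hasDerivAt_cs_div_sn {c r : ℝ} (h : sn c r ≠ 0) :
    HasDerivAt (fun t ↦ cs c t / sn c t) (-c - (cs c r / sn c r) ^ 2) r := by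
  refine ((hasDerivAt_cs c r).div (hasDerivAt_sn c r) h).congr_deriv ?_
  field_simp

theorem modelMeanCurvature_eq (c m r : ℝ) :
    modelMeanCurvature c m r = (m - 1) * (cs c r / sn c r) := by
  rw [modelMeanCurvature, deriv_sn]

/-! ### Riccati inequalities on the line -/

/-- A scalar Riccati inequality on `(0, ℓ]`. Here `H` is the weighted mean curvature along the
geodesic, `e` the weight and `m` the radial eigenvalue of the tensor; the inequality for the
parameter `s` compares the shape operator with `s` times the identity. -/
structure RiccatiInequality (N δ c m ℓ : ℝ) (H H' e e' : ℝ → ℝ) : Prop where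
  deriv_H : ∀ t ∈ Ioc 0 ℓ, HasDerivWithinAt H (H' t) (Icc 0 ℓ) t
  deriv_e : ∀ t ∈ Ioc 0 ℓ, HasDerivWithinAt e (e' t) (Icc 0 ℓ) t
  bdd_e : ∃ C, ∀ t ∈ Ioc 0 ℓ, |e t| ≤ C
  bdd_e' : ∃ C, ∀ t ∈ Ioc 0 ℓ, |e' t| ≤ C
  le : ∀ t ∈ Ioc 0 ℓ, ∀ s : ℝ,
    H' t ≤ -(2 * s * (H t + m * e' t) - s ^ 2 * (N * δ)) - N * c * δ
  N_nonneg : 0 ≤ N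
  δ_nonneg : 0 ≤ δ
  m_nonneg : 0 ≤ m
  m_le : m ≤ δ

namespace RiccatiInequality

variable {N δ c m ℓ : ℝ} {H H' e e' : ℝ → ℝ}

/-- No initial condition is needed to bound `H` above: comparing with `1 / (t - a)` for `a ↓ 0`
gives `H ≤ K / t`. -/
theorem exists_le_div (h : RiccatiInequality N δ c m ℓ H H' e e') :
    ∃ K, ∀ t ∈ Ioc 0 ℓ, H t ≤ K / t := by
  obtain ⟨C, hC⟩ := h.bdd_e'
  set K := 2 * ℓ * (m * |C|) + N * δ + ℓ ^ 2 * (N * |c| * δ) with hK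
  refine ⟨K, fun t ht ↦ ?_⟩
  have hℓ : 0 < ℓ := ht.1.trans_le ht.2
  have hm := h.m_nonneg
  have hN := h.N_nonneg
  have hδ := h.δ_nonneg
  have key : ∀ a, 0 < a → a < t → (t - a) * H t ≤ K := by
    intro a ha hat
    have hsub : Icc a t ⊆ Ioc 0 ℓ := fun s hs ↦ ⟨ha.trans_le hs.1, hs.2.trans ht.2⟩
    have hsub' : Icc a t ⊆ Icc 0 ℓ := hsub.trans Ioc_subset_Icc_self
    have hd : ∀ s ∈ Icc a t, HasDerivWithinAt (fun s ↦ (s - a) ^ 2 * H s - K * s)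
        (2 * (s - a) * H s + (s - a) ^ 2 * H' s - K) (Icc 0 ℓ) s := by
      intro s hs
      have h1 : HasDerivWithinAt (fun s : ℝ ↦ (s - a) ^ 2) (2 * (s - a)) (Icc 0 ℓ) s := by
        have := (((hasDerivAt_id s).sub_const a).pow 2).hasDerivWithinAt (s := Icc 0 ℓ)
        exact this.congr_deriv (by simp)
      have h2 : HasDerivWithinAt (fun s : ℝ ↦ K * s) K (Icc 0 ℓ) s := by
        simpa using ((hasDerivAt_id s).const_mul K).hasDerivWithinAt
      exact (h1.mul (h.deriv_H s (hsub hs))).sub h2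
    have hanti : AntitoneOn (fun s ↦ (s - a) ^ 2 * H s - K * s) (Icc a t) := by
      refine antitoneOn_of_hasDerivWithinAt_nonpos (convex_Icc a t)
        (f' := fun s ↦ 2 * (s - a) * H s + (s - a) ^ 2 * H' s - K)
        (fun s hs ↦ (hd s hs).continuousWithinAt.mono hsub')
        (fun s hs ↦ (hd s (interior_subset hs)).mono (interior_subset.trans hsub')) ?_
      intro s hs
      rw [interior_Icc] at hs
      have hsm := hsub (Ioo_subset_Icc_self hs)
      have hpos : 0 < s - a := sub_pos.2 hs.1
      have h1 := mul_le_mul_of_nonneg_left (h.le s hsm (1 / (s - a))) (sq_nonneg (s - a))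
      have h2 : (s - a) ^ 2 * (-(2 * (1 / (s - a)) * (H s + m * e' s)
          - (1 / (s - a)) ^ 2 * (N * δ)) - N * c * δ)
          = -2 * (s - a) * H s - 2 * (s - a) * (m * e' s) + N * δ
            - (s - a) ^ 2 * (N * c * δ) := by
        field_simp
        ring
      have h3 : -(e' s) ≤ |C| := (neg_le_abs _).trans ((hC s hsm).trans (le_abs_self C))
      have h4 : s - a ≤ ℓ := by linarith [hs.2, ht.2]
      have h5 : (s - a) * (m * -(e' s)) ≤ ℓ * (m * |C|) := by
        calc (s - a) * (m * -(e' s)) ≤ (s - a) * (m * |C|) := by gcongr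
          _ ≤ ℓ * (m * |C|) := by gcongr
      have h6 : (s - a) ^ 2 * (N * -c * δ) ≤ ℓ ^ 2 * (N * |c| * δ) := by
        calc (s - a) ^ 2 * (N * -c * δ) ≤ (s - a) ^ 2 * (N * |c| * δ) := by
              gcongr; exact neg_le_abs c
          _ ≤ ℓ ^ 2 * (N * |c| * δ) := by gcongr
      rw [h2] at h1
      simp only [hK]
      linarith
    have h7 := hanti (left_mem_Icc.2 hat.le) (right_mem_Icc.2 hat.le) hat.le
    simp only [sub_self] at h7
    have h8 : 0 < t - a := sub_pos.2 hat
    have h9 : (t - a) * ((t - a) * H t) ≤ (t - a) * K := by nlinarith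
    exact le_of_mul_le_mul_left h9 h8
  rw [le_div_iff₀ ht.1, mul_comm]
  have hlim : Tendsto (fun a ↦ (t - a) * H t) (𝓝[>] 0) (𝓝 (t * H t)) := by
    have : Continuous (fun a ↦ (t - a) * H t) := by fun_prop
    have h1 := this.tendsto 0
    rw [sub_zero] at h1
    exact h1.mono_left nhdsWithin_le_nhds
  refine le_of_tendsto hlim ?_
  filter_upwards [Ioo_mem_nhdsGT ht.1] with a ha using key a ha.1 ha.2

/-- The inequality for `s = sn' / sn`, multiplied by `sn²`. -/
theorem sn_sq_le (h : RiccatiInequality N δ c m ℓ H H' e e') {t : ℝ} (ht : t ∈ Ioc 0 ℓ)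
    (hsn : 0 < sn c t) :
    sn c t ^ 2 * H' t + 2 * sn c t * cs c t * H t - N * δ * (cs c t ^ 2 - c * sn c t ^ 2)
      ≤ -(2 * sn c t * cs c t) * (m * e' t) := by
  have h1 := mul_le_mul_of_nonneg_left (h.le t ht (cs c t / sn c t)) (sq_nonneg (sn c t))
  have h2 : sn c t ^ 2 * (-(2 * (cs c t / sn c t) * (H t + m * e' t)
      - (cs c t / sn c t) ^ 2 * (N * δ)) - N * c * δ)
      = -(2 * sn c t * cs c t) * (H t + m * e' t) + cs c t ^ 2 * (N * δ)
        - sn c t ^ 2 * (N * c * δ) := by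
    field_simp
    ring
  rw [h2] at h1
  linarith

/-- The derivative of `sn² H - N δ sn sn' + w`. -/
theorem hasDerivWithinAt_sn (h : RiccatiInequality N δ c m ℓ H H' e e') {t : ℝ}
    (ht : t ∈ Ioc 0 ℓ) {w : ℝ → ℝ} {w' : ℝ} (hw : HasDerivWithinAt w w' (Icc 0 ℓ) t) :
    HasDerivWithinAt (fun t ↦ sn c t ^ 2 * H t - N * δ * (sn c t * cs c t) + w t)
      (sn c t ^ 2 * H' t + 2 * sn c t * cs c t * H t - N * δ * (cs c t ^ 2 - c * sn c t ^ 2) + w')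
      (Icc 0 ℓ) t := by
  have h1 := (hasDerivAt_sn c t).hasDerivWithinAt (s := Icc 0 ℓ)
  have h2 := (hasDerivAt_cs c t).hasDerivWithinAt (s := Icc 0 ℓ)
  refine ((((h1.pow 2).mul (h.deriv_H t ht)).sub ((h1.mul h2).const_mul (N * δ))).add
    hw).congr_deriv ?_
  simp only [Pi.pow_apply, Nat.cast_ofNat, Nat.add_one_sub_one, pow_one]
  ring

/-- A function on `(0, r]` that decreases and is bounded above by a null function near `0` is
nonpositive. -/
theorem nonpos_of_antitoneOn {F g : ℝ → ℝ} {r : ℝ} (hF : AntitoneOn F (Ioc 0 r))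
    (hg : Tendsto g (𝓝[>] 0) (𝓝 0)) (hFg : ∀ t ∈ Ioc 0 r, F t ≤ g t) {t : ℝ}
    (ht : t ∈ Ioc 0 r) : F t ≤ 0 := by
  refine ge_of_tendsto hg ?_
  filter_upwards [Ioo_mem_nhdsGT ht.1] with s hs
  have hs' : s ∈ Ioc 0 r := ⟨hs.1, hs.2.le.trans ht.2⟩
  exact (hF hs' ht hs.2.le).trans (hFg s hs')

/-- The majorant of the comparison functions near the centre. -/
theorem tendsto_bound (c K C₁ C₂ : ℝ) :
    Tendsto (fun t ↦ sn c t ^ 2 * (K / t) + C₁ * |sn c t * cs c t| + C₂ * sn c t ^ 2)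
      (𝓝[>] 0) (𝓝 0) := by
  have hs : Tendsto (sn c) (𝓝[>] 0) (𝓝 0) := by
    have := (continuous_sn c).tendsto 0
    rw [sn_zero] at this
    exact this.mono_left nhdsWithin_le_nhds
  have hc : Tendsto (cs c) (𝓝[>] 0) (𝓝 1) := by
    have := (continuous_cs c).tendsto 0
    rw [cs_zero] at this
    exact this.mono_left nhdsWithin_le_nhds
  have h1 : Tendsto (fun t ↦ sn c t * K * (sn c t / t)) (𝓝[>] 0) (𝓝 (0 * K * 1)) :=
    (hs.mul_const K).mul (tendsto_sn_div c)
  have h2 : Tendsto (fun t ↦ C₁ * |sn c t * cs c t|) (𝓝[>] 0) (𝓝 (C₁ * |0 * 1|)) :=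
    (hs.mul hc).abs.const_mul C₁
  have h3 : Tendsto (fun t ↦ C₂ * sn c t ^ 2) (𝓝[>] 0) (𝓝 (C₂ * 0 ^ 2)) :=
    (hs.pow 2).const_mul C₂
  have := (h1.add h2).add h3
  simp only [zero_mul, abs_zero, mul_zero, add_zero, ne_eq, OfNat.ofNat_ne_zero,
    not_false_eq_true, zero_pow] at this
  refine this.congr fun t ↦ ?_
  ring

theorem antitoneOn_of_deriv {F F' : ℝ → ℝ} {D : Set ℝ} (hD : Convex ℝ D) (hDℓ : D ⊆ Ioc 0 ℓ)
    (hF : ∀ t ∈ D, HasDerivWithinAt F (F' t) (Icc 0 ℓ) t) (hF' : ∀ t ∈ D, F' t ≤ 0) :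
    AntitoneOn F D :=
  antitoneOn_of_hasDerivWithinAt_nonpos hD
    (fun s hs ↦ (hF s hs).continuousWithinAt.mono (hDℓ.trans Ioc_subset_Icc_self))
    (fun s hs ↦ (hF s (interior_subset hs)).mono
      (interior_subset.trans (hDℓ.trans Ioc_subset_Icc_self)))
    fun s hs ↦ hF' s (interior_subset hs)

section LowerBoundOnDerivative

variable {a r : ℝ}

/-- The comparison function for a lower bound `-a` on the derivative of the weight. -/
def comparisonFun (N δ c a : ℝ) (H : ℝ → ℝ) (t : ℝ) : ℝ :=
  sn c t ^ 2 * H t - N * δ * (sn c t * cs c t) + -(δ * a) * sn c t ^ 2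

theorem comparisonFun_antitoneOn (h : RiccatiInequality N δ c m ℓ H H' e e') (hr : r ∈ Ioc 0 ℓ)
    (ha : 0 ≤ a) (he : ∀ t ∈ Ioc 0 ℓ, -a ≤ e' t) (hsn : ∀ t ∈ Ioc 0 r, 0 < sn c t)
    (hcs : ∀ t ∈ Ioc 0 r, 0 ≤ cs c t) : AntitoneOn (comparisonFun N δ c a H) (Ioc 0 r) := by
  have hsub : Ioc 0 r ⊆ Ioc 0 ℓ := Ioc_subset_Ioc_right hr.2
  have hw : ∀ t, HasDerivWithinAt (fun t ↦ -(δ * a) * sn c t ^ 2)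
      (-(δ * a) * (2 * sn c t * cs c t)) (Icc 0 ℓ) t := fun t ↦
    ((((hasDerivAt_sn c t).pow 2).const_mul (-(δ * a))).hasDerivWithinAt).congr_deriv (by simp)
  refine antitoneOn_of_deriv (convex_Ioc 0 r) hsub
    (fun t ht ↦ h.hasDerivWithinAt_sn (hsub ht) (hw t)) fun t ht ↦ ?_
  have h1 := h.sn_sq_le (hsub ht) (hsn t ht)
  have h2 : 0 ≤ m * e' t + δ * a := by
    have := mul_le_mul_of_nonneg_left (he t (hsub ht)) h.m_nonneg
    have := mul_le_mul_of_nonneg_right h.m_le ha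
    linarith
  have h3 : 0 ≤ 2 * sn c t * cs c t := by
    have := hsn t ht
    have := hcs t ht
    positivity
  have h4 := mul_nonneg h3 h2
  linarith

theorem comparisonFun_nonpos (h : RiccatiInequality N δ c m ℓ H H' e e') (hr : r ∈ Ioc 0 ℓ)
    (ha : 0 ≤ a) (he : ∀ t ∈ Ioc 0 ℓ, -a ≤ e' t) (hsn : ∀ t ∈ Ioc 0 r, 0 < sn c t)
    (hcs : ∀ t ∈ Ioc 0 r, 0 ≤ cs c t) : ∀ t ∈ Ioc 0 r, comparisonFun N δ c a H t ≤ 0 := by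
  obtain ⟨K, hK⟩ := h.exists_le_div
  intro t ht
  refine nonpos_of_antitoneOn (h.comparisonFun_antitoneOn hr ha he hsn hcs)
    (tendsto_bound c K (N * δ) 0) (fun s hs ↦ ?_) ht
  have h1 := mul_le_mul_of_nonneg_left (hK s (Ioc_subset_Ioc_right hr.2 hs)) (sq_nonneg (sn c s))
  have h2 := mul_le_mul_of_nonneg_left (neg_le_abs (sn c s * cs c s))
    (mul_nonneg h.N_nonneg h.δ_nonneg)
  have h3 : 0 ≤ δ * a * sn c s ^ 2 := mul_nonneg (mul_nonneg h.δ_nonneg ha) (sq_nonneg _)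
  rw [comparisonFun]
  linarith

theorem comparisonFun_eq {t : ℝ} (ht : 0 < sn c t) : comparisonFun N δ c a H t
    = sn c t ^ 2 * (H t - (N * δ * (cs c t / sn c t) + δ * a)) := by
  rw [comparisonFun]
  field_simp
  ring

theorem le_of_deriv_weight (h : RiccatiInequality N δ c m ℓ H H' e e') (hr : r ∈ Ioc 0 ℓ)
    (ha : 0 ≤ a) (he : ∀ t ∈ Ioc 0 ℓ, -a ≤ e' t) (hsn : ∀ t ∈ Ioc 0 r, 0 < sn c t)
    (hcs : ∀ t ∈ Ioc 0 r, 0 ≤ cs c t) : H r ≤ N * δ * (cs c r / sn c r) + δ * a := by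
  have hr' := right_mem_Ioc.2 hr.1
  have h1 := h.comparisonFun_nonpos hr ha he hsn hcs r hr'
  have h2 := hsn r hr'
  rw [comparisonFun_eq h2] at h1
  have h3 : 0 < sn c r ^ 2 := by positivity
  by_contra! hlt
  have := mul_pos h3 (sub_pos.2 hlt)
  linarith

/-- Equality in the comparison at `r` propagates to `(0, r]`. -/
theorem eq_of_eq (h : RiccatiInequality N δ c m ℓ H H' e e') (hr : r ∈ Ioc 0 ℓ)
    (ha : 0 ≤ a) (he : ∀ t ∈ Ioc 0 ℓ, -a ≤ e' t) (hsn : ∀ t ∈ Ioc 0 r, 0 < sn c t)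
    (hcs : ∀ t ∈ Ioc 0 r, 0 ≤ cs c t) (heq : H r = N * δ * (cs c r / sn c r) + δ * a) :
    ∀ t ∈ Ioc 0 r, H t = N * δ * (cs c t / sn c t) + δ * a := by
  intro t ht
  have hr' := right_mem_Ioc.2 hr.1
  have h0 : comparisonFun N δ c a H r = 0 := by
    rw [comparisonFun_eq (hsn r hr'), heq]; ring
  have h1 := h.comparisonFun_antitoneOn hr ha he hsn hcs ht hr' ht.2
  have h2 := h.comparisonFun_nonpos hr ha he hsn hcs t ht
  rw [h0] at h1
  have h3 := le_antisymm h2 h1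
  rw [comparisonFun_eq (hsn t ht)] at h3
  have h4 := hsn t ht
  have h5 : sn c t ^ 2 ≠ 0 := by positivity
  linarith [(mul_eq_zero.1 h3).resolve_left h5]

/-- In the case of equality the derivative is the one in the model space, also at the endpoint `r`. -/
theorem deriv_eq_of_eq (h : RiccatiInequality N δ c m ℓ H H' e e') (hr : r ∈ Ioc 0 ℓ)
    (ha : 0 ≤ a) (he : ∀ t ∈ Ioc 0 ℓ, -a ≤ e' t) (hsn : ∀ t ∈ Ioc 0 r, 0 < sn c t)
    (hcs : ∀ t ∈ Ioc 0 r, 0 ≤ cs c t) (heq : H r = N * δ * (cs c r / sn c r) + δ * a) :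
    ∀ t ∈ Ioc 0 r, H' t = -(N * δ) * (c + (cs c t / sn c t) ^ 2) := by
  intro t ht
  have h1 := h.eq_of_eq hr ha he hsn hcs heq
  have hsub : Ioc 0 r ⊆ Icc 0 ℓ := (Ioc_subset_Ioc_right hr.2).trans Ioc_subset_Icc_self
  have h2 := (h.deriv_H t (Ioc_subset_Ioc_right hr.2 ht)).mono hsub
  have h3 : HasDerivWithinAt H (N * δ * (-c - (cs c t / sn c t) ^ 2)) (Ioc 0 r) t :=
    ((((hasDerivAt_cs_div_sn (hsn t ht).ne').const_mul (N * δ)).add_const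
      (δ * a)).hasDerivWithinAt).congr h1 (h1 t ht)
  have hu : UniqueDiffWithinAt ℝ (Ioc 0 r) t := uniqueDiffOn_Ioc 0 r t ht
  rw [hu.eq_deriv _ h2 h3]
  ring

end LowerBoundOnDerivative

section BoundedWeight

variable {k r : ℝ}

theorem hasDerivWithinAt_weight (h : RiccatiInequality N δ c m ℓ H H' e e') (k : ℝ) {t : ℝ}
    (ht : t ∈ Ioc 0 ℓ) : HasDerivWithinAt (fun t ↦ 2 * m * (sn c t * cs c t * (e t - k)))
      (2 * m * (cs c t ^ 2 - c * sn c t ^ 2) * (e t - k) + 2 * m * (sn c t * cs c t) * e' t)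
      (Icc 0 ℓ) t := by
  have h1 := (hasDerivAt_sn c t).hasDerivWithinAt (s := Icc 0 ℓ)
  have h2 := (hasDerivAt_cs c t).hasDerivWithinAt (s := Icc 0 ℓ)
  refine (((h1.mul h2).mul ((h.deriv_e t ht).sub_const k)).const_mul (2 * m)).congr_deriv ?_
  simp only [Pi.mul_apply]
  ring

/-- The comparison function for a bounded weight. -/
def weightFun (N δ c m k : ℝ) (H e : ℝ → ℝ) (t : ℝ) : ℝ :=
  sn c t ^ 2 * H t - N * δ * (sn c t * cs c t) + 2 * m * (sn c t * cs c t * (e t - k))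

theorem weightFun_antitoneOn (h : RiccatiInequality N δ c m ℓ H H' e e') {D : Set ℝ}
    (hD : Convex ℝ D) (hDℓ : D ⊆ Ioc 0 ℓ) (hsn : ∀ t ∈ D, 0 < sn c t)
    (hk : ∀ t ∈ D, (cs c t ^ 2 - c * sn c t ^ 2) * (e t - k) ≤ 0) :
    AntitoneOn (weightFun N δ c m k H e) D := by
  refine antitoneOn_of_deriv hD hDℓ
    (fun t ht ↦ h.hasDerivWithinAt_sn (hDℓ ht) (h.hasDerivWithinAt_weight k (hDℓ ht)))
    fun t ht ↦ ?_
  have h1 := h.sn_sq_le (hDℓ ht) (hsn t ht)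
  have h2 := mul_le_mul_of_nonneg_left (hk t ht) h.m_nonneg
  linarith

/-- In the range where `sn'² - c sn² ≥ 0` the weight is compared with its upper bound. -/
theorem weightFun_nonpos (h : RiccatiInequality N δ c m ℓ H H' e e') (hr : r ∈ Ioc 0 ℓ)
    (hk : ∀ t ∈ Ioc 0 ℓ, |e t| ≤ k) (hsn : ∀ t ∈ Ioc 0 r, 0 < sn c t)
    (hcs2 : ∀ t ∈ Ioc 0 r, 0 ≤ cs c t ^ 2 - c * sn c t ^ 2) :
    weightFun N δ c m k H e r ≤ 0 := by
  have hsub : Ioc 0 r ⊆ Ioc 0 ℓ := Ioc_subset_Ioc_right hr.2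
  obtain ⟨K, hK⟩ := h.exists_le_div
  refine nonpos_of_antitoneOn (r := r) (h.weightFun_antitoneOn (convex_Ioc 0 r) hsub hsn
    fun t ht ↦ ?_) (tendsto_bound c K (N * δ + 2 * m * (2 * k)) 0) (fun s hs ↦ ?_)
    (right_mem_Ioc.2 hr.1)
  · exact mul_nonpos_of_nonneg_of_nonpos (hcs2 t ht)
      (sub_nonpos.2 ((le_abs_self _).trans (hk t (hsub ht))))
  have h1 := mul_le_mul_of_nonneg_left (hK s (hsub hs)) (sq_nonneg (sn c s))
  have h2 := mul_le_mul_of_nonneg_left (neg_le_abs (sn c s * cs c s))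
    (mul_nonneg h.N_nonneg h.δ_nonneg)
  have h3 : sn c s * cs c s * (e s - k) ≤ |sn c s * cs c s| * (2 * k) := by
    refine (le_abs_self _).trans ?_
    rw [abs_mul]
    refine mul_le_mul_of_nonneg_left ?_ (abs_nonneg _)
    have := abs_le.1 (hk s (hsub hs))
    rw [abs_le]
    constructor <;> linarith
  have h4 := mul_le_mul_of_nonneg_left h3 (mul_nonneg zero_le_two h.m_nonneg)
  rw [weightFun]
  linarith

theorem le_of_abs_weight_le (h : RiccatiInequality N δ c m ℓ H H' e e') (hr : r ∈ Ioc 0 ℓ)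
    (hk : ∀ t ∈ Ioc 0 ℓ, |e t| ≤ k) (hsn : ∀ t ∈ Ioc 0 r, 0 < sn c t) (hcs : 0 ≤ cs c r)
    (hcs2 : ∀ t ∈ Ioc 0 r, 0 ≤ cs c t ^ 2 - c * sn c t ^ 2) :
    H r ≤ δ * ((N + 4 * k) * (cs c r / sn c r)) := by
  have h1 := h.weightFun_nonpos hr hk hsn hcs2
  have h2 := hsn r (right_mem_Ioc.2 hr.1)
  have h3 : weightFun N δ c m k H e r
      = sn c r ^ 2 * (H r - (cs c r / sn c r) * (N * δ + 2 * m * (k - e r))) := by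
    rw [weightFun]; field_simp; ring
  have h4 : 0 < sn c r ^ 2 := by positivity
  have h5 : H r ≤ (cs c r / sn c r) * (N * δ + 2 * m * (k - e r)) := by
    by_contra! hlt
    have := mul_pos h4 (sub_pos.2 hlt)
    linarith
  have hke := abs_le.1 (hk r hr)
  have h6 : m * (k - e r) ≤ δ * (2 * k) :=
    mul_le_mul h.m_le (by linarith) (by linarith) h.δ_nonneg
  have h7 := mul_le_mul_of_nonneg_left (show N * δ + 2 * m * (k - e r) ≤ δ * (N + 4 * k) by linarith)
    (div_nonneg hcs h2.le)
  linarith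

/-- Beyond the zero `r₀` of `sn'² - c sn²` the weight is compared with its lower bound. -/
theorem le_of_abs_weight_le' (h : RiccatiInequality N δ c m ℓ H H' e e') {r₀ : ℝ} (hr₀ : 0 < r₀)
    (hr₀r : r₀ ≤ r) (hrℓ : r ≤ ℓ)
    (hk : ∀ t ∈ Ioc 0 ℓ, |e t| ≤ k) (hsn : ∀ t ∈ Ioc 0 r, 0 < sn c t) (hcs : 0 ≤ cs c r)
    (hcs0 : 0 ≤ cs c r₀)
    (hcs2 : ∀ t ∈ Ioc 0 r₀, 0 ≤ cs c t ^ 2 - c * sn c t ^ 2)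
    (hcs2' : ∀ t ∈ Icc r₀ r, cs c t ^ 2 - c * sn c t ^ 2 ≤ 0) :
    sn c r ^ 2 * H r ≤ N * δ * (sn c r * cs c r) + 4 * δ * k * (sn c r₀ * cs c r₀) := by
  have hr : r ∈ Ioc 0 ℓ := ⟨hr₀.trans_le hr₀r, hrℓ⟩
  have h1 := h.weightFun_nonpos (r := r₀) ⟨hr₀, hr₀r.trans hrℓ⟩ hk
    (fun t ht ↦ hsn t ⟨ht.1, ht.2.trans hr₀r⟩) hcs2
  have h2 := (h.weightFun_antitoneOn (k := -k) (convex_Icc r₀ r)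
    (fun t ht ↦ ⟨hr₀.trans_le ht.1, ht.2.trans hrℓ⟩) (fun t ht ↦ hsn t ⟨hr₀.trans_le ht.1, ht.2⟩)
    fun t ht ↦ by
      have := abs_le.1 (hk t ⟨hr₀.trans_le ht.1, ht.2.trans hrℓ⟩)
      exact mul_nonpos_of_nonpos_of_nonneg (hcs2' t ht) (by linarith))
    (left_mem_Icc.2 hr₀r) (right_mem_Icc.2 hr₀r) hr₀r
  have hs0 := hsn r₀ ⟨hr₀, hr₀r⟩
  have hs := hsn r (right_mem_Ioc.2 hr.1)
  have hke := abs_le.1 (hk r hr)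
  have h3 : weightFun N δ c m (-k) H e r₀
      = weightFun N δ c m k H e r₀ + 4 * k * (m * (sn c r₀ * cs c r₀)) := by
    rw [weightFun, weightFun]; ring
  have h4 : m * (sn c r₀ * cs c r₀) ≤ δ * (sn c r₀ * cs c r₀) :=
    mul_le_mul_of_nonneg_right h.m_le (mul_nonneg hs0.le hcs0)
  have hk0 : 0 ≤ k := by linarith
  have h5 := mul_le_mul_of_nonneg_left h4 (show 0 ≤ 4 * k by linarith)
  have h6 : 0 ≤ 2 * m * (sn c r * cs c r * (e r - -k)) :=
    mul_nonneg (mul_nonneg zero_le_two h.m_nonneg)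
      (mul_nonneg (mul_nonneg hs.le hcs) (by linarith))
  have h7 : weightFun N δ c m (-k) H e r
      = sn c r ^ 2 * H r - N * δ * (sn c r * cs c r) + 2 * m * (sn c r * cs c r * (e r - -k)) := rfl
  linarith

end BoundedWeight

end RiccatiInequality

end Comparison

/-! ### A calibration argument in a chart -/

section Calibration

theorem hasDerivAt_clm_comp_apply {V W : Type*} [NormedAddCommGroup V] [NormedSpace ℝ V]
    [NormedAddCommGroup W] [NormedSpace ℝ W] {G : V → V →L[ℝ] W} {D : V →L[ℝ] V →L[ℝ] W}
    {c w : ℝ → V} {c₁ w₁ : V} {τ : ℝ} (hG : HasFDerivAt G D (c τ)) (hc : HasDerivAt c c₁ τ)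
    (hw : HasDerivAt w w₁ τ) :
    HasDerivAt (fun s ↦ G (c s) (w s)) (D c₁ (w τ) + G (c τ) w₁) τ :=
  HasDerivAt.clm_apply (c := fun s ↦ G (c s)) (hG.comp_hasDerivAt τ hc) hw

variable {V : Type*} [NormedAddCommGroup V] [InnerProductSpace ℝ V]

set_option synthInstance.maxHeartbeats 200000 in
/-- The geodesic equation `∂_v G(c', c') = 2 (G(c', ·))'(v)` for the integral curves of the gradient
of a solution `f` of the eikonal equation: `G_z(ξ, ξ) - (df_z ξ)²` has a minimum at `z = c τ` for
`ξ = c' τ`. -/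
theorem deriv_metric_of_eikonal {G : V → V →L[ℝ] V →L[ℝ] ℝ} {f : V → ℝ} {c c' : ℝ → V} {τ : ℝ}
    {D : V →L[ℝ] V →L[ℝ] V →L[ℝ] ℝ} {ξ' : V →L[ℝ] ℝ}
    (hG : HasFDerivAt G D (c τ)) (hf : ContDiffAt ℝ 2 f (c τ)) (hc : HasDerivAt c (c' τ) τ)
    (heik : ∀ᶠ z in 𝓝 (c τ), (fderiv ℝ f z (c' τ)) ^ 2 ≤ G z (c' τ) (c' τ))
    (hξ : ∀ᶠ s in 𝓝 τ, fderiv ℝ f (c s) = G (c s) (c' s))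
    (h1 : G (c τ) (c' τ) (c' τ) = 1)
    (hξ' : HasDerivAt (fun s ↦ G (c s) (c' s)) ξ' τ) (v : V) :
    D v (c' τ) (c' τ) = 2 * ξ' v := by
  have hf1 : HasFDerivAt (fderiv ℝ f) (fderiv ℝ (fderiv ℝ f) (c τ)) (c τ) :=
    ((hf.fderiv_right (m := 1) (by norm_num)).differentiableAt (by norm_num)).hasFDerivAt
  have hs : IsSymmSndFDerivAt ℝ f (c τ) := hf.isSymmSndFDerivAt (by simp)
  have e1 : fderiv ℝ (fderiv ℝ f) (c τ) (c' τ) = ξ' :=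
    ((hf1.comp_hasDerivAt τ hc).congr_of_eventuallyEq (hξ.mono fun s hs ↦ hs.symm)).unique hξ'
  have e2 : fderiv ℝ f (c τ) (c' τ) = 1 := by rw [hξ.self_of_nhds, h1]
  have hq := ((hG.clm_apply (hasFDerivAt_const (c' τ) (c τ))).clm_apply
    (hasFDerivAt_const (c' τ) (c τ))).sub
    ((hf1.clm_apply (hasFDerivAt_const (c' τ) (c τ))).pow 2)
  have hmin : IsLocalMin (fun z ↦ G z (c' τ) (c' τ) - (fderiv ℝ f z (c' τ)) ^ 2) (c τ) := by
    filter_upwards [heik] with z hz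
    rw [h1, e2]
    linarith
  have h := DFunLike.congr_fun (hmin.hasFDerivAt_eq_zero hq) v
  simp [e2] at h
  rw [hs.eq, e1] at h
  linarith

/-- Lower bound for the energy density of a curve `c + y` close to a geodesic `c`, with velocity
`c' + ζ`. -/
theorem energy_lower_bound {G₀ G₁ : V →L[ℝ] V →L[ℝ] ℝ} {Dy : V →L[ℝ] V →L[ℝ] ℝ} {c' y ζ : V}
    {C κ : ℝ} (hC : 0 ≤ C) (hκ : 0 < κ) (hsymm : ∀ u v, G₁ u v = G₁ v u)
    (h2 : ‖G₁ - G₀ - Dy‖ ≤ C * ‖y‖ ^ 2) (h1 : ‖G₁ - G₀‖ ≤ C * ‖y‖) (hc' : ‖c'‖ ≤ C)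
    (hell : κ * ‖ζ‖ ^ 2 ≤ G₁ ζ ζ) :
    G₀ c' c' + Dy c' c' + 2 * G₀ c' ζ + κ / 2 * ‖ζ‖ ^ 2 - (C ^ 3 + 2 * C ^ 4 / κ) * ‖y‖ ^ 2
      ≤ G₁ (c' + ζ) (c' + ζ) := by
  have e1 : |(G₁ - G₀ - Dy) c' c'| ≤ C ^ 3 * ‖y‖ ^ 2 := by
    calc |(G₁ - G₀ - Dy) c' c'| ≤ ‖G₁ - G₀ - Dy‖ * ‖c'‖ * ‖c'‖ := (G₁ - G₀ - Dy).le_opNorm₂ _ _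
      _ ≤ (C * ‖y‖ ^ 2) * C * C := by gcongr
      _ = _ := by ring
  have e2 : |(G₁ - G₀) c' ζ| ≤ C ^ 2 * ‖y‖ * ‖ζ‖ := by
    calc |(G₁ - G₀) c' ζ| ≤ ‖G₁ - G₀‖ * ‖c'‖ * ‖ζ‖ := (G₁ - G₀).le_opNorm₂ _ _
      _ ≤ (C * ‖y‖) * C * ‖ζ‖ := by gcongr
      _ = _ := by ring
  have e3 : 2 * (C ^ 2 * ‖y‖ * ‖ζ‖) ≤ κ / 2 * ‖ζ‖ ^ 2 + 2 * C ^ 4 / κ * ‖y‖ ^ 2 := by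
    have : 0 ≤ (κ * ‖ζ‖ - 2 * C ^ 2 * ‖y‖) ^ 2 / (2 * κ) := by positivity
    have e : (κ * ‖ζ‖ - 2 * C ^ 2 * ‖y‖) ^ 2 / (2 * κ)
        = κ / 2 * ‖ζ‖ ^ 2 + 2 * C ^ 4 / κ * ‖y‖ ^ 2 - 2 * (C ^ 2 * ‖y‖ * ‖ζ‖) := by
      field_simp; ring
    linarith
  have e4 := hsymm ζ c'
  simp only [sub_apply, map_add, add_apply] at e1 e2 ⊢
  rw [abs_le] at e1 e2
  nlinarith

/-- The calibration: a curve `α` that starts at `c 0` and stays in `B` is compared with the geodesic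
`c` at the parameter `τ` proportional to arc length. The function `F` of the displacement `α - c ∘ τ`
below increases along `α`, and its values at the ends give a lower bound for the length of `α` with a
quadratic gain in the displacement of the end point. The constant `e` keeps the speed positive. -/
theorem length_sq_lower_bound {G : V → V →L[ℝ] V →L[ℝ] ℝ} {B : Set V} {C κ t₁ : ℝ}
    {c c' : ℝ → V} {ξ' : ℝ → V →L[ℝ] ℝ} (ht₁ : 0 < t₁) (hC : 0 ≤ C) (hκ : 0 < κ)
    (hsymm : ∀ z ∈ B, ∀ u v, G z u v = G z v u)
    (hell : ∀ z ∈ B, ∀ v, κ * ‖v‖ ^ 2 ≤ G z v v)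
    (hlip : ∀ z ∈ B, ∀ w ∈ B, ‖G w - G z‖ ≤ C * ‖w - z‖)
    (htay : ∀ z ∈ B, ∀ w ∈ B, ‖G w - G z - fderiv ℝ G z (w - z)‖ ≤ C * ‖w - z‖ ^ 2)
    (hcB : ∀ τ ∈ Icc 0 t₁, c τ ∈ B) (hcc : ContinuousOn c (Icc 0 t₁))
    (hcd : ∀ τ ∈ Ioo 0 t₁, HasDerivAt c (c' τ) τ) (hc' : ∀ τ ∈ Icc 0 t₁, ‖c' τ‖ ≤ C)
    (hξc : ContinuousOn (fun s ↦ G (c s) (c' s)) (Icc 0 t₁))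
    (hξd : ∀ τ ∈ Ioo 0 t₁, HasDerivAt (fun s ↦ G (c s) (c' s)) (ξ' τ) τ)
    (h1 : ∀ τ ∈ Ioo 0 t₁, G (c τ) (c' τ) (c' τ) = 1)
    (hgeo : ∀ τ ∈ Ioo 0 t₁, ∀ v, fderiv ℝ G (c τ) v (c' τ) (c' τ) = 2 * ξ' τ v)
    (hsmall : 2 * (C ^ 3 + 2 * C ^ 4 / κ) * t₁ ^ 2 ≤ κ / 16)
    {α α' : ℝ → V} {sp : ℝ → ℝ} (hαB : ∀ s ∈ Icc (0 : ℝ) 1, α s ∈ B)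
    (hα : ∀ s ∈ Icc (0 : ℝ) 1, HasDerivAt α (α' s) s) (hα0 : α 0 = c 0)
    (hsp : Continuous sp) (hsp0 : ∀ s, 0 ≤ sp s)
    (hspα : ∀ s ∈ Icc (0 : ℝ) 1, G (α s) (α' s) (α' s) = sp s ^ 2) {e : ℝ} (he : 0 < e) :
    t₁ ^ 2 + 2 * t₁ * G (c t₁) (c' t₁) (α 1 - c t₁) + κ / 16 * ‖α 1 - c t₁‖ ^ 2
      ≤ ((∫ s in (0 : ℝ)..1, sp s) + e) ^ 2 := by
  set Λ := (∫ s in (0 : ℝ)..1, sp s) + e with hΛ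
  have hΛ0 : 0 < Λ := add_pos_of_nonneg_of_pos
    (intervalIntegral.integral_nonneg zero_le_one fun s _ ↦ hsp0 s) he
  set β := κ / 16 with hβ
  -- the parameter proportional to (slightly modified) arc length
  set θ : ℝ → ℝ := fun s ↦ t₁ * (sp s + e) / Λ with hθ
  set τ : ℝ → ℝ := fun s ↦ ∫ u in (0 : ℝ)..s, θ u with hτ
  have hθc : Continuous θ := by fun_prop
  have hθ0 : ∀ s, 0 < θ s := fun s ↦ div_pos (mul_pos ht₁ (by linarith [hsp0 s])) hΛ0
  have hτd : ∀ s, HasDerivAt τ (θ s) s := fun s ↦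
    intervalIntegral.integral_hasDerivAt_right (hθc.intervalIntegrable _ _)
      hθc.stronglyMeasurable.stronglyMeasurableAtFilter hθc.continuousAt
  have hτ0 : τ 0 = 0 := by simp [hτ]
  have hτ1 : τ 1 = t₁ := by
    have : ∫ u in (0 : ℝ)..1, (sp u + e) = Λ := by
      rw [intervalIntegral.integral_add (hsp.intervalIntegrable _ _)
        (continuous_const.intervalIntegrable _ _)]
      simp [hΛ]
    simp only [hτ, hθ, mul_div_assoc]
    rw [intervalIntegral.integral_const_mul, intervalIntegral.integral_div, this,
      div_self hΛ0.ne', mul_one]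
  have hτm : StrictMono τ := strictMono_of_hasDerivAt_pos hτd hθ0
  have hτI : ∀ s ∈ Ioo (0 : ℝ) 1, τ s ∈ Ioo 0 t₁ := fun s hs ↦
    ⟨hτ0 ▸ hτm hs.1, hτ1 ▸ hτm hs.2⟩
  have hτJ : MapsTo τ (Icc (0 : ℝ) 1) (Icc 0 t₁) := fun s hs ↦
    ⟨hτ0 ▸ hτm.monotone hs.1, hτ1 ▸ hτm.monotone hs.2⟩
  have hτc : ContinuousOn τ (Icc 0 1) := fun s _ ↦ (hτd s).continuousAt.continuousWithinAt
  set b : ℝ → ℝ := fun s ↦ β * (2 * t₁ - s) / t₁ ^ 2 with hb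
  have hbd : ∀ s, HasDerivAt b (-β / t₁ ^ 2) s := fun s ↦ by
    have := (((hasDerivAt_id s).const_sub (2 * t₁)).const_mul β).div_const (t₁ ^ 2)
    simpa using this
  set y : ℝ → V := fun s ↦ α s - c (τ s) with hy
  set ξ : ℝ → V →L[ℝ] ℝ := fun s ↦ G (c s) (c' s) with hξ
  set F : ℝ → ℝ := fun s ↦
    (Λ / t₁) ^ 2 * τ s - τ s - 2 * ξ (τ s) (y s) - b (τ s) * ‖y s‖ ^ 2 with hF
  have hyc : ContinuousOn y (Icc 0 1) :=
    ContinuousOn.sub (fun s hs ↦ (hα s hs).continuousAt.continuousWithinAt) (hcc.comp hτc hτJ)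
  have hFc : ContinuousOn F (Icc 0 1) := by
    refine (((continuousOn_const.mul hτc).sub hτc).sub
      (continuousOn_const.mul ((hξc.comp hτc hτJ).clm_apply hyc))).sub
      (ContinuousOn.mul ?_ (hyc.norm.pow 2))
    exact (fun s hs ↦ ((hbd _).continuousAt.comp (hτd s).continuousAt).continuousWithinAt)
  have hmono : MonotoneOn F (Icc 0 1) := by
    refine monotoneOn_of_hasDerivWithinAt_nonneg (f' := fun s ↦
      (Λ / t₁) ^ 2 * θ s - θ s - 2 * (θ s * ξ' (τ s) (y s) + ξ (τ s) (α' s - θ s • c' (τ s)))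
        - ((-β / t₁ ^ 2 * θ s) * ‖y s‖ ^ 2
          + b (τ s) * (2 * ⟪y s, α' s - θ s • c' (τ s)⟫_ℝ))) (convex_Icc 0 1) hFc ?_ ?_
    · intro s hs
      rw [interior_Icc] at hs
      have hs' := Ioo_subset_Icc_self hs
      have hyd : HasDerivAt y (α' s - θ s • c' (τ s)) s :=
        (hα s hs').sub ((hcd _ (hτI s hs)).scomp s (hτd s))
      have hξs : HasDerivAt (fun s ↦ ξ (τ s)) (θ s • ξ' (τ s)) s :=
        (hξd _ (hτI s hs)).scomp s (hτd s)
      have h := (((hτd s).const_mul ((Λ / t₁) ^ 2)).sub (hτd s)).sub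
        ((hξs.clm_apply hyd).const_mul 2) |>.sub (((hbd (τ s)).comp s (hτd s)).mul hyd.norm_sq)
      exact h.hasDerivWithinAt
    · intro s hs
      rw [interior_Icc] at hs
      have hs' := Ioo_subset_Icc_self hs
      have hτs := hτI s hs
      have hτs' := Ioo_subset_Icc_self hτs
      obtain ⟨ζ, hζ⟩ : ∃ ζ : V, α' s = θ s • (c' (τ s) + ζ) :=
        ⟨(θ s)⁻¹ • α' s - c' (τ s), by simp [smul_smul, (hθ0 s).ne']⟩
      have hwz : α s - c (τ s) = y s := rfl
      have key := energy_lower_bound (G₀ := G (c (τ s))) (G₁ := G (α s))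
        (Dy := fderiv ℝ G (c (τ s)) (y s)) (c' := c' (τ s)) (y := y s) (ζ := ζ) hC hκ
        (hsymm _ (hαB s hs')) (htay _ (hcB _ hτs') _ (hαB s hs'))
        (hlip _ (hcB _ hτs') _ (hαB s hs')) (hc' _ hτs') (hell _ (hαB s hs') ζ)
      rw [h1 _ hτs, hgeo _ hτs] at key
      have hspd := hspα s hs'
      rw [hζ] at hspd
      simp only [map_smul, smul_apply, smul_eq_mul] at hspd
      have hν : G (α s) (c' (τ s) + ζ) (c' (τ s) + ζ) ≤ (Λ / t₁) ^ 2 := by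
        have h3 : sp s ≤ Λ / t₁ * θ s := by
          have : Λ / t₁ * θ s = sp s + e := by simp only [hθ]; field_simp
          linarith
        have h4 : sp s ^ 2 ≤ (Λ / t₁ * θ s) ^ 2 := pow_le_pow_left₀ (hsp0 s) h3 2
        rw [← hspd, mul_pow] at h4
        nlinarith [pow_pos (hθ0 s) 2]
      have hb0 : 0 ≤ b (τ s) ∧ b (τ s) ≤ 2 * β / t₁ := by
        have hβ0 : 0 < β := by positivity
        refine ⟨div_nonneg (mul_nonneg hβ0.le (by linarith [hτs.2])) (by positivity), ?_⟩
        have e5 : 2 * β / t₁ = β * (2 * t₁) / t₁ ^ 2 := by field_simp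
        rw [e5]
        simp only [hb]
        gcongr
        linarith [hτs.1]
      have hin : |⟪y s, ζ⟫_ℝ| ≤ ‖y s‖ * ‖ζ‖ := abs_real_inner_le_norm _ _
      have hcross : 2 * b (τ s) * (‖y s‖ * ‖ζ‖)
          ≤ κ / 2 * ‖ζ‖ ^ 2 + β / (2 * t₁ ^ 2) * ‖y s‖ ^ 2 := by
        have e6 : 2 * b (τ s) * (‖y s‖ * ‖ζ‖) ≤ 2 * (2 * β / t₁) * (‖y s‖ * ‖ζ‖) := by
          gcongr; exact hb0.2
        have e7 : κ / 2 * ‖ζ‖ ^ 2 + β / (2 * t₁ ^ 2) * ‖y s‖ ^ 2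
            - 2 * (2 * β / t₁) * (‖y s‖ * ‖ζ‖)
            = κ / 2 * (‖ζ‖ - ‖y s‖ / (4 * t₁)) ^ 2 := by
          rw [hβ]; field_simp; ring
        have : 0 ≤ κ / 2 * (‖ζ‖ - ‖y s‖ / (4 * t₁)) ^ 2 := by positivity
        linarith
      have hK : (C ^ 3 + 2 * C ^ 4 / κ) * ‖y s‖ ^ 2 ≤ β / (2 * t₁ ^ 2) * ‖y s‖ ^ 2 := by
        gcongr
        rw [le_div_iff₀ (by positivity)]
        linarith
      have hβt : β / t₁ ^ 2 = 2 * (β / (2 * t₁ ^ 2)) := by field_simp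
      have e8 : α' s - θ s • c' (τ s) = θ s • ζ := by rw [hζ, smul_add]; abel
      rw [e8]
      simp only [map_smul, smul_eq_mul, real_inner_smul_right]
      have hfin : 0 ≤ (Λ / t₁) ^ 2 - 1 - 2 * (ξ' (τ s) (y s) + ξ (τ s) ζ)
          + β / t₁ ^ 2 * ‖y s‖ ^ 2 - 2 * b (τ s) * ⟪y s, ζ⟫_ℝ := by
        have e9 : 2 * b (τ s) * ⟪y s, ζ⟫_ℝ ≤ 2 * b (τ s) * (‖y s‖ * ‖ζ‖) :=
          mul_le_mul_of_nonneg_left ((le_abs_self _).trans hin) (by linarith [hb0.1])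
        rw [hβt]
        simp only [hξ]
        linarith
      have := mul_nonneg (hθ0 s).le hfin
      simp only [neg_div]
      linarith
  have hend := hmono (left_mem_Icc.2 zero_le_one) (right_mem_Icc.2 zero_le_one) zero_le_one
  have hy0 : y 0 = 0 := by simp [hy, hτ0, hα0]
  have hy1 : y 1 = α 1 - c t₁ := by simp only [hy, hτ1]
  have hb1 : b t₁ = β / t₁ := by simp only [hb]; field_simp; ring
  simp only [hF, hτ0, hτ1, hy0, hy1, hb1, map_zero, norm_zero] at hend
  have h9 := mul_nonneg ht₁.le
    (show 0 ≤ (Λ / t₁) ^ 2 * t₁ - t₁ - 2 * ξ t₁ (α 1 - c t₁) - β / t₁ * ‖α 1 - c t₁‖ ^ 2 by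
      refine le_trans (le_of_eq ?_) hend
      ring)
  have h10 : t₁ * ((Λ / t₁) ^ 2 * t₁ - t₁ - 2 * ξ t₁ (α 1 - c t₁)
      - β / t₁ * ‖α 1 - c t₁‖ ^ 2) = Λ ^ 2 - t₁ ^ 2 - 2 * t₁ * ξ t₁ (α 1 - c t₁)
      - β * ‖α 1 - c t₁‖ ^ 2 := by field_simp
  linarith

/-- A `C²` map is Lipschitz and satisfies a first order Taylor estimate on a small ball. -/
theorem exists_ball_taylor {W : Type*} [NormedAddCommGroup W] [NormedSpace ℝ W] {G : V → W} {z₀ : V}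
    (hG : ContDiffAt ℝ 2 G z₀) {e : ℝ} (he : 0 < e) : ∃ R > 0, ∃ C : ℝ,
      (∀ z ∈ Metric.ball z₀ R, HasFDerivAt G (fderiv ℝ G z) z ∧ ‖G z - G z₀‖ ≤ e) ∧
      (∀ z ∈ Metric.ball z₀ R, ∀ w ∈ Metric.ball z₀ R, ‖G w - G z‖ ≤ C * ‖w - z‖) ∧
      ∀ z ∈ Metric.ball z₀ R, ∀ w ∈ Metric.ball z₀ R,
        ‖G w - G z - fderiv ℝ G z (w - z)‖ ≤ C * ‖w - z‖ ^ 2 := by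
  obtain ⟨K₁, s₁, hs₁, hK₁⟩ := (hG.of_le (m := 1) (by norm_num)).exists_lipschitzOnWith
  obtain ⟨K₂, s₂, hs₂, hK₂⟩ := (hG.fderiv_right (m := 1) (by norm_num)).exists_lipschitzOnWith
  have hdiff : ∀ᶠ z in 𝓝 z₀, DifferentiableAt ℝ G z :=
    (hG.eventually (by simp)).mono fun z hz ↦ hz.differentiableAt (by norm_num)
  have hnear : ∀ᶠ z in 𝓝 z₀, ‖G z - G z₀‖ < e := by
    have := hG.continuousAt.eventually (Metric.ball_mem_nhds (G z₀) he)
    exact this.mono fun z hz ↦ by rwa [← dist_eq_norm]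
  obtain ⟨R, hR, hball⟩ := Metric.eventually_nhds_iff_ball.1
    ((eventually_mem_set.2 hs₁).and ((eventually_mem_set.2 hs₂).and (hdiff.and hnear)))
  refine ⟨R, hR, max K₁ K₂, fun z hz ↦ ⟨(hball z hz).2.2.1.hasFDerivAt, (hball z hz).2.2.2.le⟩,
    fun z hz w hw ↦ ?_, fun z hz w hw ↦ ?_⟩
  · have := hK₁.dist_le_mul w (hball w hw).1 z (hball z hz).1
    rw [dist_eq_norm, dist_eq_norm] at this
    exact this.trans (by gcongr; exact le_max_left _ _)
  · have hseg : segment ℝ z w ⊆ Metric.ball z₀ R := (convex_ball z₀ R).segment_subset hz hw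
    have := (convex_segment z w).norm_image_sub_le_of_norm_fderiv_le' (𝕜 := ℝ) (f := G)
      (φ := fderiv ℝ G z) (C := max K₁ K₂ * ‖w - z‖) (x := z) (y := w)
      (fun x hx ↦ (hball x (hseg hx)).2.2.1) (fun x hx ↦ ?_) (left_mem_segment ℝ z w)
      (right_mem_segment ℝ z w)
    · rwa [mul_assoc, ← sq] at this
    · have h3 := hK₂.dist_le_mul x (hball x (hseg hx)).2.1 z (hball z hz).2.1
      rw [dist_eq_norm, dist_eq_norm] at h3
      refine h3.trans ?_
      have h4 : ‖x - z‖ ≤ ‖w - z‖ := by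
        obtain ⟨θ, hθ, rfl⟩ := (segment_eq_image' ℝ z w ▸ hx :)
        rw [add_sub_cancel_left, norm_smul, Real.norm_of_nonneg hθ.1]
        exact mul_le_of_le_one_left (norm_nonneg _) hθ.2
      gcongr
      exact le_max_right _ _

set_option synthInstance.maxHeartbeats 200000 in
set_option maxHeartbeats 1000000 in
/-- Near its starting point, a geodesic `c` of the metric `G` along which `f` is smooth and has
gradient `c'` is strictly shorter than nearby curves, to second order, with a constant that does not
depend on the length of `c`. -/
theorem exists_length_sq_lower_bound {G : V → V →L[ℝ] V →L[ℝ] ℝ} {f : V → ℝ} {c : ℝ → V} {z₀ : V}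
    {a κ₀ : ℝ} (ha : 0 < a) (hG : ContDiffAt ℝ 2 G z₀)
    (hsymm : ∀ z u v, G z u v = G z v u)
    (hκ₀ : 0 < κ₀) (hell : ∀ v, κ₀ * ‖v‖ ^ 2 ≤ G z₀ v v)
    (hc : ContDiffOn ℝ 2 c (Icc 0 a)) (hc0 : c 0 = z₀)
    (hf : ∀ τ ∈ Ioo 0 a, ContDiffAt ℝ 2 f (c τ))
    (heik : ∀ τ ∈ Ioo 0 a, ∀ᶠ z in 𝓝 (c τ), ∀ v, (fderiv ℝ f z v) ^ 2 ≤ G z v v)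
    (hgrad : ∀ τ ∈ Ioo 0 a, fderiv ℝ f (c τ) = G (c τ) (derivWithin c (Icc 0 a) τ))
    (hunit : ∀ τ ∈ Ioo 0 a,
      G (c τ) (derivWithin c (Icc 0 a) τ) (derivWithin c (Icc 0 a) τ) = 1) :
    ∃ κ > 0, ∃ B ∈ 𝓝 z₀, ∃ t₀ > 0, t₀ ≤ a ∧ ∀ t₁ ∈ Ioo 0 t₀, ∀ (α α' : ℝ → V) (sp : ℝ → ℝ),
      (∀ s ∈ Icc (0 : ℝ) 1, α s ∈ B) → (∀ s ∈ Icc (0 : ℝ) 1, HasDerivAt α (α' s) s) →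
      α 0 = z₀ → Continuous sp → (∀ s, 0 ≤ sp s) →
      (∀ s ∈ Icc (0 : ℝ) 1, G (α s) (α' s) (α' s) = sp s ^ 2) → ∀ e > 0,
      t₁ ^ 2 + 2 * t₁ * fderiv ℝ f (c t₁) (α 1 - c t₁) + κ * ‖α 1 - c t₁‖ ^ 2
        ≤ ((∫ s in (0 : ℝ)..1, sp s) + e) ^ 2 := by
  set c' := derivWithin c (Icc 0 a) with hc'
  have hu : UniqueDiffOn ℝ (Icc 0 a) := uniqueDiffOn_Icc ha
  have hc1 : ContDiffOn ℝ 1 c' (Icc 0 a) := hc.derivWithin hu (by norm_num)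
  have hcc : ContinuousOn c (Icc 0 a) := hc.continuousOn
  obtain ⟨R, hR, C₁, hball, hlip₁, htay₁⟩ := exists_ball_taylor hG (half_pos hκ₀)
  set B := Metric.ball z₀ R with hB
  obtain ⟨C₃, hC₃⟩ : ∃ C, ∀ τ ∈ Icc 0 a, ‖c' τ‖ ≤ C :=
    isCompact_Icc.exists_bound_of_continuousOn hc1.continuousOn
  obtain ⟨C, hC, hCC₁, hCC₃⟩ : ∃ C : ℝ, 0 ≤ C ∧ C₁ ≤ C ∧ C₃ ≤ C :=
    ⟨max 0 (max C₁ C₃), le_max_left _ _, (le_max_left _ _).trans (le_max_right _ _),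
      (le_max_right _ _).trans (le_max_right _ _)⟩
  obtain ⟨κ, hκ, hκ'⟩ : ∃ κ > 0, κ = κ₀ / 2 := ⟨κ₀ / 2, half_pos hκ₀, rfl⟩
  obtain ⟨t₂, ht₂, hct₂⟩ : ∃ t₂ > 0, ∀ τ ∈ Icc 0 a, τ < t₂ → c τ ∈ B := by
    have h := hcc 0 (left_mem_Icc.2 ha.le)
    obtain ⟨t₂, ht₂, h⟩ := Metric.continuousWithinAt_iff.1 h R hR
    refine ⟨t₂, ht₂, fun τ hτ hlt ↦ ?_⟩
    have := h hτ (by rw [Real.dist_eq, sub_zero, abs_of_nonneg hτ.1]; exact hlt)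
    rwa [hc0] at this
  set Q := 2 * (C ^ 3 + 2 * C ^ 4 / κ) with hQ
  have hQ0 : 0 ≤ Q := by positivity
  refine ⟨κ / 16, by positivity, B, Metric.ball_mem_nhds z₀ hR,
    min a (min t₂ (min 1 (κ / 16 / (Q + 1)))), by positivity, min_le_left _ _, ?_⟩
  intro t₁ ht₁ α α' sp hαB hα hα0 hsp hsp0 hspα e he
  obtain ⟨hta, htt₂, ht1, htQ⟩ : t₁ < a ∧ t₁ < t₂ ∧ t₁ < 1 ∧ t₁ < κ / 16 / (Q + 1) := by
    have := ht₁.2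
    simp only [lt_min_iff] at this
    exact ⟨this.1, this.2.1, this.2.2.1, this.2.2.2⟩
  have hsub : Icc 0 t₁ ⊆ Icc 0 a := Icc_subset_Icc_right hta.le
  have hsub' : Ioo 0 t₁ ⊆ Ioo 0 a := Ioo_subset_Ioo_right hta.le
  have hcB : ∀ τ ∈ Icc 0 t₁, c τ ∈ B := fun τ hτ ↦
    hct₂ τ (hsub hτ) (hτ.2.trans_lt htt₂)
  have hcd : ∀ τ ∈ Ioo 0 a, HasDerivAt c (c' τ) τ := fun τ hτ ↦
    ((hc.differentiableOn (by norm_num)) τ (Ioo_subset_Icc_self hτ)).hasDerivWithinAt.hasDerivAt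
      (Icc_mem_nhds hτ.1 hτ.2)
  have hcd' : ∀ τ ∈ Ioo 0 a, HasDerivAt c' (derivWithin c' (Icc 0 a) τ) τ := fun τ hτ ↦
    ((hc1.differentiableOn (by norm_num)) τ (Ioo_subset_Icc_self hτ)).hasDerivWithinAt.hasDerivAt
      (Icc_mem_nhds hτ.1 hτ.2)
  have hGd : ∀ z ∈ B, HasFDerivAt G (fderiv ℝ G z) z := fun z hz ↦ (hball z hz).1
  have hξd : ∀ τ ∈ Ioo 0 t₁, HasDerivAt (fun s ↦ G (c s) (c' s))
      (fderiv ℝ G (c τ) (c' τ) (c' τ) + G (c τ) (derivWithin c' (Icc 0 a) τ)) τ := fun τ hτ ↦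
    hasDerivAt_clm_comp_apply (hGd _ (hcB _ (Ioo_subset_Icc_self hτ))) (hcd τ (hsub' hτ))
      (hcd' τ (hsub' hτ))
  have hell' : ∀ z ∈ B, ∀ v, κ * ‖v‖ ^ 2 ≤ G z v v := by
    intro z hz v
    have h1 : |(G z - G z₀) v v| ≤ κ₀ / 2 * ‖v‖ * ‖v‖ := by
      refine ((G z - G z₀).le_opNorm₂ v v).trans ?_
      gcongr
      exact (hball z hz).2
    rw [sub_apply, sub_apply, abs_le] at h1
    have := hell v
    rw [hκ']
    nlinarith
  have hlip : ∀ z ∈ B, ∀ w ∈ B, ‖G w - G z‖ ≤ C * ‖w - z‖ := fun z hz w hw ↦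
    (hlip₁ z hz w hw).trans (mul_le_mul_of_nonneg_right hCC₁ (norm_nonneg _))
  have htay : ∀ z ∈ B, ∀ w ∈ B, ‖G w - G z - fderiv ℝ G z (w - z)‖ ≤ C * ‖w - z‖ ^ 2 :=
    fun z hz w hw ↦ (htay₁ z hz w hw).trans (mul_le_mul_of_nonneg_right hCC₁ (by positivity))
  have hgeo : ∀ τ ∈ Ioo 0 t₁, ∀ v, fderiv ℝ G (c τ) v (c' τ) (c' τ)
      = 2 * (fderiv ℝ G (c τ) (c' τ) (c' τ) + G (c τ) (derivWithin c' (Icc 0 a) τ)) v := by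
    intro τ hτ v
    refine deriv_metric_of_eikonal (hGd _ (hcB _ (Ioo_subset_Icc_self hτ)))
      (hf τ (hsub' hτ)) (hcd τ (hsub' hτ)) ((heik τ (hsub' hτ)).mono fun z hz ↦ hz _) ?_
      (hunit τ (hsub' hτ)) (hξd τ hτ) v
    filter_upwards [Ioo_mem_nhds hτ.1 hτ.2] with s hs using hgrad s (hsub' hs)
  have hξc : ContinuousOn (fun s ↦ G (c s) (c' s)) (Icc 0 t₁) := by
    have h1 : ContinuousOn G B := fun z hz ↦ (hGd z hz).continuousAt.continuousWithinAt
    exact (h1.comp (hcc.mono hsub) hcB).clm_apply (hc1.continuousOn.mono hsub)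
  have hsmall : 2 * (C ^ 3 + 2 * C ^ 4 / κ) * t₁ ^ 2 ≤ κ / 16 := by
    rw [lt_div_iff₀ (by positivity)] at htQ
    have : Q * t₁ ^ 2 ≤ t₁ * (Q + 1) := by nlinarith [ht₁.1, mul_nonneg hQ0 ht₁.1.le]
    linarith
  have := length_sq_lower_bound ht₁.1 hC hκ (fun z _ ↦ hsymm z) hell' hlip htay hcB
    (hcc.mono hsub) (fun τ hτ ↦ hcd τ (hsub' hτ)) (fun τ hτ ↦ (hC₃ τ (hsub hτ)).trans hCC₃)
    hξc hξd (fun τ hτ ↦ hunit τ (hsub' hτ)) hgeo hsmall hαB hα (by rw [hα0, hc0]) hsp hsp0 hspα he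
  rwa [hgrad t₁ ⟨ht₁.1, hta⟩]

/-- A second derivative test, in the form needed for the square of a distance. -/
theorem le_second_deriv_of_sq_ge {g g' : ℝ → ℝ} {t k q : ℝ} (ht : 0 < t)
    (hg : ∀ᶠ s in 𝓝 0, HasDerivAt g (g' s) s) (hg' : HasDerivAt g' q 0)
    (h0 : g 0 = t) (h1 : g' 0 = 0) (h : ∀ᶠ s in 𝓝 0, t ^ 2 + k * s ^ 2 ≤ g s ^ 2) :
    k / t ≤ q := by
  by_contra! hlt
  rw [lt_div_iff₀ ht] at hlt
  set f : ℝ → ℝ := fun s ↦ g s ^ 2 - (t ^ 2 + k * s ^ 2) with hf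
  have hd1 : deriv f =ᶠ[𝓝 0] fun s ↦ 2 * g s * g' s - 2 * k * s := by
    filter_upwards [hg] with s hs
    have := (hs.pow 2).sub ((((hasDerivAt_id s).pow 2).const_mul k).const_add (t ^ 2))
    refine (HasDerivAt.congr_deriv (f := f) this ?_).deriv
    simp
    ring
  have hd2 : deriv (deriv f) 0 = 2 * t * q - 2 * k := by
    rw [hd1.deriv_eq]
    have := ((hg.self_of_nhds.const_mul 2).mul hg').sub ((hasDerivAt_id (0 : ℝ)).const_mul (2 * k))
    refine (HasDerivAt.congr_deriv this ?_).deriv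
    simp [h0, h1]
  have hcont : ContinuousAt f 0 := by
    have := hg.self_of_nhds.continuousAt
    fun_prop
  have hmax := isLocalMax_of_deriv_deriv_neg (by rw [hd2]; nlinarith)
    (by rw [hd1.self_of_nhds]; simp [h1]) hcont
  have hzero : f =ᶠ[𝓝 0] fun _ ↦ (0 : ℝ) := by
    filter_upwards [hmax, h] with s h2 h3
    have : f 0 = 0 := by simp [hf, h0]
    rw [this] at h2
    exact le_antisymm h2 (sub_nonneg.2 h3)
  rw [hzero.deriv.deriv_eq] at hd2
  simp at hd2
  nlinarith

end Calibration

/-! ### The metric in a chart -/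

section ChartMetric

open Manifold

variable {p : M}

theorem contDiffAt_of_clm_apply {D F G : Type*} [NormedAddCommGroup D] [NormedSpace ℝ D]
    [NormedAddCommGroup F] [NormedSpace ℝ F] [FiniteDimensional ℝ F]
    [NormedAddCommGroup G] [NormedSpace ℝ G] {n : ℕ∞ω} {f : D → F →L[ℝ] G} {x : D}
    (h : ∀ y, ContDiffAt ℝ n (fun x ↦ f x y) x) : ContDiffAt ℝ n f x := by
  let d := Module.finrank ℝ F
  have hd : d = Module.finrank ℝ (Fin d → ℝ) := (Module.finrank_fin_fun ℝ).symm
  let e₁ := ContinuousLinearEquiv.ofFinrankEq hd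
  let e₂ := (e₁.arrowCongr (1 : G ≃L[ℝ] G)).trans (ContinuousLinearEquiv.piRing (Fin d))
  rw [← Function.id_comp f, ← e₂.symm_comp_self]
  exact e₂.symm.contDiff.contDiffAt.comp x (contDiffAt_pi.mpr fun i ↦ h _)

/-- The tangent vector at `φ⁻¹ z` with coordinates `u` in the chart `φ` at `p`. -/
def chartVec (p : M) (z : E) : E →L[ℝ] TangentSpace 𝓘(ℝ, E) ((extChartAt 𝓘(ℝ, E) p).symm z) :=
  mfderiv 𝓘(ℝ, E) 𝓘(ℝ, E) (extChartAt 𝓘(ℝ, E) p).symm z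

theorem chartVec_eq_extend {z : E} (hz : z ∈ (extChartAt 𝓘(ℝ, E) p).target) (u : E) :
    chartVec p z u = extend E (asTangent p u) ((extChartAt 𝓘(ℝ, E) p).symm z) := by
  have hsrc : (extChartAt 𝓘(ℝ, E) p).symm z ∈ (chartAt E p).source := by
    have := (extChartAt 𝓘(ℝ, E) p).map_target hz
    rwa [extChartAt_source] at this
  have h4 : ∀ ζ, ζ = z → chartVec p z u = mfderiv 𝓘(ℝ, E) 𝓘(ℝ, E) (extChartAt 𝓘(ℝ, E) p).symm
      ζ u := by
    rintro ζ rfl; rfl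
  exact (h4 _ ((extChartAt 𝓘(ℝ, E) p).right_inv hz)).trans
    (extend_eq_mfderiv_symm hsrc (asTangent p u)).symm

/-- The metric in the chart at `p`. -/
def chartMetric (p : M) (z : E) : E →L[ℝ] E →L[ℝ] ℝ :=
  (innerSL ℝ (E := TangentSpace 𝓘(ℝ, E) ((extChartAt 𝓘(ℝ, E) p).symm z))).bilinearComp
    (chartVec p z) (chartVec p z)

theorem chartMetric_apply (z u v : E) :
    chartMetric p z u v = ⟪chartVec p z u, chartVec p z v⟫_ℝ := rfl

theorem chartMetric_symm (z u v : E) : chartMetric p z u v = chartMetric p z v u := by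
  rw [chartMetric_apply, chartMetric_apply, real_inner_comm]

theorem chartMetric_self (z u : E) : chartMetric p z u u = ‖chartVec p z u‖ ^ 2 := by
  rw [chartMetric_apply, real_inner_self_eq_norm_sq]

theorem contDiffAt_chartMetric (p : M) :
    ContDiffAt ℝ 2 (chartMetric (E := E) p) (extChartAt 𝓘(ℝ, E) p p) := by
  refine contDiffAt_of_clm_apply fun u ↦ contDiffAt_of_clm_apply fun v ↦ ?_
  have h1 : CMDiffAt (2 : ℕ) (fun y ↦ ⟪extend E (asTangent p u) y, extend E (asTangent p v) y⟫_ℝ) p :=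
    contMDiffAt_inner (contMDiffAt_extend_field _) (contMDiffAt_extend_field _)
  refine (contDiffAt_comp_symm (by exact_mod_cast h1)).congr_of_eventuallyEq ?_
  filter_upwards [extChartAt_target_mem_nhds (I := 𝓘(ℝ, E)) p] with z hz
  rw [chartMetric_apply, chartVec_eq_extend hz, chartVec_eq_extend hz]
  rfl

theorem chartVec_self_injective (p : M) :
    Function.Injective (chartVec (E := E) p (extChartAt 𝓘(ℝ, E) p p)) := by
  have hi := isInvertible_mfderivWithin_extChartAt_symm (I := 𝓘(ℝ, E)) (x := p)
    (y := extChartAt 𝓘(ℝ, E) p p) (mem_extChartAt_target p)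
  have hr : range 𝓘(ℝ, E) = univ := by simp
  rw [hr, mfderivWithin_univ] at hi
  exact hi.injective

theorem exists_chartMetric_self_ge (p : M) : ∃ κ > 0, ∀ v : E,
    κ * ‖v‖ ^ 2 ≤ chartMetric p (extChartAt 𝓘(ℝ, E) p p) v v := by
  obtain ⟨K, hK, h⟩ := (chartVec (E := E) p (extChartAt 𝓘(ℝ, E) p p)).toLinearMap.exists_antilipschitzWith
    (LinearMap.ker_eq_bot.2 (chartVec_self_injective p))
  have hK' : (0 : ℝ) < K := hK
  refine ⟨(K ^ 2 : ℝ)⁻¹, by positivity, fun v ↦ ?_⟩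
  rw [chartMetric_self, inv_mul_le_iff₀ (by positivity), ← mul_pow]
  have := h.le_mul_dist v 0
  simp only [dist_zero_right, map_zero] at this
  exact pow_le_pow_left₀ (norm_nonneg _) this 2

theorem fderiv_comp_chart {f : M → ℝ} {z : E} (hz : z ∈ (extChartAt 𝓘(ℝ, E) p).target)
    (hf : MDiffAt f ((extChartAt 𝓘(ℝ, E) p).symm z)) (v : E) :
    fderiv ℝ (f ∘ (extChartAt 𝓘(ℝ, E) p).symm) z v
      = ⟪grad f ((extChartAt 𝓘(ℝ, E) p).symm z), chartVec p z v⟫_ℝ := by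
  have hsrc : (extChartAt 𝓘(ℝ, E) p).symm z ∈ (chartAt E p).source := by
    have := (extChartAt 𝓘(ℝ, E) p).map_target hz
    rwa [extChartAt_source] at this
  have h := mvfderiv_extend hsrc hf (asTangent p v)
  rw [(extChartAt 𝓘(ℝ, E) p).right_inv hz] at h
  rw [inner_grad, chartVec_eq_extend hz, h]
  rfl

theorem chartMetric_chart {x : M} (hx : x ∈ (chartAt E p).source) (u v : E) :
    chartMetric p (extChartAt 𝓘(ℝ, E) p x) u v
      = ⟪extend E (asTangent p u) x, extend E (asTangent p v) x⟫_ℝ := by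
  have hx' : x ∈ (extChartAt 𝓘(ℝ, E) p).source := by rwa [extChartAt_source]
  rw [chartMetric_apply, chartVec_eq_extend ((extChartAt 𝓘(ℝ, E) p).map_source hx'),
    chartVec_eq_extend ((extChartAt 𝓘(ℝ, E) p).map_source hx')]
  have h : ∀ y, y = x → ⟪extend E (asTangent p u) y, extend E (asTangent p v) y⟫_ℝ
      = ⟪extend E (asTangent p u) x, extend E (asTangent p v) x⟫_ℝ := by
    rintro y rfl; rfl
  exact h _ ((extChartAt 𝓘(ℝ, E) p).left_inv hx')

/-- The coordinates of a tangent vector at `x` in the chart at `p`. -/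
def chartCoord (p x : M) (v : TangentSpace 𝓘(ℝ, E) x) : E :=
  mfderiv 𝓘(ℝ, E) 𝓘(ℝ, E) (extChartAt 𝓘(ℝ, E) p) x v

theorem extend_chartCoord {x : M} (hx : x ∈ (chartAt E p).source) (v : TangentSpace 𝓘(ℝ, E) x) :
    extend E (asTangent p (chartCoord p x v)) x = v := by
  have hx' : x ∈ (extChartAt 𝓘(ℝ, E) p).source := by rwa [extChartAt_source]
  have h := mfderivWithin_extChartAt_symm_comp_mfderiv_extChartAt' (I := 𝓘(ℝ, E)) hx'
  have hr : range 𝓘(ℝ, E) = univ := by simp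
  rw [hr, mfderivWithin_univ] at h
  rw [extend_eq_mfderiv_symm hx]
  exact DFunLike.congr_fun h v

theorem chartMetric_chartCoord {x : M} (hx : x ∈ (chartAt E p).source)
    (v : TangentSpace 𝓘(ℝ, E) x) :
    chartMetric p (extChartAt 𝓘(ℝ, E) p x) (chartCoord p x v) (chartCoord p x v) = ‖v‖ ^ 2 := by
  rw [chartMetric_chart hx, extend_chartCoord hx, real_inner_self_eq_norm_sq]

theorem hasDerivAt_chart_comp {α : ℝ → M} {s : ℝ} (hs : α s ∈ (chartAt E p).source)
    (hα : MDifferentiableAt 𝓘(ℝ, ℝ) 𝓘(ℝ, E) α s) :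
    HasDerivAt (fun s ↦ extChartAt 𝓘(ℝ, E) p (α s))
      (chartCoord p (α s) (mfderiv 𝓘(ℝ, ℝ) 𝓘(ℝ, E) α s 1)) s := by
  have h1 := ((mdifferentiableAt_extChartAt (I := 𝓘(ℝ, E)) hs).hasMFDerivAt.comp s
    hα.hasMFDerivAt).hasFDerivAt
  exact HasFDerivAt.hasDerivAt (F := E) (f := fun s ↦ extChartAt 𝓘(ℝ, E) p (α s)) (x := s) h1

/-- The second derivative in the chart is the Hessian plus a Christoffel term. -/
theorem fderiv_fderiv_chart_eq {ρ : M → ℝ} {x : M} (hx : x ∈ (chartAt E p).source)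
    (hρ : CMDiffAt (2 : ℕ) ρ x) (w : E) (hW : MDiffAt (T% (extend E (asTangent p w))) x) :
    fderiv ℝ (fderiv ℝ (ρ ∘ (extChartAt 𝓘(ℝ, E) p).symm)) (extChartAt 𝓘(ℝ, E) p x) w w
      = ⟪leviCivita (grad ρ) x (extend E (asTangent p w) x), extend E (asTangent p w) x⟫_ℝ
        + ⟪grad ρ x, leviCivita (extend E (asTangent p w)) x (extend E (asTangent p w) x)⟫_ℝ := by
  set φ := extChartAt 𝓘(ℝ, E) p with hφ
  set W : Π y : M, TangentSpace 𝓘(ℝ, E) y := extend E (asTangent p w) with hWdef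
  have hx' : x ∈ φ.source := by rwa [hφ, extChartAt_source]
  have hX : MDiffAt (T% (grad (E := E) ρ)) x :=
    contMDiffAt_zero_of_mdiff (k := 0) (contMDiffAt_grad (k := 1) hρ)
  rw [← leviCivita_metric hW hX hW]
  have hd := mdiffAt_inner hX hW
  refine Eq.trans ?_ (mvfderiv_extend hx hd (asTangent p w)).symm
  have hev : (fun y ↦ ⟪grad ρ y, W y⟫_ℝ) ∘ φ.symm =ᶠ[𝓝 (φ x)]
      fun z ↦ fderiv ℝ (ρ ∘ φ.symm) z w := by
    have h1 : Tendsto φ.symm (𝓝 (φ x)) (𝓝 x) := by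
      have := (continuousAt_extChartAt_symm'' (I := 𝓘(ℝ, E)) (φ.map_source hx')).tendsto
      rwa [φ.left_inv hx'] at this
    have h2 : ∀ᶠ y in 𝓝 x, CMDiffAt (2 : ℕ) ρ y :=
      (contMDiffAt_iff_contMDiffAt_nhds (by simp)).1 hρ
    filter_upwards [(isOpen_extChartAt_target p).mem_nhds (φ.map_source hx'), h1.eventually h2]
      with z hz hρz
    rw [fderiv_comp_chart hz (hρz.mdifferentiableAt (by norm_num)), chartVec_eq_extend hz]
    rfl
  rw [hev.fderiv_eq]
  have h3 : ContDiffAt ℝ 2 (ρ ∘ φ.symm) (φ x) := by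
    have h4 : ContMDiffAt 𝓘(ℝ, E) 𝓘(ℝ, E) (2 : ℕ) φ.symm (φ x) :=
      (contMDiffOn_extChartAt_symm p).contMDiffAt
        ((isOpen_extChartAt_target p).mem_nhds (φ.map_source hx'))
    have h5 : ContMDiffAt 𝓘(ℝ, E) 𝓘(ℝ, ℝ) (2 : ℕ) ρ (φ.symm (φ x)) := by rwa [φ.left_inv hx']
    exact_mod_cast (ContMDiffAt.comp (φ x) h5 h4).contDiffAt
  have h6 : HasFDerivAt (fderiv ℝ (ρ ∘ φ.symm)) (fderiv ℝ (fderiv ℝ (ρ ∘ φ.symm)) (φ x)) (φ x) :=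
    ((h3.fderiv_right (m := 1) (by norm_num)).differentiableAt (by norm_num)).hasFDerivAt
  have h7 := (h6.clm_apply (hasFDerivAt_const w (φ x))).fderiv
  refine Eq.trans ?_ (congrArg (fun L : E →L[ℝ] ℝ ↦ L w) h7).symm
  simp

theorem extend_eq_sum_frame {y : M} (hy : y ∈ (chartAt E p).source) (w : E) :
    extend E (asTangent p w) y
      = ∑ i, (Module.finBasis ℝ E).repr w i • frame (E := E) p i y := by
  have h : ∀ v : TangentSpace 𝓘(ℝ, E) p, extend E v y
      = mfderiv 𝓘(ℝ, E) 𝓘(ℝ, E) (extChartAt 𝓘(ℝ, E) p).symm (extChartAt 𝓘(ℝ, E) p y) v :=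
    extend_eq_mfderiv_symm hy
  simp only [frame]
  simp only [h]
  have h2 : ∀ L : E →ₗ[ℝ] TangentSpace 𝓘(ℝ, E) y,
      L w = ∑ i, (Module.finBasis ℝ E).repr w i • L (Module.finBasis ℝ E i) := by
    intro L
    conv_lhs => rw [← (Module.finBasis ℝ E).sum_repr w]
    rw [map_sum]
    simp only [map_smul]
  let L : E →ₗ[ℝ] TangentSpace 𝓘(ℝ, E) y :=
    { toFun := fun v ↦ mfderiv 𝓘(ℝ, E) 𝓘(ℝ, E) (extChartAt 𝓘(ℝ, E) p).symm
        (extChartAt 𝓘(ℝ, E) p y) v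
      map_add' := fun a b ↦ map_add (mfderiv 𝓘(ℝ, E) 𝓘(ℝ, E) (extChartAt 𝓘(ℝ, E) p).symm
        (extChartAt 𝓘(ℝ, E) p y)) a b
      map_smul' := fun a b ↦ map_smul (mfderiv 𝓘(ℝ, E) 𝓘(ℝ, E) (extChartAt 𝓘(ℝ, E) p).symm
        (extChartAt 𝓘(ℝ, E) p y)) a b }
  exact h2 L

/-- The fields with constant coefficients in a chart, and their covariant derivatives along each
other, are bounded near the centre of the chart. -/
theorem exists_christoffel_bound (p : M) : ∃ K : ℝ, 0 ≤ K ∧ ∀ᶠ y in 𝓝 p, ∀ w : E,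
    MDiffAt (T% (extend E (asTangent p w))) y ∧
    ‖leviCivita (extend E (asTangent p w)) y (extend E (asTangent p w) y)‖ ≤ K * ‖w‖ ^ 2 ∧
    ‖extend E (asTangent p w) y‖ ≤ K * ‖w‖ := by
  have h1 : ∀ i, ∀ᶠ y in 𝓝 p, MDiffAt (T% (frame (E := E) p i)) y := fun i ↦
    eventually_mdiffAt (k := 0) (contMDiffAt_extend_field _)
  have h2 : ∀ i, ∃ C : ℝ, ∀ᶠ y in 𝓝 p, ‖frame (E := E) p i y‖ ≤ C := fun i ↦
    ⟨‖frame (E := E) p i p‖ + 1, ((continuousAt_norm_field (contMDiffAt_extend_field _)).eventually_lt_const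
      (lt_add_one _)).mono fun y hy ↦ hy.le⟩
  have h3 : ∀ i j, ∃ C : ℝ, ∀ᶠ y in 𝓝 p,
      ‖leviCivita (frame (E := E) p j) y (frame p i y)‖ ≤ C := fun i j ↦
    ⟨‖leviCivita (frame (E := E) p j) p (frame p i p)‖ + 1,
      ((continuousAt_norm_field (contMDiffAt_leviCivita (k := 0) (contMDiffAt_extend_field _)
        (contMDiffAt_extend_field _))).eventually_lt_const (lt_add_one _)).mono fun y hy ↦ hy.le⟩
  choose C₂ h2 using h2
  choose C₃ h3 using h3
  set L : E →L[ℝ] (Fin (Module.finrank ℝ E) → ℝ) :=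
    (Module.finBasis ℝ E).equivFunL.toContinuousLinearMap with hL
  have hLw : ∀ (w : E) i, |(Module.finBasis ℝ E).repr w i| ≤ ‖L‖ * ‖w‖ := fun w i ↦
    (norm_le_pi_norm (L w) i).trans (L.le_opNorm w)
  set l := ‖L‖ with hl
  have hl0 : 0 ≤ l := norm_nonneg _
  refine ⟨∑ i, l * |C₂ i| + ∑ i, ∑ j, l * l * |C₃ i j|, by positivity, ?_⟩
  filter_upwards [eventually_all.2 h1, eventually_all.2 h2,
    eventually_all.2 fun i ↦ eventually_all.2 (h3 i), chart_source_mem_nhds E p,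
    eventually_eventually_nhds.2 (eventually_mem_set.2 (chart_source_mem_nhds E p))]
    with y e1 e2 e3 hy hy' w
  set a := fun i ↦ (Module.finBasis ℝ E).repr w i with ha
  have hW : ∀ᶠ z in 𝓝 y, extend E (asTangent p w) z = ∑ i, a i • frame (E := E) p i z :=
    hy'.mono fun z hz ↦ extend_eq_sum_frame hz w
  have hda : ∀ i, MDiffAt (T% (fun z ↦ a i • frame (E := E) p i z)) y := fun i ↦
    MDifferentiableAt.smul_section (mdifferentiableAt_const) (e1 i)
  have hd0 : MDiffAt (T% (fun z ↦ ∑ i, a i • frame (E := E) p i z)) y :=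
    mdiffAt_sum_field fun i _ ↦ hda i
  have hd : MDiffAt (T% (extend E (asTangent p w))) y :=
    hd0.congr_of_eventuallyEq (hW.mono fun z hz ↦ by simp [hz])
  refine ⟨hd, ?_, ?_⟩
  · rw [leviCivita_congr hd hW, hW.self_of_nhds,
      leviCivita_sum_apply _ (fun i _ ↦ hda i)]
    have e4 : ∀ j, leviCivita (fun z ↦ a j • frame (E := E) p j z) y (∑ i, a i • frame p i y)
        = ∑ i, (a i * a j) • leviCivita (frame (E := E) p j) y (frame p i y) := fun j ↦ by
      rw [leviCivita_const_smul_apply _ (e1 j), map_sum, Finset.smul_sum]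
      refine Finset.sum_congr rfl fun i _ ↦ ?_
      rw [map_smul, smul_smul, mul_comm]
    simp only [e4]
    rw [Finset.sum_comm]
    have e5 : ‖∑ i, ∑ j, (a i * a j) • leviCivita (frame (E := E) p j) y (frame p i y)‖
        ≤ ∑ i, ∑ j, (l * ‖w‖) * (l * ‖w‖) * |C₃ i j| := by
      refine (norm_sum_le _ _).trans (Finset.sum_le_sum fun i _ ↦
        (norm_sum_le _ _).trans (Finset.sum_le_sum fun j _ ↦ ?_))
      rw [norm_smul, norm_mul]
      have := hLw w i
      have := hLw w j
      have := (e3 i j).trans (le_abs_self _)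
      simp only [Real.norm_eq_abs]
      gcongr
    refine e5.trans ?_
    have e6 : ∑ i, ∑ j, (l * ‖w‖) * (l * ‖w‖) * |C₃ i j|
        = (∑ i, ∑ j, l * l * |C₃ i j|) * ‖w‖ ^ 2 := by
      simp only [Finset.sum_mul]
      refine Finset.sum_congr rfl fun i _ ↦ Finset.sum_congr rfl fun j _ ↦ by ring
    rw [e6]
    gcongr
    have : 0 ≤ ∑ i, l * |C₂ i| := by positivity
    linarith
  · rw [hW.self_of_nhds]
    have e5 : ‖∑ i, a i • frame (E := E) p i y‖ ≤ ∑ i, (l * ‖w‖) * |C₂ i| := by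
      refine (norm_sum_le _ _).trans (Finset.sum_le_sum fun i _ ↦ ?_)
      rw [norm_smul]
      have := (e2 i).trans (le_abs_self _)
      simp only [Real.norm_eq_abs]
      gcongr
      exact hLw w i
    refine e5.trans ?_
    have e6 : ∑ i, (l * ‖w‖) * |C₂ i| = (∑ i, l * |C₂ i|) * ‖w‖ := by
      simp only [Finset.sum_mul]
      refine Finset.sum_congr rfl fun i _ ↦ by ring
    rw [e6]
    gcongr
    have : 0 ≤ ∑ i, ∑ j, l * l * |C₃ i j| := by positivity
    linarith

end ChartMetric

section Barrier

variable {F : Type*} [NormedAddCommGroup F] [InnerProductSpace ℝ F] [FiniteDimensional ℝ F]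
  {N : Type*} [MetricSpace N] [ChartedSpace F N] [IsManifold 𝓘(ℝ, F) ∞ N]
  [RiemannianBundle (fun x : N ↦ TangentSpace 𝓘(ℝ, F) x)]
  [IsContMDiffRiemannianBundle 𝓘(ℝ, F) ∞ F (fun x : N ↦ TangentSpace 𝓘(ℝ, F) x)]
  [IsRiemannianManifold 𝓘(ℝ, F) N] {o : N} {γ : ℝ → N} {ℓ : ℝ}

theorem mdifferentiableAt_geodesic (hγ : IsMinimalGeodesic F γ o ℓ) {τ : ℝ} (hτ : τ ∈ Ioo 0 ℓ) :
    MDifferentiableAt 𝓘(ℝ, ℝ) 𝓘(ℝ, F) γ τ :=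
  (hγ.smooth.contMDiffAt (Icc_mem_nhds hτ.1 hτ.2)).mdifferentiableAt (by simp)

theorem mfderiv_geodesic (hγ : IsMinimalGeodesic F γ o ℓ)
    (hcut : ∀ t ∈ Ioc 0 ℓ, γ t ∈ distSmoothSet F o) {τ : ℝ} (hτ : τ ∈ Ioo 0 ℓ) :
    mfderiv 𝓘(ℝ, ℝ) 𝓘(ℝ, F) γ τ 1 = radial o (γ τ) := by
  rw [← velocity_eq_radial hγ (Ioo_subset_Ioc_self hτ) (hcut τ (Ioo_subset_Ioc_self hτ)), velocity,
    mfderivWithin_of_mem_nhds (Icc_mem_nhds hτ.1 hτ.2)]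

theorem norm_radial (hγ : IsMinimalGeodesic F γ o ℓ)
    (hcut : ∀ t ∈ Ioc 0 ℓ, γ t ∈ distSmoothSet F o) {τ : ℝ} (hτ : τ ∈ Ioc 0 ℓ) :
    ‖(radial o (γ τ) : TangentSpace 𝓘(ℝ, F) (γ τ))‖ = 1 := by
  refine norm_grad_dist_eq_one (fun h ↦ ?_) (hcut τ hτ)
  have := dist_geodesic hγ (Ioc_subset_Icc_self hτ)
  rw [h, dist_self] at this
  exact hτ.1.ne this

/-- The square of the distance from `o` is bounded below near `γ t`, to second order in the chart at
`o`, by a function with a Hessian that is uniformly positive definite in `t`. -/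
theorem exists_dist_sq_lower_bound (hγ : IsMinimalGeodesic F γ o ℓ) (hℓ : 0 < ℓ)
    (hcut : ∀ t ∈ Ioc 0 ℓ, γ t ∈ distSmoothSet F o) :
    ∃ κ > 0, ∃ t₀ > 0, t₀ ≤ ℓ ∧ ∀ t ∈ Ioo 0 t₀, γ t ∈ (chartAt F o).source ∧
      ∀ᶠ z in 𝓝 (extChartAt 𝓘(ℝ, F) o (γ t)),
        t ^ 2 + 2 * t * fderiv ℝ ((fun y ↦ dist o y) ∘ (extChartAt 𝓘(ℝ, F) o).symm)
            (extChartAt 𝓘(ℝ, F) o (γ t)) (z - extChartAt 𝓘(ℝ, F) o (γ t))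
          + κ * ‖z - extChartAt 𝓘(ℝ, F) o (γ t)‖ ^ 2
          ≤ dist o ((extChartAt 𝓘(ℝ, F) o).symm z) ^ 2 := by
  set φ := extChartAt 𝓘(ℝ, F) o with hφ
  set f : F → ℝ := (fun y ↦ dist o y) ∘ φ.symm with hf
  obtain ⟨r₀, hr₀, hsrc⟩ := Metric.eventually_nhds_iff_ball.1
    (eventually_mem_set.2 (chart_source_mem_nhds F o))
  have hsrcφ : ∀ {y}, y ∈ (chartAt F o).source → y ∈ φ.source := fun h ↦ by
    rwa [hφ, extChartAt_source]
  set a := min ℓ (r₀ / 2) with ha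
  have ha0 : 0 < a := by positivity
  have haℓ : a ≤ ℓ := min_le_left _ _
  have hγsrc : ∀ τ ∈ Icc 0 a, γ τ ∈ (chartAt F o).source := fun τ hτ ↦ by
    refine hsrc _ ?_
    rw [Metric.mem_ball, dist_comm, dist_geodesic hγ ⟨hτ.1, hτ.2.trans haℓ⟩]
    exact (hτ.2.trans (min_le_right _ _)).trans_lt (by linarith)
  set c : ℝ → F := fun τ ↦ φ (γ τ) with hc
  have hcC : ContDiffOn ℝ 2 c (Icc 0 a) := by
    have h1 : ContMDiffOn 𝓘(ℝ, ℝ) 𝓘(ℝ, F) ∞ c (Icc 0 a) :=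
      (contMDiffOn_extChartAt (I := 𝓘(ℝ, F)) (x := o)).comp
        (hγ.smooth.mono (Icc_subset_Icc_right haℓ)) hγsrc
    exact h1.contDiffOn.of_le (by norm_cast)
  have hIoo : ∀ τ ∈ Ioo 0 a, τ ∈ Ioo 0 ℓ := fun τ hτ ↦ ⟨hτ.1, hτ.2.trans_le haℓ⟩
  have hIoc : ∀ τ ∈ Ioo 0 a, τ ∈ Ioc 0 ℓ := fun τ hτ ↦ ⟨hτ.1, (hτ.2.trans_le haℓ).le⟩
  have hcd : ∀ τ ∈ Ioo 0 a, derivWithin c (Icc 0 a) τ = chartCoord o (γ τ) (radial o (γ τ)) := by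
    intro τ hτ
    rw [derivWithin_of_mem_nhds (Icc_mem_nhds hτ.1 hτ.2)]
    refine ((hasDerivAt_chart_comp (hγsrc τ (Ioo_subset_Icc_self hτ))
      (mdifferentiableAt_geodesic hγ (hIoo τ hτ))).deriv).trans ?_
    rw [mfderiv_geodesic hγ hcut (hIoo τ hτ)]
  have hsm : ∀ τ ∈ Ioo 0 a, ∀ᶠ z in 𝓝 (c τ), z ∈ φ.target ∧ φ.symm z ≠ o ∧
      φ.symm z ∈ distSmoothSet F o := by
    intro τ hτ
    have hx := hsrcφ (hγsrc τ (Ioo_subset_Icc_self hτ))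
    have h1 : Tendsto φ.symm (𝓝 (c τ)) (𝓝 (γ τ)) := by
      have := (continuousAt_extChartAt_symm'' (I := 𝓘(ℝ, F)) (φ.map_source hx)).tendsto
      rwa [φ.left_inv hx] at this
    have hne : γ τ ≠ o := fun h ↦ by
      have := dist_geodesic hγ (Ioc_subset_Icc_self (hIoc τ hτ))
      rw [h, dist_self] at this
      exact hτ.1.ne this
    have h2 : ∀ᶠ y in 𝓝 (γ τ), y ∈ distSmoothSet F o := eventually_eventually_nhds.2 (hcut τ (hIoc τ hτ))
    filter_upwards [(isOpen_extChartAt_target o).mem_nhds (φ.map_source hx),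
      h1.eventually (isOpen_ne.mem_nhds hne), h1.eventually h2] with z h3 h4 h5
    exact ⟨h3, h4, h5⟩
  have hmd : ∀ y ∈ distSmoothSet F o, MDifferentiableAt 𝓘(ℝ, F) 𝓘(ℝ, ℝ) (fun y ↦ dist o y) y := fun y hy ↦
    (Eventually.self_of_nhds hy).mdifferentiableAt (by simp)
  obtain ⟨κ₀, hκ₀, hell⟩ := exists_chartMetric_self_ge (E := F) o
  have hgradc : ∀ τ ∈ Ioo 0 a, ∀ v, fderiv ℝ f (c τ) v
      = chartMetric o (c τ) (chartCoord o (γ τ) (radial o (γ τ))) v := by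
    intro τ hτ v
    have hx := hγsrc τ (Ioo_subset_Icc_self hτ)
    have h1 := mvfderiv_extend hx (hmd _ (hcut τ (hIoc τ hτ))) (asTangent o v)
    refine h1.symm.trans ?_
    rw [chartMetric_chart hx, extend_chartCoord hx, ← inner_grad]
    rfl
  have hf2 : ∀ τ ∈ Ioo 0 a, ContDiffAt ℝ 2 f (c τ) := by
    intro τ hτ
    have hz := (hsm τ hτ).self_of_nhds
    have h1 : ContMDiffAt 𝓘(ℝ, F) 𝓘(ℝ, F) ∞ φ.symm (c τ) :=
      (contMDiffOn_extChartAt_symm o).contMDiffAt ((isOpen_extChartAt_target o).mem_nhds hz.1)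
    have h2 : ContMDiffAt 𝓘(ℝ, F) 𝓘(ℝ, ℝ) ∞ (fun y ↦ dist o y) (φ.symm (c τ)) := Eventually.self_of_nhds hz.2.2
    exact (ContMDiffAt.comp (c τ) h2 h1).contDiffAt.of_le (by norm_cast)
  have heik : ∀ τ ∈ Ioo 0 a, ∀ᶠ z in 𝓝 (c τ), ∀ v, (fderiv ℝ f z v) ^ 2 ≤ chartMetric o z v v := by
    intro τ hτ
    filter_upwards [hsm τ hτ] with z hz v
    rw [hf, fderiv_comp_chart hz.1 (hmd _ hz.2.2), chartMetric_self, sq_le_sq, abs_norm]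
    refine (abs_real_inner_le_norm _ _).trans ?_
    rw [norm_grad_dist_eq_one hz.2.1 hz.2.2, one_mul]
  have hgr : ∀ τ ∈ Ioo 0 a, fderiv ℝ f (c τ) = chartMetric o (c τ) (derivWithin c (Icc 0 a) τ) := by
    intro τ hτ
    ext v
    rw [hgradc τ hτ, hcd τ hτ]
  have hun : ∀ τ ∈ Ioo 0 a, chartMetric o (c τ) (derivWithin c (Icc 0 a) τ)
      (derivWithin c (Icc 0 a) τ) = 1 := by
    intro τ hτ
    rw [hcd τ hτ]
    refine (chartMetric_chartCoord (hγsrc τ (Ioo_subset_Icc_self hτ)) _).trans ?_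
    rw [norm_radial hγ hcut (hIoc τ hτ), one_pow]
  obtain ⟨κ, hκ, B, hB, t₀, ht₀, hta, hmain⟩ := exists_length_sq_lower_bound (G := chartMetric o)
    (f := f) (c := c) (z₀ := φ o) (a := a) ha0 (contDiffAt_chartMetric o)
    (fun z u v ↦ chartMetric_symm z u v) hκ₀ hell hcC (by rw [hc]; simp only [hγ.start])
    hf2 heik hgr hun
  -- nearly minimal curves to points near `γ t` stay in the neighbourhood `B`
  obtain ⟨r₁, hr₁, hball⟩ := Metric.eventually_nhds_iff_ball.1
    (((continuousAt_extChartAt (I := 𝓘(ℝ, F)) o).eventually_mem hB).and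
      (eventually_mem_set.2 (chart_source_mem_nhds F o)))
  refine ⟨κ, hκ, min t₀ r₁, by positivity, (min_le_left _ _).trans (hta.trans haℓ),
    fun t ht ↦ ?_⟩
  have htt₀ : t ∈ Ioo 0 t₀ := ⟨ht.1, ht.2.trans_le (min_le_left _ _)⟩
  have hta' : t ∈ Ioo 0 a := ⟨ht.1, htt₀.2.trans_le hta⟩
  have hx := hsrcφ (hγsrc t (Ioo_subset_Icc_self hta'))
  refine ⟨hγsrc t (Ioo_subset_Icc_self hta'), ?_⟩
  have h1 : Tendsto φ.symm (𝓝 (c t)) (𝓝 (γ t)) := by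
    have := (continuousAt_extChartAt_symm'' (I := 𝓘(ℝ, F)) (φ.map_source hx)).tendsto
    rwa [φ.left_inv hx] at this
  have h2 : ∀ᶠ y in 𝓝 (γ t), dist o y < r₁ := by
    refine (continuousAt_const.dist continuousAt_id).eventually_lt_const ?_
    rw [id, dist_geodesic hγ (Ioc_subset_Icc_self (hIoc t hta'))]
    exact ht.2.trans_le (min_le_right _ _)
  filter_upwards [h1.eventually h2, (isOpen_extChartAt_target o).mem_nhds (φ.map_source hx)]
    with z hz hzt
  set y := φ.symm z with hy
  have hφy : φ y = z := φ.right_inv hzt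
  have hlim : Tendsto (fun e ↦ (dist o y + 2 * e) ^ 2) (𝓝[>] 0) (𝓝 (dist o y ^ 2)) := by
    have : ContinuousAt (fun e : ℝ ↦ (dist o y + 2 * e) ^ 2) 0 := by fun_prop
    have h := this.tendsto
    simp only [mul_zero, add_zero] at h
    exact h.mono_left nhdsWithin_le_nhds
  refine ge_of_tendsto hlim ?_
  filter_upwards [Ioo_mem_nhdsGT (sub_pos.2 hz)] with e he
  obtain ⟨α, hα, hα0, hα1, hl⟩ := exists_nearly_minimal_curve (E := F) o y he.1
  have hcs := continuous_speed hα
  have hmem : ∀ s ∈ Icc (0 : ℝ) 1, α s ∈ Metric.ball o r₁ := by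
    intro s hs
    have h3 := dist_le_integral_speed hα hs.1
    have h4 := intervalIntegral.integral_add_adjacent_intervals
      (hcs.intervalIntegrable 0 s (μ := MeasureTheory.volume)) (hcs.intervalIntegrable s 1)
    have h5 : 0 ≤ ∫ u in s..1, speed (E := F) α u :=
      intervalIntegral.integral_nonneg hs.2 fun u _ ↦ norm_nonneg _
    rw [hα0] at h3
    rw [Metric.mem_ball, dist_comm]
    linarith [he.2]
  have key := hmain t htt₀ (fun s ↦ φ (α s))
    (fun s ↦ chartCoord o (α s) (mfderiv 𝓘(ℝ, ℝ) 𝓘(ℝ, F) α s 1)) (speed (E := F) α)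
    (fun s hs ↦ (hball _ (hmem s hs)).1)
    (fun s hs ↦ hasDerivAt_chart_comp (hball _ (hmem s hs)).2
      (hα.mdifferentiableAt one_ne_zero))
    (by rw [hα0]) hcs (fun s ↦ norm_nonneg _)
    (fun s hs ↦ chartMetric_chartCoord (hball _ (hmem s hs)).2 _) e he.1
  simp only [hα1, hφy] at key
  refine key.trans (pow_le_pow_left₀ ?_ (by linarith) 2)
  have : 0 ≤ ∫ s in (0 : ℝ)..1, speed (E := F) α s :=
    intervalIntegral.integral_nonneg zero_le_one fun u _ ↦ norm_nonneg _
  linarith [he.1]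

set_option maxHeartbeats 1000000 in
/-- For small `t`, the shape operator of the geodesic sphere of radius `t` is bounded below by a
positive multiple of `1 / t`. -/
theorem exists_shape_lower_bound (hγ : IsMinimalGeodesic F γ o ℓ) (hℓ : 0 < ℓ)
    (hcut : ∀ t ∈ Ioc 0 ℓ, γ t ∈ distSmoothSet F o) :
    ∃ κ > 0, ∃ t₀ > 0, t₀ ≤ ℓ ∧ ∀ t ∈ Ioo 0 t₀, ∀ u : TangentSpace 𝓘(ℝ, F) (γ t),
      ⟪radial o (γ t), u⟫_ℝ = 0 →
      κ / t * ‖u‖ ^ 2 ≤ ⟪leviCivita (radial o) (γ t) u, u⟫_ℝ := by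
  obtain ⟨κ, hκ, t₀, ht₀, htℓ, hmain⟩ := exists_dist_sq_lower_bound hγ hℓ hcut
  obtain ⟨K, hK, hchr⟩ := exists_christoffel_bound (E := F) o
  obtain ⟨r₁, hr₁, hball⟩ := Metric.eventually_nhds_iff_ball.1 hchr
  refine ⟨κ / (2 * (K ^ 2 + 1)), by positivity, min t₀ (min r₁ (κ / (2 * (K + 1)))),
    by positivity, (min_le_left _ _).trans htℓ, fun t ht u hu ↦ ?_⟩
  obtain ⟨htt₀, htr, htK⟩ : t < t₀ ∧ t < r₁ ∧ t < κ / (2 * (K + 1)) := by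
    have := ht.2
    simp only [lt_min_iff] at this
    exact ⟨this.1, this.2.1, this.2.2⟩
  have htI : t ∈ Ioc 0 ℓ := ⟨ht.1, (htt₀.trans_le htℓ).le⟩
  have hdist := dist_geodesic hγ (Ioc_subset_Icc_self htI)
  obtain ⟨hx, hev⟩ := hmain t ⟨ht.1, htt₀⟩
  set φ := extChartAt 𝓘(ℝ, F) o with hφ
  have hx' : γ t ∈ φ.source := by rwa [hφ, extChartAt_source]
  set w := chartCoord o (γ t) u with hw
  have hWu : extend F (asTangent o w) (γ t) = u := extend_chartCoord hx u
  obtain ⟨hWd, hWW, hWn⟩ := hball (γ t)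
    (by rw [Metric.mem_ball, dist_comm, hdist]; exact htr) w
  have hρ : ContMDiffAt 𝓘(ℝ, F) 𝓘(ℝ, ℝ) ∞ (fun y ↦ dist o y) (γ t) :=
    Eventually.self_of_nhds (hcut t htI)
  have hρ2 : ContMDiffAt 𝓘(ℝ, F) 𝓘(ℝ, ℝ) (2 : ℕ) (fun y ↦ dist o y) (γ t) :=
    hρ.of_le (by norm_cast)
  have hhess := fderiv_fderiv_chart_eq hx hρ2 w hWd
  rw [hWu] at hhess hWW hWn
  set f : F → ℝ := (fun y ↦ dist o y) ∘ φ.symm with hf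
  set ξ := φ (γ t) with hξ
  have hfC : ContDiffAt ℝ 2 f ξ := by
    have h4 : ContMDiffAt 𝓘(ℝ, F) 𝓘(ℝ, F) ∞ φ.symm ξ :=
      (contMDiffOn_extChartAt_symm o).contMDiffAt
        ((isOpen_extChartAt_target o).mem_nhds (φ.map_source hx'))
    have h5 : ContMDiffAt 𝓘(ℝ, F) 𝓘(ℝ, ℝ) ∞ (fun y ↦ dist o y) (φ.symm ξ) := by
      rwa [hξ, φ.left_inv hx']
    exact (ContMDiffAt.comp ξ h5 h4).contDiffAt.of_le (by norm_cast)
  have hdf : fderiv ℝ f ξ w = 0 := by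
    have := mvfderiv_extend hx (hρ.mdifferentiableAt (by simp)) (asTangent o w)
    rw [hWu, ← inner_grad] at this
    exact this.symm.trans hu
  have hline : ∀ s : ℝ, HasDerivAt (fun s : ℝ ↦ ξ + s • w) w s := fun s ↦ by
    simpa using ((hasDerivAt_id s).smul_const w).const_add ξ
  have hline0 : Tendsto (fun s : ℝ ↦ ξ + s • w) (𝓝 0) (𝓝 ξ) := by
    have := (hline 0).continuousAt.tendsto
    simpa using this
  have hg : ∀ᶠ s in 𝓝 (0 : ℝ), HasDerivAt (fun s ↦ f (ξ + s • w)) (fderiv ℝ f (ξ + s • w) w) s := by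
    have h1 : ∀ᶠ z in 𝓝 ξ, DifferentiableAt ℝ f z :=
      (hfC.eventually (by simp)).mono fun z hz ↦ hz.differentiableAt (by norm_num)
    filter_upwards [hline0.eventually h1] with s hs
    exact hs.hasFDerivAt.comp_hasDerivAt s (hline s)
  have hg' : HasDerivAt (fun s : ℝ ↦ fderiv ℝ f (ξ + s • w) w) (fderiv ℝ (fderiv ℝ f) ξ w w) 0 := by
    have h1 : DifferentiableAt ℝ (fderiv ℝ f) ξ :=
      (hfC.fderiv_right (m := 1) (by norm_num)).differentiableAt (by norm_num)
    have h2 : HasFDerivAt (fderiv ℝ f) (fderiv ℝ (fderiv ℝ f) ξ) (ξ + (0 : ℝ) • w) := by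
      simpa using h1.hasFDerivAt
    exact (hasDerivAt_clm_comp_apply h2 (hline 0)
      (hasDerivAt_const (0 : ℝ) w)).congr_deriv (by rw [map_zero, add_zero])
  have hD2 : κ * ‖w‖ ^ 2 / t ≤ fderiv ℝ (fderiv ℝ f) ξ w w := by
    refine le_second_deriv_of_sq_ge ht.1 hg hg' ?_ ?_ ?_
    · simp only [zero_smul, add_zero, hf, Function.comp_apply, hξ, φ.left_inv hx', hdist]
    · simpa using hdf
    · filter_upwards [hline0.eventually hev] with s hs
      simp only [add_sub_cancel_left, map_smul, hdf, smul_zero, mul_zero, add_zero, norm_smul,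
        mul_pow, Real.norm_eq_abs, sq_abs] at hs
      refine le_trans (le_of_eq ?_) hs
      ring
  have hXn := norm_radial hγ hcut htI
  have hlow : ⟪radial o (γ t), leviCivita (extend F (asTangent o w)) (γ t) u⟫_ℝ ≤ K * ‖w‖ ^ 2 := by
    refine (real_inner_le_norm _ _).trans ?_
    rw [hXn, one_mul]
    exact hWW
  have hfin : κ * ‖w‖ ^ 2 / t - K * ‖w‖ ^ 2 ≤ ⟪leviCivita (radial o) (γ t) u, u⟫_ℝ := by
    have h1 := hD2.trans_eq hhess
    have h2 : ⟪leviCivita (grad (fun y ↦ dist o y)) (γ t) u, u⟫_ℝ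
        = ⟪leviCivita (radial o) (γ t) u, u⟫_ℝ := rfl
    have h3 : ⟪grad (fun y ↦ dist o y) (γ t), leviCivita (extend F (asTangent o w)) (γ t) u⟫_ℝ
        = ⟪radial o (γ t), leviCivita (extend F (asTangent o w)) (γ t) u⟫_ℝ := rfl
    linarith
  refine le_trans ?_ hfin
  have h5 : K * t ≤ κ / 2 := by
    rw [lt_div_iff₀ (by positivity)] at htK
    nlinarith [ht.1]
  have h6 : ‖u‖ ^ 2 ≤ (K ^ 2 + 1) * ‖w‖ ^ 2 := by
    have := pow_le_pow_left₀ (norm_nonneg _) hWn 2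
    nlinarith [sq_nonneg ‖w‖]
  have h7 : κ / (2 * (K ^ 2 + 1)) / t * ‖u‖ ^ 2 ≤ κ / 2 / t * ‖w‖ ^ 2 := by
    calc κ / (2 * (K ^ 2 + 1)) / t * ‖u‖ ^ 2
        ≤ κ / (2 * (K ^ 2 + 1)) / t * ((K ^ 2 + 1) * ‖w‖ ^ 2) := by
          have := ht.1
          gcongr
      _ = κ / 2 / t * ‖w‖ ^ 2 := by field_simp
  have h8 : K * ‖w‖ ^ 2 ≤ κ / 2 / t * ‖w‖ ^ 2 := by
    gcongr
    rwa [le_div_iff₀ ht.1]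
  have h9 : κ * ‖w‖ ^ 2 / t = κ / 2 / t * ‖w‖ ^ 2 + κ / 2 / t * ‖w‖ ^ 2 := by
    field_simp; ring
  linarith

end Barrier

/-! ### The Riccati inequality along a radial geodesic -/

section RadialSetting

variable [IsRiemannianManifold 𝓘(ℝ, E) M] {p : M} {γ : ℝ → M} {ℓ δ c : ℝ} {η : M → ℝ}
  {T : Π x : M, TangentSpace 𝓘(ℝ, E) x →L[ℝ] TangentSpace 𝓘(ℝ, E) x} {t : ℝ}

/-- The assumptions of the comparison theorem: a minimal geodesic `γ` from `p` that avoids the cut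
locus of `p`, a weight `η`, and a symmetric positive definite divergence-free tensor field `T`
bounded above by `δ` which along `γ` is radially parallel with radial eigenvector `∂_r` and satisfies
the curvature bound. -/
structure RadialSetting (η : M → ℝ)
    (T : Π x : M, TangentSpace 𝓘(ℝ, E) x →L[ℝ] TangentSpace 𝓘(ℝ, E) x) (p : M) (γ : ℝ → M)
    (ℓ δ c : ℝ) : Prop where
  weight : CMDiff ∞ η
  diffEndo : ∀ x, DiffEndo T x
  symm : ∀ (x : M) (u v : TangentSpace 𝓘(ℝ, E) x), ⟪T x u, v⟫_ℝ = ⟪u, T x v⟫_ℝ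
  pos : ∀ (x : M) (v : TangentSpace 𝓘(ℝ, E) x), v ≠ 0 → 0 < ⟪T x v, v⟫_ℝ
  div : ∀ (x : M) (v : TangentSpace 𝓘(ℝ, E) x), divTensor T x v = 0
  le : ∀ (x : M) (v : TangentSpace 𝓘(ℝ, E) x), ⟪T x v, v⟫_ℝ ≤ δ * ‖v‖ ^ 2
  geodesic : IsMinimalGeodesic E γ p ℓ
  cut : ∀ t ∈ Ioc 0 ℓ, γ t ∈ distSmoothSet E p
  eig : ∀ t ∈ Ioc 0 ℓ, ∃ μ : ℝ, T (γ t) (radial p (γ t)) = μ • radial p (γ t)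
  par : ∀ t ∈ Ioc 0 ℓ, ∀ v, covTensor T (γ t) (radial p (γ t)) v = 0
  ricci : ∀ t ∈ Ioc 0 ℓ, ((Module.finrank ℝ E : ℝ) - 1) * c * δ
    ≤ ricciEtaT η T (γ t) (radial p (γ t)) (radial p (γ t))

theorem contMDiffAt_dist (hcut : ∀ t ∈ Ioc 0 ℓ, γ t ∈ distSmoothSet E p) (ht : t ∈ Ioc 0 ℓ) :
    CMDiffAt ∞ (fun y ↦ dist p y) (γ t) :=
  Eventually.self_of_nhds (hcut t ht)

theorem eventually_norm_grad_dist (hγ : IsMinimalGeodesic E γ p ℓ)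
    (hcut : ∀ t ∈ Ioc 0 ℓ, γ t ∈ distSmoothSet E p) (ht : t ∈ Ioc 0 ℓ) :
    ∀ᶠ y in 𝓝 (γ t), ‖grad (E := E) (fun y ↦ dist p y) y‖ = 1 := by
  have hne : γ t ≠ p := fun h ↦ by
    have := dist_geodesic hγ (Ioc_subset_Icc_self ht)
    rw [h, dist_self] at this
    exact ht.1.ne this
  have h2 : ∀ᶠ y in 𝓝 (γ t), y ∈ distSmoothSet E p := eventually_eventually_nhds.2 (hcut t ht)
  filter_upwards [isOpen_ne.mem_nhds hne, h2] with y h3 h4 using norm_grad_dist_eq_one h3 h4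

theorem hasDerivWithinAt_radial (hγ : IsMinimalGeodesic E γ p ℓ)
    (hcut : ∀ t ∈ Ioc 0 ℓ, γ t ∈ distSmoothSet E p) (ht : t ∈ Ioc 0 ℓ) {f : M → ℝ}
    (hf : MDiffAt f (γ t)) :
    HasDerivWithinAt (f ∘ γ) (mvfderiv 𝓘(ℝ, E) f (γ t) (grad (fun y ↦ dist p y) (γ t)))
      (Icc 0 ℓ) t := by
  have h := hasDerivWithinAt_comp_geodesic hγ (Ioc_subset_Icc_self ht) hf
  rwa [velocity_eq_radial hγ ht (hcut t ht)] at h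

namespace RadialSetting

theorem norm_eq (S : RadialSetting η T p γ ℓ δ c) (ht : t ∈ Ioc 0 ℓ) :
    ‖grad (E := E) (fun y ↦ dist p y) (γ t)‖ = 1 :=
  (eventually_norm_grad_dist S.geodesic S.cut ht).self_of_nhds

theorem isSymmetric_shape (S : RadialSetting η T p γ ℓ δ c) (ht : t ∈ Ioc 0 ℓ) :
    (shape E (fun y ↦ dist p y) (γ t)).IsSymmetric :=
  inner_leviCivita_grad_symm
    (eventually_contMDiffAt_infty (contMDiffAt_dist S.cut ht) 2).self_of_nhds

theorem shape_grad (S : RadialSetting η T p γ ℓ δ c) (ht : t ∈ Ioc 0 ℓ) :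
    shape E (fun y ↦ dist p y) (γ t) (grad (fun y ↦ dist p y) (γ t)) = 0 :=
  leviCivita_grad_self (eventually_contMDiffAt_infty (contMDiffAt_dist S.cut ht) 2).self_of_nhds
    (eventually_norm_grad_dist S.geodesic S.cut ht)

theorem nonneg (S : RadialSetting η T p γ ℓ δ c) (x : M) (v : TangentSpace 𝓘(ℝ, E) x) :
    0 ≤ ⟪T x v, v⟫_ℝ := by
  rcases eq_or_ne v 0 with rfl | hv
  · simp
  · exact (S.pos x v hv).le

theorem meanCurvature_eq (S : RadialSetting η T p γ ℓ δ c) (ht : t ∈ Ioc 0 ℓ) :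
    meanCurvature η T p (γ t) = traceMeanCurvature η T (fun y ↦ dist p y) (γ t) := by
  have h := sum_perp_eq_trace (S := (T (γ t)).toLinearMap ∘ₗ shape E (fun y ↦ dist p y) (γ t))
    (S.norm_eq ht) (by rw [LinearMap.comp_apply, S.shape_grad ht, map_zero])
  rw [traceMeanCurvature, ← h]
  rfl

theorem hasDerivWithinAt_traceMeanCurvature (S : RadialSetting η T p γ ℓ δ c) (ht : t ∈ Ioc 0 ℓ) :
    HasDerivWithinAt (traceMeanCurvature η T (fun y ↦ dist p y) ∘ γ)
      (-LinearMap.trace ℝ _ ((T (γ t)).toLinearMap ∘ₗ shape E (fun y ↦ dist p y) (γ t) ∘ₗ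
          shape E (fun y ↦ dist p y) (γ t))
        - ricciEtaT η T (γ t) (radial p (γ t)) (radial p (γ t))) (Icc 0 ℓ) t := by
  have hρ := contMDiffAt_dist S.cut ht
  have h := hasDerivWithinAt_radial S.geodesic S.cut ht
    (mdiffAt_traceMeanCurvature hρ (S.diffEndo _) (S.weight _))
  rwa [mvfderiv_traceMeanCurvature hρ (eventually_norm_grad_dist S.geodesic S.cut ht) (S.weight _)
    (S.diffEndo _) (S.par t ht) S.symm S.div] at h

theorem eq_of_deriv_eq_zero {F : ℝ → ℝ} (hF : ∀ t ∈ Ioc 0 ℓ, HasDerivWithinAt F 0 (Icc 0 ℓ) t)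
    {s : ℝ} (hs : s ∈ Ioc 0 ℓ) (ht : t ∈ Ioc 0 ℓ) : F s = F t := by
  have h1 := RiccatiInequality.antitoneOn_of_deriv (convex_Ioc 0 ℓ) Subset.rfl hF fun t _ ↦ le_rfl
  have h2 := RiccatiInequality.antitoneOn_of_deriv (F := -F) (F' := fun _ ↦ 0) (convex_Ioc 0 ℓ)
    Subset.rfl (fun t ht ↦ (hF t ht).neg.congr_deriv neg_zero) fun t _ ↦ le_rfl
  rcases le_total s t with h | h
  · exact le_antisymm (neg_le_neg_iff.1 (h2 hs ht h)) (h1 hs ht h)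
  · exact le_antisymm (h1 ht hs h) (neg_le_neg_iff.1 (h2 ht hs h))

/-- The radial eigenvalue of `T` is constant along the geodesic. -/
theorem exists_eigenvalue (S : RadialSetting η T p γ ℓ δ c) (hℓ : 0 < ℓ) :
    ∃ m : ℝ, 0 < m ∧ m ≤ δ ∧ ∀ t ∈ Ioc 0 ℓ, T (γ t) (grad (fun y ↦ dist p y) (γ t))
      = m • grad (fun y ↦ dist p y) (γ t) := by
  set ρ : M → ℝ := fun y ↦ dist p y with hρdef
  set f : M → ℝ := fun y ↦ ⟪T y (grad ρ y), grad ρ y⟫_ℝ with hf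
  have hd : ∀ t ∈ Ioc 0 ℓ, HasDerivWithinAt (f ∘ γ) 0 (Icc 0 ℓ) t := by
    intro t ht
    have hX : MDiffAt (T% (grad (E := E) ρ)) (γ t) :=
      contMDiffAt_zero_of_mdiff (k := 0) (contMDiffAt_grad_of_infty (contMDiffAt_dist S.cut ht) 1)
    have hTX := (S.diffEndo (γ t)).mdiffAt hX
    refine (hasDerivWithinAt_radial S.geodesic S.cut ht (mdiffAt_inner hTX hX)).congr_deriv ?_
    have h0 : leviCivita (grad ρ) (γ t) (grad ρ (γ t)) = 0 := S.shape_grad ht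
    have h1 : covTensor T (γ t) (grad ρ (γ t)) (grad ρ (γ t)) = 0 := S.par t ht _
    rw [leviCivita_metric hX hTX hX, (S.diffEndo (γ t)).leviCivita_apply hX, h1, h0, map_zero,
      add_zero, inner_zero_left, inner_zero_right, add_zero]
  have hev : ∀ t ∈ Ioc 0 ℓ, T (γ t) (grad ρ (γ t)) = f (γ t) • grad ρ (γ t) := by
    intro t ht
    obtain ⟨μ, hμ⟩ := S.eig t ht
    have h2 : T (γ t) (grad ρ (γ t)) = μ • grad ρ (γ t) := hμ
    have h3 : f (γ t) = μ := by
      simp only [hf]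
      rw [h2, real_inner_smul_left, real_inner_self_eq_norm_sq, S.norm_eq ht, one_pow, mul_one]
    rw [h3, h2]
  have hℓ' : ℓ ∈ Ioc 0 ℓ := right_mem_Ioc.2 hℓ
  refine ⟨f (γ ℓ), S.pos _ _ ?_, ?_, fun t ht ↦ ?_⟩
  · exact norm_ne_zero_iff.1 (by rw [S.norm_eq hℓ']; exact one_ne_zero)
  · have := S.le (γ ℓ) (grad ρ (γ ℓ))
    rwa [S.norm_eq hℓ', one_pow, mul_one] at this
  · rw [hev t ht]
    have := eq_of_deriv_eq_zero hd ht hℓ'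
    simp only [Function.comp_apply] at this
    rw [this]

theorem traceMeanCurvature_eq (S : RadialSetting η T p γ ℓ δ c) {m : ℝ}
    (hm : ∀ t ∈ Ioc 0 ℓ, T (γ t) (grad (fun y ↦ dist p y) (γ t))
      = m • grad (fun y ↦ dist p y) (γ t)) (ht : t ∈ Ioc 0 ℓ) :
    traceMeanCurvature η T (fun y ↦ dist p y) (γ t)
      = LinearMap.trace ℝ _ ((T (γ t)).toLinearMap ∘ₗ shape E (fun y ↦ dist p y) (γ t))
        - m * mvfderiv 𝓘(ℝ, E) η (γ t) (radial p (γ t)) := by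
  have h : ⟪T (γ t) (grad η (γ t)), grad (fun y ↦ dist p y) (γ t)⟫_ℝ
      = m * mvfderiv 𝓘(ℝ, E) η (γ t) (radial p (γ t)) := by
    rw [S.symm, hm t ht, real_inner_smul_right, inner_grad]
    rfl
  rw [traceMeanCurvature, h]

theorem riccatiInequality (S : RadialSetting η T p γ ℓ δ c) (hδ : 0 < δ)
    (hE : 1 ≤ Module.finrank ℝ E) {m : ℝ} (hm0 : 0 < m) (hmδ : m ≤ δ)
    (hm : ∀ t ∈ Ioc 0 ℓ, T (γ t) (grad (fun y ↦ dist p y) (γ t))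
      = m • grad (fun y ↦ dist p y) (γ t)) :
    RiccatiInequality ((Module.finrank ℝ E : ℝ) - 1) δ c m ℓ
      (traceMeanCurvature η T (fun y ↦ dist p y) ∘ γ)
      (fun t ↦ -LinearMap.trace ℝ _ ((T (γ t)).toLinearMap ∘ₗ shape E (fun y ↦ dist p y) (γ t) ∘ₗ
          shape E (fun y ↦ dist p y) (γ t))
        - ricciEtaT η T (γ t) (radial p (γ t)) (radial p (γ t)))
      (η ∘ γ) (fun t ↦ mvfderiv 𝓘(ℝ, E) η (γ t) (radial p (γ t))) where
  deriv_H t ht := S.hasDerivWithinAt_traceMeanCurvature ht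
  deriv_e t ht := hasDerivWithinAt_radial S.geodesic S.cut ht
    ((S.weight _).mdifferentiableAt (by simp))
  bdd_e := by
    have hc : ContinuousOn (η ∘ γ) (Icc 0 ℓ) :=
      S.weight.continuous.comp_continuousOn S.geodesic.smooth.continuousOn
    obtain ⟨C, hC⟩ := isCompact_Icc.exists_bound_of_continuousOn hc
    exact ⟨C, fun t ht ↦ hC t (Ioc_subset_Icc_self ht)⟩
  bdd_e' := by
    have hcont : Continuous (fun x ↦ ‖grad (E := E) η x‖) := continuous_iff_continuousAt.2 fun x ↦
      continuousAt_norm_field (contMDiffAt_grad_of_infty (S.weight x) 0)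
    obtain ⟨C, hC⟩ := isCompact_Icc.exists_bound_of_continuousOn (s := Icc 0 ℓ)
      (hcont.comp_continuousOn S.geodesic.smooth.continuousOn)
    refine ⟨C, fun t ht ↦ ?_⟩
    have h1 := hC t (Ioc_subset_Icc_self ht)
    rw [Function.comp_apply, norm_norm] at h1
    rw [← inner_grad]
    refine (abs_real_inner_le_norm _ _).trans ?_
    have h2 : ‖(radial p (γ t) : TangentSpace 𝓘(ℝ, E) (γ t))‖ = 1 := S.norm_eq ht
    rwa [h2, mul_one]
  le t ht s := by
    have h1 := two_mul_trace_sub_le (T := (T (γ t)).toLinearMap) (S.norm_eq ht)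
      (S.isSymmetric_shape ht) (S.shape_grad ht) (S.nonneg (γ t)) (S.le (γ t)) s
    have h2 := S.ricci t ht
    have h3 := S.traceMeanCurvature_eq hm ht
    have h4 : Module.finrank ℝ (TangentSpace 𝓘(ℝ, E) (γ t)) = Module.finrank ℝ E := rfl
    rw [h4] at h1
    simp only [Function.comp_apply]
    rw [h3]
    linarith
  N_nonneg := by
    have : (1 : ℝ) ≤ Module.finrank ℝ E := by exact_mod_cast hE
    linarith
  δ_nonneg := hδ.le
  m_nonneg := hm0.le
  m_le := hmδ

end RadialSetting

end RadialSetting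

/-! ### Traces of powers -/

section Powers

variable {V : Type*} [NormedAddCommGroup V] [InnerProductSpace ℝ V] [FiniteDimensional ℝ V]
  {B L : V →ₗ[ℝ] V} {X : V} {c b : ℝ}

theorem trace_eq_sum_of_eigenbasis {ι : Type*} [Fintype ι] (e : OrthonormalBasis ι ℝ V) {d : ι → ℝ}
    (h : ∀ i, B (e i) = d i • e i) : LinearMap.trace ℝ V B = ∑ i, d i := by
  rw [LinearMap.trace_eq_sum_inner _ e]
  refine Finset.sum_congr rfl fun i _ ↦ ?_
  rw [h, real_inner_smul_right, real_inner_self_eq_norm_sq, e.norm_eq_one]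
  ring

theorem exists_eigenbasis (hB : B.IsSymmetric) :
    ∃ (e : OrthonormalBasis (Fin (Module.finrank ℝ V)) ℝ V) (d : Fin (Module.finrank ℝ V) → ℝ),
      (∀ i, d i = ⟪B (e i), e i⟫_ℝ) ∧ LinearMap.trace ℝ V B = ∑ i, d i ∧
      LinearMap.trace ℝ V (B ∘ₗ B) = ∑ i, d i ^ 2 ∧
      LinearMap.trace ℝ V (B ∘ₗ B ∘ₗ B) = ∑ i, d i ^ 3 := by
  set e := hB.eigenvectorBasis rfl
  set d := hB.eigenvalues rfl
  have h : ∀ i, B (e i) = d i • e i := fun i ↦ hB.apply_eigenvectorBasis rfl i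
  refine ⟨e, d, fun i ↦ ?_, trace_eq_sum_of_eigenbasis e h,
    trace_eq_sum_of_eigenbasis e fun i ↦ ?_, trace_eq_sum_of_eigenbasis e fun i ↦ ?_⟩
  · rw [h, real_inner_smul_left, real_inner_self_eq_norm_sq, e.norm_eq_one]; ring
  · rw [LinearMap.comp_apply, h, map_smul, h, smul_smul, ← sq]
  · rw [LinearMap.comp_apply, LinearMap.comp_apply, h, map_smul, h, smul_smul, map_smul, h,
      smul_smul]
    ring_nf

/-- A lower bound `-b` for the eigenvalues bounds the sum of their cubes by that of their squares. -/
theorem trace_cube_ge (hB : B.IsSymmetric) (h : ∀ v, -b * ‖v‖ ^ 2 ≤ ⟪B v, v⟫_ℝ) :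
    -b * LinearMap.trace ℝ V (B ∘ₗ B) ≤ LinearMap.trace ℝ V (B ∘ₗ B ∘ₗ B) := by
  obtain ⟨e, d, hd, -, h2, h3⟩ := exists_eigenbasis hB
  rw [h2, h3, Finset.mul_sum]
  refine Finset.sum_le_sum fun i _ ↦ ?_
  have := h (e i)
  rw [e.norm_eq_one, ← hd] at this
  nlinarith [mul_nonneg (sq_nonneg (d i)) (show 0 ≤ d i + b by linarith)]

theorem trace_cube_ge_of_trace_sq_le (hB : B.IsSymmetric) (hb : 0 ≤ b)
    (h : LinearMap.trace ℝ V (B ∘ₗ B) ≤ b ^ 2) :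
    -b * LinearMap.trace ℝ V (B ∘ₗ B) ≤ LinearMap.trace ℝ V (B ∘ₗ B ∘ₗ B) := by
  obtain ⟨e, d, hd, -, h2, h3⟩ := exists_eigenbasis hB
  rw [h2] at h ⊢
  rw [h3, Finset.mul_sum]
  refine Finset.sum_le_sum fun i _ ↦ ?_
  have h4 : d i ^ 2 ≤ ∑ i, d i ^ 2 :=
    Finset.single_le_sum (f := fun i ↦ d i ^ 2) (fun i _ ↦ sq_nonneg _) (Finset.mem_univ i)
  have h5 := neg_le_of_abs_le (abs_le_of_sq_le_sq (h4.trans h) hb)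
  nlinarith [mul_nonneg (sq_nonneg (d i)) (show 0 ≤ d i + b by linarith)]

theorem trace_sq_le_of_nonneg (hB : B.IsSymmetric) (h : ∀ v, 0 ≤ ⟪B v, v⟫_ℝ) :
    0 ≤ LinearMap.trace ℝ V B ∧ LinearMap.trace ℝ V (B ∘ₗ B) ≤ LinearMap.trace ℝ V B ^ 2 := by
  obtain ⟨e, d, hd, h1, h2, -⟩ := exists_eigenbasis hB
  have h0 : ∀ i, 0 ≤ d i := fun i ↦ by rw [hd]; exact h _
  rw [h1, h2]
  exact ⟨Finset.sum_nonneg fun i _ ↦ h0 i, Finset.sum_sq_le_sq_sum_of_nonneg fun i _ ↦ h0 i⟩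

theorem trace_sq_nonneg (hB : B.IsSymmetric) : 0 ≤ LinearMap.trace ℝ V (B ∘ₗ B) := by
  obtain ⟨e, d, -, -, h2, -⟩ := exists_eigenbasis hB
  rw [h2]
  positivity

/-- A symmetric endomorphism with constant quadratic form on the unit vectors orthogonal to `X`,
and with `X` in its kernel. -/
theorem eq_smul_perpProj (hL : L.IsSymmetric) (hX : ‖X‖ = 1) (hLX : L X = 0)
    (h : ∀ u, ⟪u, X⟫_ℝ = 0 → ‖u‖ = 1 → ⟪L u, u⟫_ℝ = c) : L = c • perpProj X := by
  have hS : (L - c • perpProj X).IsSymmetric := isSymmetric_sub_smul hL c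
  refine sub_eq_zero.1 (hS.inner_map_self_eq_zero.1 fun v ↦ ?_)
  have h1 : ∀ u, ⟪u, X⟫_ℝ = 0 → ⟪L u, u⟫_ℝ = c * ‖u‖ ^ 2 := by
    intro u hu
    rcases eq_or_ne u 0 with rfl | hu0
    · simp
    have hn : ‖u‖ ≠ 0 := norm_ne_zero_iff.2 hu0
    have := h (‖u‖⁻¹ • u) (by rw [real_inner_smul_left, hu, mul_zero])
      (by rw [norm_smul, norm_inv, norm_norm, inv_mul_cancel₀ hn])
    rw [map_smul, real_inner_smul_left, real_inner_smul_right] at this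
    field_simp at this
    linarith
  have h2 := h1 _ (inner_perpProj_self hX v)
  have h3 : ⟪L (perpProj X v), perpProj X v⟫_ℝ = ⟪L v, v⟫_ℝ := by
    rw [← LinearMap.comp_apply, comp_perpProj hLX, ← inner_perpProj, ← LinearMap.comp_apply,
      perpProj_comp hL hLX]
  have h4 : ⟪perpProj X v, v⟫_ℝ = ‖perpProj X v‖ ^ 2 := by
    rw [← real_inner_self_eq_norm_sq, ← inner_perpProj, ← LinearMap.comp_apply,
      perpProj_comp_self hX]
  rw [LinearMap.sub_apply, LinearMap.smul_apply, inner_sub_left, real_inner_smul_left, h4, ← h2, h3,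
    sub_self]

/-- The third power of the deviation from an umbilical shape operator. -/
theorem trace_cube_sub {A : V →ₗ[ℝ] V} (hX : ‖X‖ = 1) (hAs : A.IsSymmetric) (hA : A X = 0) (s : ℝ) :
    LinearMap.trace ℝ V ((A - s • perpProj X) ∘ₗ (A - s • perpProj X) ∘ₗ (A - s • perpProj X))
      = LinearMap.trace ℝ V (A ∘ₗ A ∘ₗ A) - 3 * s * LinearMap.trace ℝ V (A ∘ₗ A)
        + 3 * s ^ 2 * LinearMap.trace ℝ V A - s ^ 3 * (Module.finrank ℝ V - 1) := by
  have h1 : perpProj X ∘ₗ A ∘ₗ A = A ∘ₗ A := by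
    rw [← LinearMap.comp_assoc, perpProj_comp hAs hA]
  rw [← trace_perpProj hX]
  simp only [LinearMap.comp_sub, LinearMap.sub_comp, LinearMap.comp_smul, LinearMap.smul_comp,
    comp_perpProj hA, perpProj_comp hAs hA, h1, perpProj_comp_self hX, map_sub, map_smul, smul_eq_mul]
  ring

end Powers

/-! ### The Riccati equation with constant curvature -/

section ConstantCurvature

/-- A nonnegative function on `(0, r]` that satisfies `w' ≤ 2 b w` with `b = (1 - k) / t` near `0` and
with `b` locally bounded elsewhere, and that is `O(t²)` at `0`, vanishes. -/
theorem eq_zero_of_deriv_le {w w' : ℝ → ℝ} {r t₁ k C : ℝ} (hk : 0 < k) (ht₁ : 0 < t₁) (ht₁r : t₁ ≤ r)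
    (hw : ∀ t ∈ Ioc 0 r, HasDerivWithinAt w (w' t) (Icc 0 r) t) (hw0 : ∀ t ∈ Ioc 0 r, 0 ≤ w t)
    (hnear : ∀ t ∈ Ioc 0 t₁, w' t ≤ 2 * ((1 - k) / t) * w t)
    (hC : ∀ t ∈ Ioc 0 t₁, w t ≤ C * t ^ 2)
    (hfar : ∃ K, ∀ t ∈ Icc t₁ r, w' t ≤ K * w t) {t : ℝ} (ht : t ∈ Ioc 0 r) : w t = 0 := by
  have hr : 0 < r := ht.1.trans_le ht.2
  have hsub : Ioc 0 t₁ ⊆ Ioc 0 r := Ioc_subset_Ioc_right ht₁r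
  set p := -(2 - 2 * k) with hp
  have hsmall : ∀ t ∈ Ioc 0 t₁, w t = 0 := by
    intro t ht
    have hanti : AntitoneOn (fun t ↦ w t * t ^ p) (Ioc 0 t₁) := by
      refine RiccatiInequality.antitoneOn_of_deriv (ℓ := r)
        (F' := fun t ↦ w' t * t ^ p + w t * (p * t ^ (p - 1))) (convex_Ioc 0 t₁) hsub
        (fun s hs ↦ (hw s (hsub hs)).mul
          (Real.hasDerivAt_rpow_const (Or.inl hs.1.ne')).hasDerivWithinAt) fun s hs ↦ ?_
      have h1 := mul_le_mul_of_nonneg_right (hnear s hs) (Real.rpow_nonneg hs.1.le p)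
      rw [Real.rpow_sub_one hs.1.ne']
      have h2 : 2 * ((1 - k) / s) * w s * s ^ p + w s * (p * (s ^ p / s)) = 0 := by
        rw [hp]; ring
      linarith
    have hlim : Tendsto (fun t : ℝ ↦ C * t ^ (2 * k)) (𝓝[>] 0) (𝓝 0) := by
      have h1 : ContinuousAt (fun t : ℝ ↦ C * t ^ (2 * k)) 0 :=
        continuousAt_const.mul (Real.continuousAt_rpow_const 0 _ (Or.inr (by positivity)))
      have h2 := h1.tendsto
      rw [Real.zero_rpow (by positivity), mul_zero] at h2
      exact h2.mono_left nhdsWithin_le_nhds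
    have h3 := RiccatiInequality.nonpos_of_antitoneOn hanti hlim (fun s hs ↦ ?_) ht
    · have h4 : 0 < t ^ p := Real.rpow_pos_of_pos ht.1 p
      by_contra hne
      have h5 : 0 < w t := lt_of_le_of_ne (hw0 t (hsub ht)) (Ne.symm hne)
      exact absurd h3 (not_le.2 (mul_pos h5 h4))
    · have h4 := mul_le_mul_of_nonneg_right (hC s hs) (Real.rpow_nonneg hs.1.le p)
      refine h4.trans (le_of_eq ?_)
      rw [mul_assoc, ← Real.rpow_natCast s 2, ← Real.rpow_add hs.1]
      congr 2
      rw [hp]; push_cast; ring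
  rcases le_total t t₁ with h | h
  · exact hsmall t ⟨ht.1, h⟩
  obtain ⟨K, hK⟩ := hfar
  have hsub2 : Icc t₁ r ⊆ Ioc 0 r := fun s hs ↦ ⟨ht₁.trans_le hs.1, hs.2⟩
  have hanti : AntitoneOn (fun t ↦ w t * Real.exp (-K * t)) (Icc t₁ r) := by
    refine RiccatiInequality.antitoneOn_of_deriv (ℓ := r)
      (F' := fun t ↦ w' t * Real.exp (-K * t) + w t * (Real.exp (-K * t) * (-K))) (convex_Icc t₁ r)
      hsub2 (fun s hs ↦ (hw s (hsub2 hs)).mul ?_) fun s hs ↦ ?_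
    · have := ((hasDerivAt_id s).const_mul (-K)).exp
      simp only [id, mul_one] at this
      exact this.hasDerivWithinAt
    · have h1 := mul_le_mul_of_nonneg_right (hK s hs) (Real.exp_pos (-K * s)).le
      linarith
  have h1 := hanti (left_mem_Icc.2 ht₁r) ⟨h, ht.2⟩ h
  simp only [hsmall t₁ (right_mem_Ioc.2 ht₁), zero_mul] at h1
  have h2 := Real.exp_pos (-K * t)
  by_contra hne
  have h5 : 0 < w t := lt_of_le_of_ne (hw0 t ht) (Ne.symm hne)
  exact absurd h1 (not_le.2 (mul_pos h5 h2))

end ConstantCurvature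

/-! ### Symmetry of the radial curvature -/

section RadialCurvature

variable {x : M} {ρ : M → ℝ}
  {S : Π x : M, TangentSpace 𝓘(ℝ, E) x →L[ℝ] TangentSpace 𝓘(ℝ, E) x}

theorem inner_covTensor_symm (hS : DiffEndo S x)
    (hs : ∀ᶠ y in 𝓝 x, ∀ u v : TangentSpace 𝓘(ℝ, E) y, ⟪S y u, v⟫_ℝ = ⟪u, S y v⟫_ℝ)
    (u v w : TangentSpace 𝓘(ℝ, E) x) :
    ⟪covTensor S x u v, w⟫_ℝ = ⟪v, covTensor S x u w⟫_ℝ := by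
  have hu := mdiffAt_extend (E := E) u
  have hv := mdiffAt_extend (E := E) v
  have hw := mdiffAt_extend (E := E) w
  have h1 := leviCivita_metric hu (hS.mdiffAt hv) hw
  have h2 := leviCivita_metric hu hv (hS.mdiffAt hw)
  have h3 : mvfderiv 𝓘(ℝ, E) (fun y ↦ ⟪S y (extend E v y), extend E w y⟫_ℝ) x
      = mvfderiv 𝓘(ℝ, E) (fun y ↦ ⟪extend E v y, S y (extend E w y)⟫_ℝ) x :=
    mvfderiv_congr (hs.mono fun y hy ↦ hy _ _)
  rw [h3, h2, hS.leviCivita_apply hv, hS.leviCivita_apply hw] at h1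
  simp only [extend_apply_self, inner_add_left, inner_add_right] at h1
  have hx := hs.self_of_nhds
  rw [hx, hx] at h1
  linarith

theorem isSymmetric_radialCurvature (hρ : CMDiffAt ∞ ρ x) :
    (radialCurvature (E := E) ρ x (diffEndo_shape hρ)).IsSymmetric := by
  have h2 := eventually_contMDiffAt_infty (E := E) hρ 2
  have hA := h2.mono fun y hy ↦ inner_leviCivita_grad_symm hy
  intro u v
  have h3 := inner_covTensor_symm (diffEndo_shape hρ) hA (grad ρ x) u v
  have h4 := hA.self_of_nhds
  simp only [radialCurvature, LinearMap.sub_apply, LinearMap.neg_apply, covTensorMap_apply,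
    LinearMap.comp_apply, ContinuousLinearMap.coe_coe, inner_sub_left, inner_sub_right,
    inner_neg_left, inner_neg_right, h4, h3]

theorem radialCurvature_eq_smul (hρ : CMDiffAt ∞ ρ x)
    (h1 : ∀ᶠ y in 𝓝 x, ‖grad (E := E) ρ y‖ = 1) {c : ℝ}
    (h : ∀ u : TangentSpace 𝓘(ℝ, E) x, ⟪u, grad ρ x⟫_ℝ = 0 → ‖u‖ = 1 →
      ⟪curvature x (grad ρ x) u (grad ρ x), u⟫_ℝ = c) :
    radialCurvature (E := E) ρ x (diffEndo_shape hρ) = c • perpProj (grad ρ x) := by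
  refine eq_smul_perpProj (isSymmetric_radialCurvature hρ) h1.self_of_nhds ?_ fun u hu hu1 ↦ ?_
  · rw [radialCurvature_apply hρ h1, curvature_eq_secondCov (contMDiffAt_grad_of_infty hρ 2),
      sub_self]
  · rw [radialCurvature_apply hρ h1]
    exact h u hu hu1

end RadialCurvature

/-! ### Rigidity in the case of equality -/

section Rigidity

variable [IsRiemannianManifold 𝓘(ℝ, E) M] {p : M} {γ : ℝ → M} {ℓ δ c a r t : ℝ} {η : M → ℝ}
  {T : Π x : M, TangentSpace 𝓘(ℝ, E) x →L[ℝ] TangentSpace 𝓘(ℝ, E) x}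

namespace RadialSetting

/-- Equality at `r` forces the shape operator to be umbilical on `(0, r]`. -/
theorem umbilical_of_eq (S : RadialSetting η T p γ ℓ δ c) (hδ : 0 < δ)
    (hE : 1 ≤ Module.finrank ℝ E) {m : ℝ} (hm0 : 0 < m) (hmδ : m ≤ δ)
    (hm : ∀ t ∈ Ioc 0 ℓ, T (γ t) (grad (fun y ↦ dist p y) (γ t))
      = m • grad (fun y ↦ dist p y) (γ t)) (ha : 0 ≤ a)
    (he : ∀ t ∈ Ioc 0 ℓ, -a ≤ mvfderiv 𝓘(ℝ, E) η (γ t) (radial p (γ t))) (hr : r ∈ Ioc 0 ℓ)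
    (hsn : ∀ t ∈ Ioc 0 r, 0 < sn c t) (hcs : ∀ t ∈ Ioo 0 r, 0 < cs c t) (hcsr : 0 ≤ cs c r)
    (hc : c ≤ 0 → 0 < cs c r)
    (heq : traceMeanCurvature η T (fun y ↦ dist p y) (γ r)
      = ((Module.finrank ℝ E : ℝ) - 1) * δ * (cs c r / sn c r) + δ * a) :
    (a ≠ 0 → m = δ) ∧ ∀ t ∈ Ioc 0 r,
      shape E (fun y ↦ dist p y) (γ t)
        = (cs c t / sn c t) • perpProj (grad (fun y ↦ dist p y) (γ t)) ∧
      mvfderiv 𝓘(ℝ, E) η (γ t) (radial p (γ t)) = -a ∧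
      (c ≤ 0 → ∀ u : TangentSpace 𝓘(ℝ, E) (γ t), ⟪u, radial p (γ t)⟫_ℝ = 0 →
        T (γ t) u = δ • u) := by
  have hRic := S.riccatiInequality hδ hE hm0 hmδ hm
  have hcs' : ∀ t ∈ Ioc 0 r, 0 ≤ cs c t := fun t ht ↦ by
    rcases ht.2.lt_or_eq with h | h
    · exact (hcs t ⟨ht.1, h⟩).le
    · rw [h]; exact hcsr
  have hsub : Ioc 0 r ⊆ Ioc 0 ℓ := Ioc_subset_Ioc_right hr.2
  have hH := hRic.eq_of_eq hr ha he hsn hcs' heq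
  have hH' := hRic.deriv_eq_of_eq hr ha he hsn hcs' heq
  have key : ∀ t ∈ Ioc 0 r,
      shape E (fun y ↦ dist p y) (γ t)
        = (cs c t / sn c t) • perpProj (grad (fun y ↦ dist p y) (γ t)) ∧
      (0 < cs c t → (mvfderiv 𝓘(ℝ, E) η (γ t) (radial p (γ t)) = -a ∧ (δ - m) * a = 0 ∧
        ∀ u : TangentSpace 𝓘(ℝ, E) (γ t), ⟪u, radial p (γ t)⟫_ℝ = 0 → T (γ t) u = δ • u)) := by
    intro t ht
    set A := shape E (fun y ↦ dist p y) (γ t)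
    set ψ := cs c t / sn c t with hψ
    have hψ0 : 0 ≤ ψ := div_nonneg (hcs' t ht) (hsn t ht).le
    have hfr : Module.finrank ℝ (TangentSpace 𝓘(ℝ, E) (γ t)) = Module.finrank ℝ E := rfl
    have h1 := two_mul_trace_sub_le (T := (T (γ t)).toLinearMap) (S.norm_eq (hsub ht))
      (S.isSymmetric_shape (hsub ht)) (S.shape_grad (hsub ht)) (S.nonneg (γ t)) (S.le (γ t)) ψ
    have h2 := S.ricci t (hsub ht)
    have h3 := S.traceMeanCurvature_eq hm (hsub ht)
    have h4 := hH t ht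
    have h5 := hH' t ht
    have h6 := he t (hsub ht)
    rw [hfr] at h1
    simp only [Function.comp_apply] at h4 h5
    rw [h3] at h4
    rw [← hψ] at h4 h5
    set q := LinearMap.trace ℝ _ ((T (γ t)).toLinearMap ∘ₗ A ∘ₗ A)
    set h := LinearMap.trace ℝ _ ((T (γ t)).toLinearMap ∘ₗ A)
    set e := mvfderiv 𝓘(ℝ, E) η (γ t) (radial p (γ t))
    set N := (Module.finrank ℝ E : ℝ) - 1
    have h7 : q ≤ N * δ * ψ ^ 2 := by nlinarith
    have h8 : 0 ≤ (δ - m) * a := mul_nonneg (sub_nonneg.2 hmδ) ha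
    have h9 : 0 ≤ m * (a + e) := mul_nonneg hm0.le (by linarith)
    have h10 : h = N * δ * ψ + ((δ - m) * a + m * (a + e)) := by linarith
    have h11 : ψ * ((δ - m) * a + m * (a + e)) ≤ 0 := by
      rw [h10] at h1
      linarith
    have h12 : q ≤ 2 * ψ * h - ψ ^ 2 * (N * δ) := by
      have := mul_nonneg hψ0 (add_nonneg h8 h9)
      rw [h10]
      linarith
    obtain ⟨hA, hTu⟩ := umbilical_of_trace_eq (T := (T (γ t)).toLinearMap) (S.norm_eq (hsub ht))
      (S.isSymmetric_shape (hsub ht)) (S.shape_grad (hsub ht)) (S.symm (γ t)) (S.pos (γ t))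
      (S.le (γ t)) h12
    refine ⟨hA, fun hpos ↦ ?_⟩
    have hψp : 0 < ψ := div_pos hpos (hsn t ht)
    have h13 : (δ - m) * a + m * (a + e) ≤ 0 := nonpos_of_mul_nonpos_right h11 hψp
    have h14 : m * (a + e) = 0 := by linarith
    refine ⟨?_, by linarith, hTu hψp.ne'⟩
    have := (mul_eq_zero.1 h14).resolve_left hm0.ne'
    linarith
  have hdr : ∀ t ∈ Ioo 0 r, mvfderiv 𝓘(ℝ, E) η (γ t) (radial p (γ t)) = -a := fun t ht ↦
    ((key t ⟨ht.1, ht.2.le⟩).2 (hcs t ht)).1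
  refine ⟨fun ha0 ↦ ?_, fun t ht ↦ ⟨(key t ht).1, ?_, fun hc0 ↦ ?_⟩⟩
  · have hmid : r / 2 ∈ Ioo 0 r := ⟨half_pos hr.1, half_lt_self hr.1⟩
    have h1 := ((key _ ⟨hmid.1, hmid.2.le⟩).2 (hcs _ hmid)).2.1
    have := (mul_eq_zero.1 h1).resolve_right ha0
    linarith
  · rcases ht.2.lt_or_eq with h | rfl
    · exact hdr t ⟨ht.1, h⟩
    -- at the endpoint `sn c'` may vanish, and the value follows by continuity
    set f : M → ℝ := fun y ↦ ⟪grad (E := E) η y, grad (E := E) (fun y ↦ dist p y) y⟫_ℝ with hf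
    have hf' : ∀ y, f y = mvfderiv 𝓘(ℝ, E) η y (radial p y) := fun y ↦ inner_grad _ _ _
    have hd : MDiffAt f (γ t) := mdiffAt_inner
      (contMDiffAt_zero_of_mdiff (k := 0) (contMDiffAt_grad_of_infty (S.weight _) 1))
      (contMDiffAt_zero_of_mdiff (k := 0)
        (contMDiffAt_grad_of_infty (contMDiffAt_dist S.cut hr) 1))
    have hcont := (hasDerivWithinAt_radial S.geodesic S.cut hr hd).continuousWithinAt
    have h1 : Tendsto (f ∘ γ) (𝓝[Ioo 0 t] t) (𝓝 ((f ∘ γ) t)) :=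
      hcont.mono (Ioo_subset_Icc_self.trans (Icc_subset_Icc_right hr.2))
    have h2 : Tendsto (f ∘ γ) (𝓝[Ioo 0 t] t) (𝓝 (-a)) := by
      refine tendsto_const_nhds.congr' ?_
      filter_upwards [self_mem_nhdsWithin] with s hs
      rw [Function.comp_apply, hf', hdr s hs]
    have : (𝓝[Ioo 0 t] t).NeBot := right_nhdsWithin_Ioo_neBot hr.1
    rw [← hf']
    exact tendsto_nhds_unique h1 h2
  · rcases ht.2.lt_or_eq with h | rfl
    · exact ((key t ht).2 (hcs t ⟨ht.1, h⟩)).2.2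
    · exact ((key t ht).2 (hc hc0)).2.2

/-- If the shape operators are umbilical with the factor of the model space, the radial sectional
curvatures are equal to `c`. -/
theorem curvature_of_umbilical (S : RadialSetting η T p γ ℓ δ c) (hr : r ∈ Ioc 0 ℓ)
    (hsn : ∀ t ∈ Ioc 0 r, 0 < sn c t)
    (hA : ∀ t ∈ Ioc 0 r, shape E (fun y ↦ dist p y) (γ t)
      = (cs c t / sn c t) • perpProj (grad (fun y ↦ dist p y) (γ t))) (ht : t ∈ Ioc 0 r)
    {u : TangentSpace 𝓘(ℝ, E) (γ t)} (hu : ⟪u, radial p (γ t)⟫_ℝ = 0) (hu1 : ‖u‖ = 1) :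
    ⟪curvature (γ t) (radial p (γ t)) u (radial p (γ t)), u⟫_ℝ = c := by
  set ρ : M → ℝ := fun y ↦ dist p y with hρdef
  have hsub : Ioc 0 r ⊆ Ioc 0 ℓ := Ioc_subset_Ioc_right hr.2
  have hρ : CMDiffAt ∞ ρ (γ t) := contMDiffAt_dist S.cut (hsub ht)
  have h1 : ∀ᶠ y in 𝓝 (γ t), ‖grad (E := E) ρ y‖ = 1 :=
    eventually_norm_grad_dist S.geodesic S.cut (hsub ht)
  have hu' : ⟪u, grad (E := E) ρ (γ t)⟫_ℝ = 0 := hu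
  have hV := mdiffAt_extend (E := E) u
  have hX : MDiffAt (T% (grad (E := E) ρ)) (γ t) :=
    contMDiffAt_zero_of_mdiff (k := 0) (contMDiffAt_grad_of_infty hρ 1)
  have hS := diffEndo_shape (E := E) hρ
  have d1 := hasDerivWithinAt_radial S.geodesic S.cut (hsub ht)
    (mdiffAt_inner (hS.mdiffAt hV) hV)
  have d2 := hasDerivWithinAt_radial S.geodesic S.cut (hsub ht) (mdiffAt_inner hV hV)
  have d3 := hasDerivWithinAt_radial S.geodesic S.cut (hsub ht) (mdiffAt_inner hV hX)
  rw [leviCivita_metric hX (hS.mdiffAt hV) hV, hS.leviCivita_apply hV] at d1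
  rw [leviCivita_metric hX hV hV] at d2
  rw [leviCivita_metric hX hV hX] at d3
  have hAX : leviCivita (grad (E := E) ρ) (γ t) (grad ρ (γ t)) = 0 := S.shape_grad (hsub ht)
  have d4 := ((hasDerivAt_cs_div_sn (hsn t ht).ne').hasDerivWithinAt (s := Icc 0 ℓ)).mul
    (d2.sub (d3.pow 2))
  have hss : Ioc 0 r ⊆ Icc 0 ℓ := hsub.trans Ioc_subset_Icc_self
  have hEq : EqOn ((fun y ↦ ⟪leviCivita (grad (E := E) ρ) y (extend E u y), extend E u y⟫_ℝ) ∘ γ)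
      ((fun t ↦ cs c t / sn c t) * ((fun y ↦ ⟪extend E u y, extend E u y⟫_ℝ) ∘ γ
        - ((fun y ↦ ⟪extend E u y, grad (E := E) ρ y⟫_ℝ) ∘ γ) ^ 2)) (Ioc 0 r) := by
    intro s hs
    have h2 := LinearMap.congr_fun (hA s hs) (extend E u (γ s))
    have h3 : leviCivita (grad (E := E) ρ) (γ s) (extend E u (γ s))
      = (cs c s / sn c s) • perpProj (grad (E := E) ρ (γ s)) (extend E u (γ s)) := h2
    simp only [Function.comp_apply, Pi.mul_apply, Pi.sub_apply, Pi.pow_apply]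
    rw [h3, real_inner_smul_left, perpProj_apply, inner_sub_left, real_inner_smul_left,
      real_inner_comm (extend E u (γ s)) (grad ρ (γ s))]
    ring
  have h2 := ((uniqueDiffOn_Ioc 0 r) t ht).eq_deriv _ ((d1.mono hss).congr
    (fun s hs ↦ (hEq hs).symm) (hEq ht).symm) (d4.mono hss)
  have h3 : leviCivita (grad (E := E) ρ) (γ t) u = (cs c t / sn c t) • u := by
    have h4 := LinearMap.congr_fun (hA t ht) u
    rw [LinearMap.smul_apply, perpProj_of_inner_eq_zero hu'] at h4
    exact h4
  have h4 := S.isSymmetric_shape (hsub ht) (leviCivita (extend E u) (γ t) (grad ρ (γ t))) u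
  have h5 : ⟪leviCivita (grad (E := E) ρ) (γ t) (leviCivita (extend E u) (γ t) (grad ρ (γ t))), u⟫_ℝ
    = (cs c t / sn c t) * ⟪leviCivita (extend E u) (γ t) (grad ρ (γ t)), u⟫_ℝ := by
    refine h4.trans ?_
    rw [← real_inner_smul_right, ← h3]
    rfl
  have huu : ⟪u, u⟫_ℝ = 1 := by rw [real_inner_self_eq_norm_sq, hu1, one_pow]
  simp only [Function.comp_apply, extend_apply_self, hAX, inner_add_left, h5, h3,
    real_inner_smul_left, inner_zero_right, hu', huu, Pi.sub_apply, Pi.pow_apply] at h2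
  rw [real_inner_comm _ u] at h2
  have h6 := covTensor_grad_riccati hρ h1 u
  have h7 : ⟪covTensor (fun y ↦ leviCivita (grad (E := E) ρ) y) (γ t) (grad ρ (γ t)) u, u⟫_ℝ
      = -(cs c t / sn c t) ^ 2 - ⟪curvature (γ t) (grad ρ (γ t)) u (grad ρ (γ t)), u⟫_ℝ := by
    rw [h6, h3, map_smul, h3, inner_sub_left, inner_neg_left, real_inner_smul_left,
      real_inner_smul_left, huu]
    ring
  rw [h7] at h2
  change ⟪curvature (γ t) (grad ρ (γ t)) u (grad ρ (γ t)), u⟫_ℝ = c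
  linarith

end RadialSetting

end Rigidity

/-! ### Constant radial curvature forces umbilical spheres -/

section UmbilicalSpheres

/-- The trace of the square of the deviation of the shape operator from its value in the model
space, multiplied by `sn c ^ 4` and expanded. The arguments `τ₁` and `τ₂` are the traces of the shape
operator and of its square. -/
def deviationFun (N c : ℝ) (τ₁ τ₂ : ℝ → ℝ) (t : ℝ) : ℝ :=
  sn c t ^ 4 * τ₂ t - 2 * (sn c t ^ 3 * cs c t) * τ₁ t + N * (sn c t ^ 2 * cs c t ^ 2)

theorem hasDerivWithinAt_deviationFun {N c t : ℝ} {τ₁ τ₂ : ℝ → ℝ} {τ₃ : ℝ} {s : Set ℝ}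
    (h1 : HasDerivWithinAt τ₁ (-τ₂ t - c * N) s t)
    (h2 : HasDerivWithinAt τ₂ (-2 * τ₃ - 2 * (c * τ₁ t)) s t) (hsn : sn c t ≠ 0) :
    HasDerivWithinAt (deviationFun N c τ₁ τ₂)
      (-2 * sn c t ^ 4 * (τ₃ - 3 * (cs c t / sn c t) * τ₂ t + 3 * (cs c t / sn c t) ^ 2 * τ₁ t
        - (cs c t / sn c t) ^ 3 * N)) s t := by
  have d1 := (hasDerivAt_sn c t).hasDerivWithinAt (s := s)
  have d2 := (hasDerivAt_cs c t).hasDerivWithinAt (s := s)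
  have h := (((d1.pow 4).mul h2).sub ((((d1.pow 3).mul d2).const_mul 2).mul h1)).add
    (((d1.pow 2).mul (d2.pow 2)).const_mul N)
  refine h.congr_deriv ?_
  simp only [Pi.mul_apply, Pi.pow_apply]
  field_simp
  ring

variable [IsRiemannianManifold 𝓘(ℝ, E) M] {p : M} {γ : ℝ → M} {ℓ δ c a r t : ℝ} {η : M → ℝ}
  {T : Π x : M, TangentSpace 𝓘(ℝ, E) x →L[ℝ] TangentSpace 𝓘(ℝ, E) x}

namespace RadialSetting

theorem deviationFun_eq (S : RadialSetting η T p γ ℓ δ c) (ht : t ∈ Ioc 0 ℓ) (hsn : 0 < sn c t) :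
    deviationFun ((Module.finrank ℝ E : ℝ) - 1) c
      ((fun y ↦ LinearMap.trace ℝ _ (shape E (fun y ↦ dist p y) y)) ∘ γ)
      ((fun y ↦ LinearMap.trace ℝ _ (shape E (fun y ↦ dist p y) y ∘ₗ shape E (fun y ↦ dist p y) y)) ∘ γ) t
      = sn c t ^ 4 * LinearMap.trace ℝ _
        ((shape E (fun y ↦ dist p y) (γ t) - (cs c t / sn c t) •
            perpProj (grad (fun y ↦ dist p y) (γ t))) ∘ₗ
          (shape E (fun y ↦ dist p y) (γ t) - (cs c t / sn c t) •
            perpProj (grad (fun y ↦ dist p y) (γ t)))) := by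
  have h := trace_sq_sub (T := LinearMap.id) (S.norm_eq ht) (S.isSymmetric_shape ht)
    (S.shape_grad ht) (cs c t / sn c t)
  simp only [LinearMap.id_comp] at h
  rw [h, trace_perpProj (S.norm_eq ht)]
  have hfr : Module.finrank ℝ (TangentSpace 𝓘(ℝ, E) (γ t)) = Module.finrank ℝ E := rfl
  rw [hfr, deviationFun]
  simp only [Function.comp_apply]
  field_simp

/-- A lower bound for the deviation of the shape operator from its value in the model space. -/
theorem inner_deviation_ge (S : RadialSetting η T p γ ℓ δ c) (ht : t ∈ Ioc 0 ℓ) {κ s b : ℝ}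
    (hb : 0 ≤ b) (hκ : s - b ≤ κ)
    (h : ∀ u : TangentSpace 𝓘(ℝ, E) (γ t), ⟪radial p (γ t), u⟫_ℝ = 0 →
      κ * ‖u‖ ^ 2 ≤ ⟪leviCivita (radial p) (γ t) u, u⟫_ℝ) (v : TangentSpace 𝓘(ℝ, E) (γ t)) :
    -b * ‖v‖ ^ 2 ≤ ⟪(shape E (fun y ↦ dist p y) (γ t)
      - s • perpProj (grad (fun y ↦ dist p y) (γ t)) :
        TangentSpace 𝓘(ℝ, E) (γ t) →ₗ[ℝ] TangentSpace 𝓘(ℝ, E) (γ t)) v, v⟫_ℝ := by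
  set A := shape E (fun y ↦ dist p y) (γ t) with hA
  set X := grad (E := E) (fun y ↦ dist p y) (γ t) with hX
  set w := perpProj X v with hw
  have hX1 : ‖X‖ = 1 := S.norm_eq ht
  have h1 : κ * ‖w‖ ^ 2 ≤ ⟪A w, w⟫_ℝ := h w (by
    rw [real_inner_comm]; exact inner_perpProj_self hX1 v)
  have h2 : ⟪A w, w⟫_ℝ = ⟪A v, v⟫_ℝ := by
    rw [hw, ← LinearMap.comp_apply, comp_perpProj (S.shape_grad ht), ← inner_perpProj,
      ← LinearMap.comp_apply, perpProj_comp (S.isSymmetric_shape ht) (S.shape_grad ht)]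
  have h3 : ⟪w, v⟫_ℝ = ‖w‖ ^ 2 := by
    rw [← real_inner_self_eq_norm_sq, hw, ← inner_perpProj, ← LinearMap.comp_apply,
      perpProj_comp_self hX1]
  have h4 : ‖w‖ ^ 2 ≤ ‖v‖ ^ 2 := by
    have h5 : ‖w‖ ^ 2 = ‖v‖ ^ 2 - ⟪X, v⟫_ℝ ^ 2 := by
      rw [← h3, hw, perpProj_apply, inner_sub_left, real_inner_smul_left,
        real_inner_self_eq_norm_sq]
      ring
    rw [h5]
    linarith [sq_nonneg ⟪X, v⟫_ℝ]
  rw [LinearMap.sub_apply, LinearMap.smul_apply, inner_sub_left, real_inner_smul_left, ← hw, h3,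
    ← h2]
  nlinarith [mul_nonneg (sub_nonneg.2 hκ) (sq_nonneg ‖w‖), mul_le_mul_of_nonneg_left h4 hb]

/-- If the radial curvatures are equal to `c` and the shape operators satisfy a lower bound of order
`1 / t` near the centre, the shape operators are umbilical with the factor of the model space: the
trace of the square of the deviation satisfies a differential inequality that forces it to vanish. -/
theorem umbilical_of_curvature (S : RadialSetting η T p γ ℓ δ c) (hr : r ∈ Ioc 0 ℓ)
    (hE : 1 ≤ Module.finrank ℝ E)
    (hsn : ∀ t ∈ Ioc 0 r, 0 < sn c t) (hcs : ∀ t ∈ Ioc 0 r, 0 ≤ cs c t)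
    (hbar : ∃ κ > 0, ∃ t₀ > 0, t₀ ≤ ℓ ∧ ∀ t ∈ Ioo 0 t₀, ∀ u : TangentSpace 𝓘(ℝ, E) (γ t),
      ⟪radial p (γ t), u⟫_ℝ = 0 → κ / t * ‖u‖ ^ 2 ≤ ⟪leviCivita (radial p) (γ t) u, u⟫_ℝ)
    (hR : ∀ t ∈ Ioc 0 r, ∀ u : TangentSpace 𝓘(ℝ, E) (γ t), ⟪u, radial p (γ t)⟫_ℝ = 0 → ‖u‖ = 1 →
      ⟪curvature (γ t) (radial p (γ t)) u (radial p (γ t)), u⟫_ℝ = c) (ht : t ∈ Ioc 0 r) :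
    shape E (fun y ↦ dist p y) (γ t)
      = (cs c t / sn c t) • perpProj (grad (fun y ↦ dist p y) (γ t)) := by
  set N := (Module.finrank ℝ E : ℝ) - 1 with hN
  have hN0 : 0 ≤ N := by
    have : (1 : ℝ) ≤ Module.finrank ℝ E := by exact_mod_cast hE
    linarith
  have hfr : ∀ t, Module.finrank ℝ (TangentSpace 𝓘(ℝ, E) (γ t)) = Module.finrank ℝ E := fun _ ↦ rfl
  have hsub : Ioc 0 r ⊆ Ioc 0 ℓ := Ioc_subset_Ioc_right hr.2
  have hmono : Icc 0 r ⊆ Icc 0 ℓ := Icc_subset_Icc_right hr.2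
  set A : ∀ t, TangentSpace 𝓘(ℝ, E) (γ t) →ₗ[ℝ] TangentSpace 𝓘(ℝ, E) (γ t) :=
    fun t ↦ shape E (fun y ↦ dist p y) (γ t) with hA
  set B : ∀ t, TangentSpace 𝓘(ℝ, E) (γ t) →ₗ[ℝ] TangentSpace 𝓘(ℝ, E) (γ t) :=
    fun t ↦ A t - (cs c t / sn c t) • perpProj (grad (fun y ↦ dist p y) (γ t)) with hB
  have hBs : ∀ t ∈ Ioc 0 r, (B t).IsSymmetric := fun t ht ↦
    isSymmetric_sub_smul (S.isSymmetric_shape (hsub ht)) _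
  set τ₁ : ℝ → ℝ := (fun y ↦ LinearMap.trace ℝ _ (shape E (fun y ↦ dist p y) y)) ∘ γ with hτ₁
  set τ₂ : ℝ → ℝ := (fun y ↦ LinearMap.trace ℝ _
    (shape E (fun y ↦ dist p y) y ∘ₗ shape E (fun y ↦ dist p y) y)) ∘ γ with hτ₂
  have hRP : ∀ t (ht : t ∈ Ioc 0 r), radialCurvature (E := E) (fun y ↦ dist p y) (γ t)
      (diffEndo_shape (contMDiffAt_dist S.cut (hsub ht)))
      = c • perpProj (grad (fun y ↦ dist p y) (γ t)) := fun t ht ↦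
    radialCurvature_eq_smul (contMDiffAt_dist S.cut (hsub ht)) (eventually_norm_grad_dist S.geodesic S.cut (hsub ht)) (hR t ht)
  have hd1 : ∀ t ∈ Ioc 0 r, HasDerivWithinAt τ₁ (-τ₂ t - c * N) (Icc 0 r) t := by
    intro t ht
    have hρ := contMDiffAt_dist S.cut (hsub ht)
    refine ((hasDerivWithinAt_radial S.geodesic S.cut (hsub ht)
      (diffEndo_shape hρ).mdiffAt_trace).mono hmono).congr_deriv ?_
    refine (mvfderiv_trace_shape hρ).trans ?_
    rw [hRP t ht, map_smul, trace_perpProj (S.norm_eq (hsub ht)), hfr]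
    rfl
  have hd2 : ∀ t ∈ Ioc 0 r, HasDerivWithinAt τ₂
      (-2 * LinearMap.trace ℝ _ (A t ∘ₗ A t ∘ₗ A t) - 2 * (c * τ₁ t)) (Icc 0 r) t := by
    intro t ht
    have hρ := contMDiffAt_dist S.cut (hsub ht)
    refine ((hasDerivWithinAt_radial S.geodesic S.cut (hsub ht)
      ((diffEndo_shape hρ).comp (diffEndo_shape hρ)).mdiffAt_trace).mono hmono).congr_deriv ?_
    refine (mvfderiv_trace_shape_sq hρ).trans ?_
    rw [hRP t ht, LinearMap.comp_smul, comp_perpProj (S.shape_grad (hsub ht)), map_smul]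
    rfl
  set w := deviationFun N c τ₁ τ₂ with hw
  have hweq : ∀ t ∈ Ioc 0 r, w t = sn c t ^ 4 * LinearMap.trace ℝ _ (B t ∘ₗ B t) := fun t ht ↦
    S.deviationFun_eq (hsub ht) (hsn t ht)
  have hwd : ∀ t ∈ Ioc 0 r, HasDerivWithinAt w
      (-2 * sn c t ^ 4 * LinearMap.trace ℝ _ (B t ∘ₗ B t ∘ₗ B t)) (Icc 0 r) t := by
    intro t ht
    refine (hasDerivWithinAt_deviationFun (hd1 t ht) (hd2 t ht) (hsn t ht).ne').congr_deriv ?_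
    rw [trace_cube_sub (S.norm_eq (hsub ht)) (S.isSymmetric_shape (hsub ht))
      (S.shape_grad (hsub ht)), hfr]
    rfl
  -- a bound `-b` from below on the deviation gives the differential inequality with factor `2 b`
  have hstep : ∀ t ∈ Ioc 0 r, ∀ b : ℝ,
      -b * LinearMap.trace ℝ _ (B t ∘ₗ B t) ≤ LinearMap.trace ℝ _ (B t ∘ₗ B t ∘ₗ B t) →
      -2 * sn c t ^ 4 * LinearMap.trace ℝ _ (B t ∘ₗ B t ∘ₗ B t) ≤ 2 * b * w t := by
    intro t ht b hb
    rw [hweq t ht]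
    have := mul_le_mul_of_nonneg_left hb (pow_pos (hsn t ht) 4).le
    linarith
  obtain ⟨κ, hκ, t₀, ht₀, -, hbar⟩ := hbar
  set k := min κ 1 / 2 with hk
  have hk0 : 0 < k := half_pos (lt_min hκ one_pos)
  have hk1 : k ≤ 1 / 2 := div_le_div_of_nonneg_right (min_le_right _ _) two_pos.le
  have hkκ : 2 * k ≤ κ := by rw [hk]; linarith [min_le_left κ 1]
  have hlim1 : ∀ᶠ t in 𝓝[>] (0 : ℝ), cs c t < (1 + k) * (sn c t / t) := by
    have h1 : Tendsto (fun t ↦ (1 + k) * (sn c t / t)) (𝓝[>] 0) (𝓝 ((1 + k) * 1)) :=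
      (tendsto_sn_div c).const_mul _
    have h2 : Tendsto (cs c) (𝓝[>] 0) (𝓝 1) := by
      have := (continuous_cs c).tendsto 0
      rw [cs_zero] at this
      exact this.mono_left nhdsWithin_le_nhds
    exact h2.eventually_lt h1 (by linarith)
  have hlim2 : ∀ᶠ t in 𝓝[>] (0 : ℝ), sn c t / t < 2 :=
    (tendsto_sn_div c).eventually_lt_const (by norm_num)
  have hlim3 : ∀ᶠ t in 𝓝[>] (0 : ℝ), cs c t < 2 := by
    have := (continuous_cs c).tendsto 0
    rw [cs_zero] at this
    exact (this.mono_left nhdsWithin_le_nhds).eventually_lt_const (by norm_num)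
  obtain ⟨t₂, ht₂, hlim⟩ := (mem_nhdsGT_iff_exists_Ioc_subset).1
    (hlim1.and (hlim2.and hlim3))
  have ht₂' : 0 < t₂ := ht₂
  set t₁ := min (min (t₀ / 2) t₂) r with ht₁
  have ht₁0 : 0 < t₁ := lt_min (lt_min (half_pos ht₀) ht₂') hr.1
  have ht₁r : t₁ ≤ r := min_le_right _ _
  have hsub1 : Ioc 0 t₁ ⊆ Ioc 0 r := Ioc_subset_Ioc_right ht₁r
  have hnear0 : ∀ t ∈ Ioc 0 t₁, t ∈ Ioo 0 t₀ := fun t ht ↦ ⟨ht.1, by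
    have := ht.2.trans ((min_le_left _ _).trans (min_le_left _ _))
    linarith⟩
  have hnearlim : ∀ t ∈ Ioc 0 t₁, cs c t < (1 + k) * (sn c t / t) ∧ sn c t / t < 2 ∧ cs c t < 2 :=
    fun t ht ↦ hlim ⟨ht.1, ht.2.trans ((min_le_left _ _).trans (min_le_right _ _))⟩
  have hnear : ∀ t ∈ Ioc 0 t₁, -2 * sn c t ^ 4 * LinearMap.trace ℝ _ (B t ∘ₗ B t ∘ₗ B t)
      ≤ 2 * ((1 - k) / t) * w t := by
    intro t ht
    have htr := hsub1 ht
    refine hstep t htr _ (trace_cube_ge (hBs t htr) ?_)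
    refine S.inner_deviation_ge (hsub htr) (div_nonneg (by linarith) ht.1.le) ?_
      (hbar t (hnear0 t ht))
    have h1 : cs c t / sn c t ≤ (1 + k) / t := by
      rw [div_le_div_iff₀ (hsn t htr) ht.1]
      have := (hnearlim t ht).1.le
      rw [mul_div_assoc', le_div_iff₀ ht.1] at this
      exact this
    have h2 : (1 + k) / t - (1 - k) / t = 2 * k / t := by ring
    have h3 : 2 * k / t ≤ κ / t := div_le_div_of_nonneg_right hkκ ht.1.le
    linarith
  -- an upper bound `K / t` for the trace of the shape operator
  have hRic : RiccatiInequality N 1 c 0 r τ₁ (fun t ↦ -τ₂ t - c * N) 0 0 :=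
    { deriv_H := hd1
      deriv_e := fun t _ ↦ (hasDerivAt_const t (0 : ℝ)).hasDerivWithinAt
      bdd_e := ⟨0, by simp⟩
      bdd_e' := ⟨0, by simp⟩
      le := fun t ht s ↦ by
        have h1 := two_mul_trace_sub_le (T := LinearMap.id) (δ := 1) (S.norm_eq (hsub ht))
          (S.isSymmetric_shape (hsub ht)) (S.shape_grad (hsub ht))
          (fun v ↦ real_inner_self_nonneg) (fun v ↦ by simp) s
        rw [hfr] at h1
        simp only [LinearMap.id_comp] at h1
        have h2 : 2 * s * τ₁ t - s ^ 2 * (N * 1) ≤ τ₂ t := h1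
        simp only [Pi.zero_apply]
        linarith
      N_nonneg := hN0
      δ_nonneg := zero_le_one
      m_nonneg := le_rfl
      m_le := zero_le_one }
  obtain ⟨K, hK⟩ := hRic.exists_le_div
  have hC : ∀ t ∈ Ioc 0 t₁, w t ≤ (16 * K ^ 2 + 16 * N) * t ^ 2 := by
    intro t ht
    have htr := hsub1 ht
    have hpos : ∀ v, 0 ≤ ⟪A t v, v⟫_ℝ := fun v ↦ by
      have h1 := S.inner_deviation_ge (s := 0) (b := 0) (hsub htr) le_rfl
        (by rw [sub_zero]; exact div_nonneg hκ.le ht.1.le) (hbar t (hnear0 t ht)) v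
      rw [zero_smul, sub_zero] at h1
      linarith
    obtain ⟨h1, h2⟩ := trace_sq_le_of_nonneg (S.isSymmetric_shape (hsub htr)) hpos
    have h1' : 0 ≤ τ₁ t := h1
    have h2' : τ₂ t ≤ τ₁ t ^ 2 := h2
    have h3 : τ₁ t * t ≤ K := (le_div_iff₀ ht.1).1 (hK t htr)
    have h4 : sn c t ≤ 2 * t := ((div_lt_iff₀ ht.1).1 (hnearlim t ht).2.1).le
    have h5 := hsn t htr
    have h6 := hcs t htr
    have h7 := (hnearlim t ht).2.2.le
    have h8 : sn c t ^ 2 ≤ 4 * t ^ 2 := by nlinarith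
    have h9 : cs c t ^ 2 ≤ 4 := by nlinarith
    have h10 : (τ₁ t * t) ^ 2 ≤ K ^ 2 := pow_le_pow_left₀ (mul_nonneg h1' ht.1.le) h3 2
    have h11 : sn c t ^ 4 * τ₂ t ≤ 16 * K ^ 2 * t ^ 2 := by
      calc sn c t ^ 4 * τ₂ t ≤ sn c t ^ 4 * τ₁ t ^ 2 := by gcongr
        _ = (sn c t ^ 2) ^ 2 * τ₁ t ^ 2 := by ring
        _ ≤ (4 * t ^ 2) ^ 2 * τ₁ t ^ 2 := by gcongr
        _ = 16 * (τ₁ t * t) ^ 2 * t ^ 2 := by ring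
        _ ≤ 16 * K ^ 2 * t ^ 2 := by gcongr
    have h12 : N * (sn c t ^ 2 * cs c t ^ 2) ≤ N * ((4 * t ^ 2) * 4) := by gcongr
    have h13 : 0 ≤ 2 * (sn c t ^ 3 * cs c t) * τ₁ t := by positivity
    rw [hw, deviationFun]
    linarith
  have hfar : ∃ K, ∀ t ∈ Icc t₁ r,
      -2 * sn c t ^ 4 * LinearMap.trace ℝ _ (B t ∘ₗ B t ∘ₗ B t) ≤ K * w t := by
    have hsub2 : Icc t₁ r ⊆ Ioc 0 r := fun s hs ↦ ⟨ht₁0.trans_le hs.1, hs.2⟩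
    have hcont : ContinuousOn (fun t ↦ w t / sn c t ^ 4) (Icc t₁ r) := by
      refine ContinuousOn.div (fun s hs ↦ (hwd s (hsub2 hs)).continuousWithinAt.mono
        (hsub2.trans Ioc_subset_Icc_self)) ((continuous_sn c).pow 4).continuousOn fun s hs ↦ ?_
      exact (pow_pos (hsn s (hsub2 hs)) 4).ne'
    obtain ⟨D, hD⟩ := isCompact_Icc.exists_bound_of_continuousOn hcont
    have hD0 : 0 ≤ D := (norm_nonneg _).trans (hD r (right_mem_Icc.2 ht₁r))
    refine ⟨2 * (D + 1), fun t ht ↦ ?_⟩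
    have htr := hsub2 ht
    refine hstep t htr _ (trace_cube_ge_of_trace_sq_le (hBs t htr) (by linarith) ?_)
    have h1 := (le_abs_self _).trans (hD t ht)
    rw [hweq t htr, mul_div_cancel_left₀ _ (pow_pos (hsn t htr) 4).ne'] at h1
    nlinarith
  have hzero := eq_zero_of_deriv_le hk0 ht₁0 ht₁r hwd (fun t ht ↦ by
    rw [hweq t ht]
    exact mul_nonneg (pow_pos (hsn t ht) 4).le (trace_sq_nonneg (hBs t ht))) hnear hC hfar ht
  rw [hweq t ht] at hzero
  have h1 := (mul_eq_zero.1 hzero).resolve_left (pow_pos (hsn t ht) 4).ne'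
  have h2 := trace_sq_sub (T := LinearMap.id) (S.norm_eq (hsub ht))
    (S.isSymmetric_shape (hsub ht)) (S.shape_grad (hsub ht)) (cs c t / sn c t)
  simp only [LinearMap.id_comp] at h2
  rw [trace_perpProj (S.norm_eq (hsub ht)), hfr] at h2
  refine (umbilical_of_trace_eq (T := LinearMap.id) (δ := 1) (S.norm_eq (hsub ht))
    (S.isSymmetric_shape (hsub ht)) (S.shape_grad (hsub ht)) (fun u v ↦ rfl)
    (fun v hv ↦ real_inner_self_pos.2 hv) (fun v ↦ by simp) ?_).1
  rw [hfr]
  simp only [LinearMap.id_comp]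
  linarith [h1.symm.trans h2]

/-- The converse in the case of equality. -/
theorem eq_of_curvature (S : RadialSetting η T p γ ℓ δ c)
    (hE : 1 ≤ Module.finrank ℝ E) {m : ℝ}
    (hm : ∀ t ∈ Ioc 0 ℓ, T (γ t) (grad (fun y ↦ dist p y) (γ t))
      = m • grad (fun y ↦ dist p y) (γ t)) (hr : r ∈ Ioc 0 ℓ)
    (hsn : ∀ t ∈ Ioc 0 r, 0 < sn c t) (hcs : ∀ t ∈ Ioc 0 r, 0 ≤ cs c t)
    (hbar : ∃ κ > 0, ∃ t₀ > 0, t₀ ≤ ℓ ∧ ∀ t ∈ Ioo 0 t₀, ∀ u : TangentSpace 𝓘(ℝ, E) (γ t),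
      ⟪radial p (γ t), u⟫_ℝ = 0 → κ / t * ‖u‖ ^ 2 ≤ ⟪leviCivita (radial p) (γ t) u, u⟫_ℝ)
    (hR : ∀ t ∈ Ioc 0 r, ∀ u : TangentSpace 𝓘(ℝ, E) (γ t), ⟪u, radial p (γ t)⟫_ℝ = 0 → ‖u‖ = 1 →
      ⟪curvature (γ t) (radial p (γ t)) u (radial p (γ t)), u⟫_ℝ = c)
    (he : ∀ t ∈ Ioc 0 r, mvfderiv 𝓘(ℝ, E) η (γ t) (radial p (γ t)) = -a)
    (hT : c ≤ 0 → ∀ u : TangentSpace 𝓘(ℝ, E) (γ r), ⟪u, radial p (γ r)⟫_ℝ = 0 → T (γ r) u = δ • u)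
    (hma : m * a = δ * a) :
    traceMeanCurvature η T (fun y ↦ dist p y) (γ r)
      = ((Module.finrank ℝ E : ℝ) - 1) * δ * (cs c r / sn c r) + δ * a := by
  have hrr : r ∈ Ioc 0 r := right_mem_Ioc.2 hr.1
  have hsub : Ioc 0 r ⊆ Ioc 0 ℓ := Ioc_subset_Ioc_right hr.2
  have hmono : Icc 0 r ⊆ Icc 0 ℓ := Icc_subset_Icc_right hr.2
  have hfr : Module.finrank ℝ (TangentSpace 𝓘(ℝ, E) (γ r)) = Module.finrank ℝ E := rfl
  have htr : LinearMap.trace ℝ _ ((T (γ r)).toLinearMap ∘ₗ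
      perpProj (grad (fun y ↦ dist p y) (γ r))) = ((Module.finrank ℝ E : ℝ) - 1) * δ := by
    rcases le_or_gt c 0 with hc | hc
    · have h1 : (T (γ r)).toLinearMap ∘ₗ perpProj (grad (fun y ↦ dist p y) (γ r))
          = δ • perpProj (grad (fun y ↦ dist p y) (γ r)) := LinearMap.ext fun v ↦
        hT hc _ (inner_perpProj_self (S.norm_eq hr) v)
      rw [h1, map_smul, trace_perpProj (S.norm_eq hr), hfr, smul_eq_mul, mul_comm]
    · -- for `c > 0` the curvature bound forces `T` to attain its upper bound on the hyperplane
      refine le_antisymm (trace_comp_perpProj_le (S.norm_eq hr) (S.le (γ r))) ?_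
      have hρ := contMDiffAt_dist S.cut hr
      have hRP := radialCurvature_eq_smul hρ (eventually_norm_grad_dist S.geodesic S.cut hr)
        (hR r hrr)
      have d1 := (S.hasDerivWithinAt_traceMeanCurvature hr).mono hmono
      have d2 := ((hasDerivWithinAt_radial S.geodesic S.cut hr
        ((S.diffEndo _).comp (diffEndo_shape hρ)).mdiffAt_trace).mono hmono).add_const (m * a)
      have h1 := mvfderiv_trace_comp_shape hρ (S.diffEndo _) (S.par r hr)
      rw [hRP, LinearMap.comp_smul, map_smul, smul_eq_mul] at h1
      have h2 := ((uniqueDiffOn_Ioc 0 r) r hrr).eq_deriv _ (d1.mono Ioc_subset_Icc_self)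
        ((d2.mono Ioc_subset_Icc_self).congr (fun t ht ↦ ?_) ?_)
      · have h3 := h2.trans h1
        have h4 := S.ricci r hr
        have h5 : c * (((Module.finrank ℝ E : ℝ) - 1) * δ) ≤ c * LinearMap.trace ℝ _
          ((T (γ r)).toLinearMap ∘ₗ perpProj (grad (fun y ↦ dist p y) (γ r))) := by linarith
        exact le_of_mul_le_mul_left h5 hc
      · refine (S.traceMeanCurvature_eq hm (hsub ht)).trans ?_
        rw [he t ht]
        simp only [Function.comp_apply]
        rw [mul_neg, sub_neg_eq_add]
        rfl
      · refine (S.traceMeanCurvature_eq hm hr).trans ?_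
        rw [he r hrr]
        simp only [Function.comp_apply]
        rw [mul_neg, sub_neg_eq_add]
        rfl
  rw [S.traceMeanCurvature_eq hm hr, he r hrr, S.umbilical_of_curvature hr hE hsn hcs hbar hR hrr,
    LinearMap.comp_smul, map_smul, htr, smul_eq_mul]
  linarith

end RadialSetting

end UmbilicalSpheres

/-! ### Bounds in terms of the radius -/

section Radius

variable {N δ c m ℓ k r t : ℝ} {H H' e e' : ℝ → ℝ}

theorem sn_of_pos (hc : 0 < c) (t : ℝ) : sn c t = Real.sin (√c * t) / √c := by
  rw [sn, if_pos hc]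

theorem cs_of_pos (hc : 0 < c) (t : ℝ) : cs c t = Real.cos (√c * t) := by
  rw [cs, if_pos hc]

theorem sqrt_mul_le_of_le_div {d : ℝ} (hd : 0 < d) (h : 0 < c → r ≤ Real.pi / (d * √c)) (hc : 0 < c) :
    √c * r ≤ Real.pi / d := by
  have h1 := (le_div_iff₀ (mul_pos hd (Real.sqrt_pos.2 hc))).1 (h hc)
  rw [le_div_iff₀ hd]
  linarith

theorem sn_pos_of_le (h : 0 < c → r ≤ Real.pi / (2 * √c)) (ht : t ∈ Ioc 0 r) : 0 < sn c t := by
  refine sn_pos ht.1 fun hc ↦ ?_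
  have h1 := sqrt_mul_le_of_le_div two_pos (fun hc ↦ ht.2.trans (h hc)) hc
  linarith [Real.pi_pos]

theorem cs_nonneg_of_le (h : 0 < c → r ≤ Real.pi / (2 * √c)) (ht : t ∈ Ioc 0 r) : 0 ≤ cs c t :=
  cs_nonneg ht.1.le (sqrt_mul_le_of_le_div two_pos fun hc ↦ ht.2.trans (h hc))

theorem cs_pos_of_lt (h : 0 < c → t < Real.pi / (2 * √c)) (ht : 0 < t) : 0 < cs c t := by
  refine cs_pos ht.le fun hc ↦ ?_
  have h1 := (lt_div_iff₀ (mul_pos two_pos (Real.sqrt_pos.2 hc))).1 (h hc)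
  linarith

theorem div_four_le_div_two : Real.pi / (4 * √c) ≤ Real.pi / (2 * √c) := by
  rcases (Real.sqrt_nonneg c).eq_or_lt with h | h
  · rw [← h]; simp
  · have := Real.pi_pos
    gcongr
    norm_num

theorem cs_sq_sub_nonneg (h : 0 < c → r ≤ Real.pi / (4 * √c)) (ht : t ∈ Ioc 0 r) :
    0 ≤ cs c t ^ 2 - c * sn c t ^ 2 := by
  rw [cs_sq_sub]
  refine cs_nonneg (by linarith [ht.1]) fun hc ↦ ?_
  have := sqrt_mul_le_of_le_div four_pos (fun hc ↦ ht.2.trans (h hc)) hc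
  linarith

namespace RiccatiInequality

theorem le_of_abs_weight_le_of_le (h : RiccatiInequality N δ c m ℓ H H' e e') (hr : r ∈ Ioc 0 ℓ)
    (hk : ∀ t ∈ Ioc 0 ℓ, |e t| ≤ k) (hc : 0 < c → r ≤ Real.pi / (4 * √c)) :
    H r ≤ δ * ((N + 4 * k) * (cs c r / sn c r)) :=
  have hc2 := fun hc0 ↦ (hc hc0).trans div_four_le_div_two
  h.le_of_abs_weight_le hr hk (fun _ ↦ sn_pos_of_le hc2)
    (cs_nonneg_of_le hc2 (right_mem_Ioc.2 hr.1)) fun _ ↦ cs_sq_sub_nonneg hc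

/-- The estimate beyond `π / (4 √c)`, where `sn c * cs c` takes the value `1 / (2 √c)`. -/
theorem sn_sq_mul_le_of_abs_weight_le (h : RiccatiInequality N δ c m ℓ H H' e e') (hr : r ∈ Ioc 0 ℓ)
    (hk : ∀ t ∈ Ioc 0 ℓ, |e t| ≤ k) (hc : 0 < c) (hr1 : Real.pi / (4 * √c) ≤ r)
    (hr2 : r ≤ Real.pi / (2 * √c)) :
    sn c r ^ 2 * H r ≤ N * δ * (sn c r * cs c r) + 2 * δ * k / √c := by
  have hsq : 0 < √c := Real.sqrt_pos.2 hc
  have hr0 : 0 < Real.pi / (4 * √c) := div_pos Real.pi_pos (by positivity)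
  have hrr := right_mem_Ioc.2 hr.1
  have h1 := h.le_of_abs_weight_le' hr0 hr1 hr.2 hk (fun _ ↦ sn_pos_of_le fun _ ↦ hr2)
    (cs_nonneg_of_le (fun _ ↦ hr2) hrr) (cs_nonneg_of_le (fun _ ↦ hr2) ⟨hr0, hr1⟩)
    (fun _ ↦ cs_sq_sub_nonneg fun _ ↦ le_rfl) fun t ht ↦ ?_
  · have h2 : √c * (Real.pi / (4 * √c)) = Real.pi / 4 := by field_simp
    have h3 : √2 * √2 = 2 := Real.mul_self_sqrt two_pos.le
    have h4 : sn c (Real.pi / (4 * √c)) * cs c (Real.pi / (4 * √c)) = 1 / 2 / √c := by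
      rw [sn_of_pos hc, cs_of_pos hc, h2, Real.sin_pi_div_four, Real.cos_pi_div_four]
      field_simp
      linarith
    rw [h4] at h1
    refine h1.trans (le_of_eq ?_)
    ring
  · rw [cs_sq_sub, cs_of_pos hc]
    have h2 := (div_le_iff₀ (by positivity)).1 ht.1
    have h3 := sqrt_mul_le_of_le_div two_pos (fun _ ↦ ht.2.trans hr2) hc
    exact Real.cos_nonpos_of_pi_div_two_le_of_le (by linarith) (by linarith [Real.pi_pos])

theorem le_of_abs_weight_le_of_lt (h : RiccatiInequality N δ c m ℓ H H' e e') (hN : 0 < N)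
    (hr : r ∈ Ioc 0 ℓ) (hk : ∀ t ∈ Ioc 0 ℓ, |e t| ≤ k) (hc : 0 < c)
    (hr1 : Real.pi / (4 * √c) ≤ r) (hr2 : r < Real.pi / (2 * √c)) :
    H r ≤ (1 + 4 * k / N * (1 / Real.sin (2 * √c * r))) * δ * (N * (cs c r / sn c r)) := by
  have h1 := h.sn_sq_mul_le_of_abs_weight_le hr hk hc hr1 hr2.le
  have hsq : 0 < √c := Real.sqrt_pos.2 hc
  have hs := sn_pos_of_le (fun _ ↦ hr2.le) (right_mem_Ioc.2 hr.1)
  have hcs := cs_pos_of_lt (fun _ ↦ hr2) hr.1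
  have h2 : Real.sin (2 * √c * r) = 2 * √c * sn c r * cs c r := by
    rw [mul_assoc, Real.sin_two_mul, sn_of_pos hc, cs_of_pos hc]
    field_simp
  rw [h2]
  have h3 : (1 + 4 * k / N * (1 / (2 * √c * sn c r * cs c r))) * δ * (N * (cs c r / sn c r))
      = (N * δ * (sn c r * cs c r) + 2 * δ * k / √c) / sn c r ^ 2 := by
    field_simp
    ring
  rw [h3, le_div_iff₀ (pow_pos hs 2)]
  linarith

theorem le_of_abs_weight_le_of_eq (h : RiccatiInequality N δ c m ℓ H H' e e')
    (hr : r ∈ Ioc 0 ℓ) (hk : ∀ t ∈ Ioc 0 ℓ, |e t| ≤ k) (hc : 0 < c)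
    (hr1 : r = Real.pi / (2 * √c)) : H r ≤ 2 * k * √c * δ := by
  have h1 := h.sn_sq_mul_le_of_abs_weight_le hr hk hc (hr1 ▸ div_four_le_div_two) hr1.le
  have hsq : 0 < √c := Real.sqrt_pos.2 hc
  have h2 : √c * r = Real.pi / 2 := by rw [hr1]; field_simp
  rw [sn_of_pos hc, cs_of_pos hc, h2, Real.sin_pi_div_two, Real.cos_pi_div_two] at h1
  have h3 := mul_le_mul_of_nonneg_left h1 (sq_nonneg √c)
  have h4 : √c ^ 2 * ((1 / √c) ^ 2 * H r) = H r := by field_simp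
  have h5 : √c ^ 2 * (N * δ * (1 / √c * 0) + 2 * δ * k / √c) = 2 * k * √c * δ := by
    field_simp
    ring
  rwa [h4, h5] at h3

end RiccatiInequality

end Radius

/-! ### Comparison along a radial geodesic -/

section Comparison

variable [IsRiemannianManifold 𝓘(ℝ, E) M] {p : M} {γ : ℝ → M} {ℓ δ c a r : ℝ} {η : M → ℝ}
  {T : Π x : M, TangentSpace 𝓘(ℝ, E) x →L[ℝ] TangentSpace 𝓘(ℝ, E) x}

namespace RadialSetting

theorem meanCurvature_le (S : RadialSetting η T p γ ℓ δ c) (hδ : 0 < δ)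
    (hE : 1 ≤ Module.finrank ℝ E) (ha : 0 ≤ a)
    (he : ∀ t ∈ Ioc 0 ℓ, -a ≤ mvfderiv 𝓘(ℝ, E) η (γ t) (radial p (γ t))) (hr : r ∈ Ioc 0 ℓ)
    (hc : 0 < c → r ≤ Real.pi / (2 * √c)) :
    meanCurvature η T p (γ r) ≤ δ * (modelMeanCurvature c (Module.finrank ℝ E) r + a) := by
  obtain ⟨m, hm0, hmδ, hm⟩ := S.exists_eigenvalue (hr.1.trans_le hr.2)
  rw [S.meanCurvature_eq hr, modelMeanCurvature_eq]
  refine ((S.riccatiInequality hδ hE hm0 hmδ hm).le_of_deriv_weight hr ha he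
    (fun _ ↦ sn_pos_of_le hc) fun _ ↦ cs_nonneg_of_le hc).trans (le_of_eq ?_)
  ring

/-- Rigidity in the comparison theorem. The assumption `hbar` is the initial condition that singles out
the shape operators of geodesic spheres among all solutions of the Riccati equation. -/
theorem meanCurvature_eq_iff (S : RadialSetting η T p γ ℓ δ c) (hδ : 0 < δ)
    (hE : 1 ≤ Module.finrank ℝ E) (ha : 0 ≤ a)
    (he : ∀ t ∈ Ioc 0 ℓ, -a ≤ mvfderiv 𝓘(ℝ, E) η (γ t) (radial p (γ t))) (hr : r ∈ Ioc 0 ℓ)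
    (hc : 0 < c → r ≤ Real.pi / (2 * √c))
    (hbar : ∃ κ > 0, ∃ t₀ > 0, t₀ ≤ ℓ ∧ ∀ t ∈ Ioo 0 t₀, ∀ u : TangentSpace 𝓘(ℝ, E) (γ t),
      ⟪radial p (γ t), u⟫_ℝ = 0 → κ / t * ‖u‖ ^ 2 ≤ ⟪leviCivita (radial p) (γ t) u, u⟫_ℝ) :
    meanCurvature η T p (γ r) = δ * (modelMeanCurvature c (Module.finrank ℝ E) r + a) ↔
      ∀ t ∈ Ioc 0 r,
        (∀ u : TangentSpace 𝓘(ℝ, E) (γ t), ⟪u, radial p (γ t)⟫_ℝ = 0 → ‖u‖ = 1 →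
          ⟪curvature (γ t) (radial p (γ t)) u (radial p (γ t)), u⟫_ℝ = c) ∧
        mvfderiv 𝓘(ℝ, E) η (γ t) (radial p (γ t)) = -a ∧
        (c ≤ 0 → ∀ u : TangentSpace 𝓘(ℝ, E) (γ t), ⟪u, radial p (γ t)⟫_ℝ = 0 →
          T (γ t) u = δ • u) ∧
        (a ≠ 0 → T (γ t) (radial p (γ t)) = δ • radial p (γ t)) := by
  obtain ⟨m, hm0, hmδ, hm⟩ := S.exists_eigenvalue (hr.1.trans_le hr.2)
  have hrr := right_mem_Ioc.2 hr.1
  have hsub : Ioc 0 r ⊆ Ioc 0 ℓ := Ioc_subset_Ioc_right hr.2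
  have hsn : ∀ t ∈ Ioc 0 r, 0 < sn c t := fun _ ↦ sn_pos_of_le hc
  have hcs : ∀ t ∈ Ioc 0 r, 0 ≤ cs c t := fun _ ↦ cs_nonneg_of_le hc
  have hbound : δ * (modelMeanCurvature c (Module.finrank ℝ E) r + a)
      = ((Module.finrank ℝ E : ℝ) - 1) * δ * (cs c r / sn c r) + δ * a := by
    rw [modelMeanCurvature_eq]
    ring
  rw [S.meanCurvature_eq hr, hbound]
  constructor
  · intro heq
    obtain ⟨hma, hall⟩ := S.umbilical_of_eq hδ hE hm0 hmδ hm ha he hr hsn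
      (fun t ht ↦ cs_pos_of_lt (fun hc0 ↦ ht.2.trans_le (hc hc0)) ht.1) (hcs r hrr)
      (fun hc0 ↦ cs_pos_of_lt (fun h ↦ absurd h hc0.not_gt) hr.1) heq
    refine fun t ht ↦ ⟨fun u hu hu1 ↦ ?_, (hall t ht).2.1, (hall t ht).2.2, fun ha0 ↦ ?_⟩
    · exact S.curvature_of_umbilical hr hsn (fun s hs ↦ (hall s hs).1) ht hu hu1
    · rw [← hma ha0]
      exact hm t (hsub ht)
  · intro h
    refine S.eq_of_curvature hE hm hr hsn hcs hbar (fun t ht ↦ (h t ht).1)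
      (fun t ht ↦ (h t ht).2.1) (h r hrr).2.2.1 ?_
    rcases eq_or_ne a 0 with rfl | ha0
    · simp
    · have h1 : m • grad (E := E) (fun y ↦ dist p y) (γ r) = δ • grad (fun y ↦ dist p y) (γ r) :=
        (hm r hr).symm.trans ((h r hrr).2.2.2 ha0)
      have h2 : grad (E := E) (fun y ↦ dist p y) (γ r) ≠ 0 :=
        norm_ne_zero_iff.1 (by rw [S.norm_eq hr]; exact one_ne_zero)
      rw [smul_left_injective ℝ h2 h1]

end RadialSetting

end Comparison

end RadialComparison

end

theorem theorem2 {n : ℕ} (hn : 2 ≤ n)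
    {M : Type*} [MetricSpace M] [CompleteSpace M]
    [ChartedSpace (EuclideanSpace ℝ (Fin n)) M] [IsManifold (𝓡 n) ∞ M]
    [RiemannianBundle (fun x : M ↦ TangentSpace (𝓡 n) x)]
    [IsContMDiffRiemannianBundle (𝓡 n) ∞ (EuclideanSpace ℝ (Fin n))
      (fun x : M ↦ TangentSpace (𝓡 n) x)]
    [IsRiemannianManifold (𝓡 n) M]
    -- a smooth weight and a smooth, symmetric, positive definite, divergence-free, bounded tensor
    (η : M → ℝ) (hη : ContMDiff (𝓡 n) 𝓘(ℝ, ℝ) ∞ η)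
    (T : Π x : M, TangentSpace (𝓡 n) x →L[ℝ] TangentSpace (𝓡 n) x)
    (hT : ContMDiff (𝓡 n)
      ((𝓡 n).prod 𝓘(ℝ, EuclideanSpace ℝ (Fin n) →L[ℝ] EuclideanSpace ℝ (Fin n))) ∞
      (fun x : M ↦ TotalSpace.mk' (EuclideanSpace ℝ (Fin n) →L[ℝ] EuclideanSpace ℝ (Fin n))
        (E := fun x : M ↦ TangentSpace (𝓡 n) x →L[ℝ] TangentSpace (𝓡 n) x) x (T x)))
    (hTsymm : ∀ (x : M) (u v : TangentSpace (𝓡 n) x), ⟪T x u, v⟫_ℝ = ⟪u, T x v⟫_ℝ)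
    (hTpos : ∀ (x : M) (v : TangentSpace (𝓡 n) x), v ≠ 0 → 0 < ⟪T x v, v⟫_ℝ)
    (hTdiv : ∀ (x : M) (v : TangentSpace (𝓡 n) x), RadialComparison.divTensor T x v = 0)
    (ε δ : ℝ) (hε : 0 < ε) (hδ : 0 < δ)
    (hTbdd : ∀ (x : M) (v : TangentSpace (𝓡 n) x), ‖v‖ = 1 →
      ε ≤ ⟪T x v, v⟫_ℝ ∧ ⟪T x v, v⟫_ℝ ≤ δ)
    -- a minimal geodesic segment from `p`, avoiding the cut locus of `p`
    (p : M) (γ : ℝ → M) (ℓ : ℝ)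
    (hγ : RadialComparison.IsMinimalGeodesic (EuclideanSpace ℝ (Fin n)) γ p ℓ)
    (hcut : ∀ t ∈ Ioc 0 ℓ, γ t ∈ RadialComparison.distSmoothSet (EuclideanSpace ℝ (Fin n)) p)
    -- along it, `∂_r` is an eigenvector of `T`, and `T` is radially parallel
    (hTeig : ∀ t ∈ Ioc 0 ℓ, ∃ μ : ℝ,
      T (γ t) (RadialComparison.radial p (γ t)) = μ • RadialComparison.radial p (γ t))
    (hTpar : ∀ t ∈ Ioc 0 ℓ, ∀ v : TangentSpace (𝓡 n) (γ t),
      RadialComparison.covTensor T (γ t) (RadialComparison.radial p (γ t)) v = 0)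
    -- the curvature bound
    (c : ℝ)
    (hR : ∀ t ∈ Ioc 0 ℓ, ((n : ℝ) - 1) * c * δ ≤ RadialComparison.ricciEtaT η T (γ t)
      (RadialComparison.radial p (γ t)) (RadialComparison.radial p (γ t))) :
    -- (a)
    (∀ a : ℝ, 0 ≤ a →
      (∀ t ∈ Ioc 0 ℓ, -a ≤ mvfderiv (𝓡 n) η (γ t) (RadialComparison.radial p (γ t))) →
      ∀ r ∈ Ioc 0 ℓ, (0 < c → r ≤ Real.pi / (2 * √c)) →
        RadialComparison.meanCurvature η T p (γ r)
            ≤ δ * (RadialComparison.modelMeanCurvature c n r + a) ∧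
        (RadialComparison.meanCurvature η T p (γ r)
            = δ * (RadialComparison.modelMeanCurvature c n r + a) ↔
          ∀ t ∈ Ioc 0 r,
            (∀ u : TangentSpace (𝓡 n) (γ t), ⟪u, RadialComparison.radial p (γ t)⟫_ℝ = 0 →
              ‖u‖ = 1 →
              ⟪RadialComparison.curvature (γ t) (RadialComparison.radial p (γ t)) u
                (RadialComparison.radial p (γ t)), u⟫_ℝ = c) ∧
            mvfderiv (𝓡 n) η (γ t) (RadialComparison.radial p (γ t)) = -a ∧
            -- the bound `δ` is attained (automatic orthogonally to `∂_r` if `0 < c`)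
            (c ≤ 0 → ∀ u : TangentSpace (𝓡 n) (γ t),
              ⟪u, RadialComparison.radial p (γ t)⟫_ℝ = 0 → T (γ t) u = δ • u) ∧
            (a ≠ 0 → T (γ t) (RadialComparison.radial p (γ t))
              = δ • RadialComparison.radial p (γ t)))) ∧
    -- (b)
    (∀ k : ℝ, (∀ t ∈ Ioc 0 ℓ, |η (γ t)| ≤ k) → ∀ r ∈ Ioc 0 ℓ,
      ((0 < c → r ≤ Real.pi / (4 * √c)) →
        RadialComparison.meanCurvature η T p (γ r)
          ≤ δ * RadialComparison.modelMeanCurvature c (n + 4 * k) r) ∧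
      (0 < c → Real.pi / (4 * √c) ≤ r → r < Real.pi / (2 * √c) →
        RadialComparison.meanCurvature η T p (γ r)
          ≤ (1 + 4 * k / ((n : ℝ) - 1) * (1 / Real.sin (2 * √c * r))) * δ
            * RadialComparison.modelMeanCurvature c n r) ∧
      -- at the right endpoint the bound is the limit of the preceding one
      (0 < c → r = Real.pi / (2 * √c) →
        RadialComparison.meanCurvature η T p (γ r) ≤ 2 * k * √c * δ) ∧
      (c = 0 →
        RadialComparison.meanCurvature η T p (γ r) ≤ δ * ((n + 4 * k - 1) / r) ∧
        RadialComparison.meanCurvature η T p (γ r) ≤ δ * ((n + 4 * k + 1) / r))) := by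
  have hfr : Module.finrank ℝ (EuclideanSpace ℝ (Fin n)) = n := finrank_euclideanSpace_fin
  have hn' : (2 : ℝ) ≤ n := by exact_mod_cast hn
  have hE : 1 ≤ Module.finrank ℝ (EuclideanSpace ℝ (Fin n)) := by rw [hfr]; omega
  have hle : ∀ (x : M) (v : TangentSpace (𝓡 n) x), ⟪T x v, v⟫_ℝ ≤ δ * ‖v‖ ^ 2 := by
    intro x v
    rcases eq_or_ne v 0 with rfl | hv
    · simp
    have hv' : 0 < ‖v‖ := norm_pos_iff.2 hv
    have h := (hTbdd x (‖v‖⁻¹ • v) (by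
      rw [norm_smul, norm_inv, norm_norm, inv_mul_cancel₀ hv'.ne'])).2
    rw [map_smul, real_inner_smul_left, real_inner_smul_right] at h
    field_simp at h
    linarith
  have S : RadialComparison.RadialSetting η T p γ ℓ δ c :=
    { weight := hη
      diffEndo := fun x ↦ RadialComparison.diffEndo_of_contMDiff (hT x)
      symm := hTsymm
      pos := hTpos
      div := hTdiv
      le := hle
      geodesic := hγ
      cut := hcut
      eig := hTeig
      par := hTpar
      ricci := by rw [hfr]; exact hR }
  refine ⟨fun a ha he r hr hc ↦ ?_, fun k hk r hr ↦ ?_⟩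
  · have h1 := S.meanCurvature_le hδ hE ha he hr hc
    have h2 := S.meanCurvature_eq_iff hδ hE ha he hr hc
      (RadialComparison.exists_shape_lower_bound hγ (hr.1.trans_le hr.2) hcut)
    rw [hfr] at h1 h2
    exact ⟨h1, h2⟩
  · obtain ⟨m, hm0, hmδ, hm⟩ := S.exists_eigenvalue (hr.1.trans_le hr.2)
    have h := S.riccatiInequality hδ hE hm0 hmδ hm
    rw [hfr] at h
    rw [S.meanCurvature_eq hr, RadialComparison.modelMeanCurvature_eq,
      RadialComparison.modelMeanCurvature_eq]
    have hb := h.le_of_abs_weight_le_of_le hr hk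
    refine ⟨fun hc ↦ (hb hc).trans (le_of_eq (by ring)),
      fun hc hr1 hr2 ↦ h.le_of_abs_weight_le_of_lt (by linarith) hr hk hc hr1 hr2,
      fun hc hr1 ↦ h.le_of_abs_weight_le_of_eq hr hk hc hr1, fun hc ↦ ?_⟩
    subst hc
    have h1 := hb fun hc ↦ absurd hc (lt_irrefl _)
    have h2 : RadialComparison.cs 0 r / RadialComparison.sn 0 r = 1 / r := by
      simp [RadialComparison.cs, RadialComparison.sn]
    rw [h2] at h1
    have h3 : δ * (((n : ℝ) - 1 + 4 * k) * (1 / r)) = δ * ((n + 4 * k - 1) / r) := by ring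
    refine ⟨h1.trans h3.le, (h1.trans h3.le).trans ?_⟩
    have := hr.1
    gcongr
    linarith
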